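/- Let $G:\mathbb R\to\mathbb R$ be twice continuously differentiable, not a polynomial of degree at most $2$, with $\mathrm E[G(Z)]=0$ for a standard Gaussian $Z$, and write $g=G'$. Let $z_1,z_2,\dots$ be independent copies of a random vector $z=(z^{(1)},\dots,z^{(p)})^T$ with mutually independent components, and let $x_i=m+z_i$ with $m\in\mathbb R^p$ (the independent component model with mixing matrix $I_p$). Assume: * (A1) at most one component of $z$ is Gaussian; * (A2) $\mathrm E[z^{(j)}]=0$ and $\mathrm E[(z^{(j)})^2]=1$ for all $j$; * (A3) $\mathrm E[(z^{(j)})^4]$, $\nu_j=\mathrm E[G(z^{(j)})]$, $\mu_j=\mathrm E[g(z^{(j)})]$, $\mathrm{Var}[g(z^{(j)})]$, $\lambda_j=\mathrm E[g(z^{(j)})z^{(j)}]$, $\delta_j=\mathrm E[g'(z^{(j)})]$ and $\mathrm E[g'(z^{(j)})z^{(j)}]$ exist and are finite for all $j$; * (A4) for every $j$ there is $r>0$ such that $(1+\sum_k (z^{(k)})^2)\,\sup\{|g'(z^{(j)}+t)|:|t|\le r(1+\sum_k|z^{(k)}|)\}$ is bounded by an integrable random variable; * (A5) $\nu_j(\lambda_j-\delta_j)\ge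 0$ for all $j$, with equality for at most one $j$. For $n$ observations put $\bar x=\frac1n\sum_{i\le n} x_i$, $\hat S=\frac1n\sum_{i\le n}(x_i-\bar x)(x_i-\bar x)^T$, $\hat G(\gamma)=\frac1n\sum_{i\le n} G(\gamma^T(x_i-\bar x))$, $\hat T(\gamma)=\frac1n\sum_{i\le n} g(\gamma^T(x_i-\bar x))(x_i-\bar x)$ and $\hat T_2(\gamma)=\hat G(\gamma)\hat T(\gamma)$. A matrix $\Gamma=(\gamma_1,\dots,\gamma_p)^T$ with $\Gamma\hat S\Gamma^T=I_p$ is a solution of * the deflation-based FastICA equations if $\hat T(\gamma_j)=\hat S\big(\sum_{l\le j}\gamma_l\gamma_l^T\big)\hat T(\gamma_j)$ for all $j$; * the symmetric FastICA equations if $\gamma_l^T\hat T(\gamma_j)\,\mathrm{sign}\,\hat G(\gamma_j)=\gamma_j^T\hat T(\gamma_l)\,\mathrm{sign}\,\hat G(\gamma_l)$ for all $j,l$; * the squared symmetric FastICA equations if $\gamma_l^T\hat T_2(\gamma_j)=\gamma_j^T\hat T_2(\gamma_l)$ for all $j,l$. A consistent sequence of solutions is a sequence of measurable functions $\hat\Gamma=\hat\Gamma_n(x_1,\dots,x_n)$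 that solve the equations with probability tending to $1$ and converge to $I_p$ in probability. Let $T_{jl}=\frac1n\sum_{i\le n}(g(z_i^{(j)})-\mu_j)z_i^{(l)}$ and $T_{2jl}=\big(\frac1n\sum_{i\le n} G(z_i^{(j)})\big)T_{jl}$. Suppose that $\sqrt n\,T_{jl}$ and $\sqrt n\,T_{2jl}$ ($j\ne l$) and $\sqrt n(\hat S_{jl}-\delta_{jl})$ (all $j,l$; $\delta_{jl}$ the Kronecker delta) converge jointly in distribution to a (possibly degenerate) multivariate normal law. Then consistent sequences of solutions exist, and for each of them $\sqrt n\,\mathrm{vec}(\hat\Gamma-I_p)$ converges in distribution to a (possibly degenerate) multivariate normal law: 1. for the deflation-based equations, provided $\lambda_j\neq\delta_j$ for all $j<p$; 2. for the symmetric equations, provided that for every $j$ with $\nu_j=0$ one has $\lambda_j=\delta_j$ and $G(z^{(j)})$ is not almost surely equal to $\mu_jz^{(j)}+\frac{\lambda_j}{2}\big((z^{(j)})^2-1\big)$ (both hold automatically if $z^{(j)}$ is Gaussian); 3. for the squared symmetric equations. -/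

import Mathlib

open MeasureTheory ProbabilityTheory Filter Matrix
open scoped Topology

noncomputable section

namespace FastICA

/-! ### Sample quantities; a data set is `x : Fin n → Fin p → ℝ` -/

variable {n p : ℕ}

/-- The sample mean vector. -/
def sampleMean (x : Fin n → Fin p → ℝ) : Fin p → ℝ :=
  (n : ℝ)⁻¹ • ∑ i, x i

/-- The centred observations `x_i - x̄`. -/
def centered (x : Fin n → Fin p → ℝ) (i : Fin n) : Fin p → ℝ :=
  x i - sampleMean x

/-- The covariance matrix of the empirical distribution. -/
def sampleCov (x : Fin n → Fin p → ℝ) : Matrix (Fin p) (Fin p) ℝ :=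
  (n : ℝ)⁻¹ • ∑ i, vecMulVec (centered x i) (centered x i)

/-- The sample average of `G(γᵀ(x_i - x̄))`. -/
def sampleG (G : ℝ → ℝ) (x : Fin n → Fin p → ℝ) (γ : Fin p → ℝ) : ℝ :=
  (n : ℝ)⁻¹ * ∑ i, G (γ ⬝ᵥ centered x i)

/-- The sample average of `g(γᵀ(x_i - x̄)) (x_i - x̄)`, where `g = G'`. -/
def sampleT (G : ℝ → ℝ) (x : Fin n → Fin p → ℝ) (γ : Fin p → ℝ) : Fin p → ℝ :=
  (n : ℝ)⁻¹ • ∑ i, deriv G (γ ⬝ᵥ centered x i) • centered x i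

/-- The product of the two preceding sample averages. -/
def sampleT2 (G : ℝ → ℝ) (x : Fin n → Fin p → ℝ) (γ : Fin p → ℝ) : Fin p → ℝ :=
  sampleG G x γ • sampleT G x γ

/-! ### The estimating equations; `γ_j` is the row `Γ j` -/

/-- Estimating equations of deflation-based FastICA, with the constraints
`γ_lᵀ Ŝ γ_j = δ_lj` under which the rows are extracted. -/
def IsDeflationSolution (G : ℝ → ℝ) (x : Fin n → Fin p → ℝ)
    (Γ : Matrix (Fin p) (Fin p) ℝ) : Prop :=
  (∀ j, sampleT G x (Γ j) =
      (sampleCov x * ∑ l ∈ Finset.Iic j, vecMulVec (Γ l) (Γ l)) *ᵥ sampleT G x (Γ j)) ∧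
    Γ * sampleCov x * Γᵀ = 1

/-- Estimating equations of symmetric FastICA. -/
def IsSymmetricSolution (G : ℝ → ℝ) (x : Fin n → Fin p → ℝ)
    (Γ : Matrix (Fin p) (Fin p) ℝ) : Prop :=
  (∀ j l, (Γ l ⬝ᵥ sampleT G x (Γ j)) * Real.sign (sampleG G x (Γ j)) =
      (Γ j ⬝ᵥ sampleT G x (Γ l)) * Real.sign (sampleG G x (Γ l))) ∧
    Γ * sampleCov x * Γᵀ = 1

/-- Estimating equations of squared symmetric FastICA. -/
def IsSquaredSymmetricSolution (G : ℝ → ℝ) (x : Fin n → Fin p → ℝ)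
    (Γ : Matrix (Fin p) (Fin p) ℝ) : Prop :=
  (∀ j l, Γ l ⬝ᵥ sampleT2 G x (Γ j) = Γ j ⬝ᵥ sampleT2 G x (Γ l)) ∧
    Γ * sampleCov x * Γᵀ = 1

/-! ### Random samples -/

section Random

variable {Ω : Type*} [MeasurableSpace Ω]

/-- The first `n` observations. -/
def firstObs (X : ℕ → Ω → Fin p → ℝ) (n : ℕ) (ω : Ω) : Fin n → Fin p → ℝ :=
  fun i => X i ω

/-- An observation from the independent component model `x = m + A z`. -/
def icObs (m : Fin p → ℝ) (A : Matrix (Fin p) (Fin p) ℝ) (z : ℕ → Ω → Fin p → ℝ) :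
    ℕ → Ω → Fin p → ℝ :=
  fun i ω => m + A *ᵥ z i ω

/-- `ν_j = E G(z_j)`. -/
def nu (P : Measure Ω) (G : ℝ → ℝ) (z : Ω → Fin p → ℝ) (j : Fin p) : ℝ :=
  ∫ ω, G (z ω j) ∂P

/-- `μ_j = E g(z_j)`. -/
def mu (P : Measure Ω) (G : ℝ → ℝ) (z : Ω → Fin p → ℝ) (j : Fin p) : ℝ :=
  ∫ ω, deriv G (z ω j) ∂P

/-- `λ_j = E [g(z_j) z_j]`. -/
def lam (P : Measure Ω) (G : ℝ → ℝ) (z : Ω → Fin p → ℝ) (j : Fin p) : ℝ :=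
  ∫ ω, deriv G (z ω j) * z ω j ∂P

/-- `δ_j = E g'(z_j)`. -/
def del (P : Measure Ω) (G : ℝ → ℝ) (z : Ω → Fin p → ℝ) (j : Fin p) : ℝ :=
  ∫ ω, deriv (deriv G) (z ω j) ∂P

/-- The nonlinearities: `G` is twice continuously differentiable, not a polynomial of degree at
most two, and `E G(Z) = 0` for a standard Gaussian `Z`. -/
structure IsContrast (G : ℝ → ℝ) : Prop where
  contDiff : ContDiff ℝ 2 G
  nonquadratic : ¬ ∃ a b c : ℝ, ∀ x, G x = a + b * x + c * x ^ 2
  integrable_gaussian : Integrable G (gaussianReal 0 1)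
  integral_gaussian : ∫ x, G x ∂(gaussianReal 0 1) = 0

/-- `z_1, z_2, …` are independent copies of a random vector with mutually independent
components. -/
structure IsICSample (P : Measure Ω) (z : ℕ → Ω → Fin p → ℝ) : Prop where
  measurable : ∀ i, Measurable (z i)
  iIndep : iIndepFun z P
  identDistrib : ∀ i, IdentDistrib (z i) (z 0) P P
  iIndep_components : iIndepFun (fun (j : Fin p) ω => z 0 ω j) P

/-- At most one component is Gaussian. -/
def AtMostOneGaussian (P : Measure Ω) (z : Ω → Fin p → ℝ) : Prop :=
  ∀ j l, HasGaussianLaw (fun ω => z ω j) P → HasGaussianLaw (fun ω => z ω l) P → j = l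

/-- The components are centred with unit variance. -/
def IsStandardized (P : Measure Ω) (z : Ω → Fin p → ℝ) : Prop :=
  ∀ j, MemLp (fun ω => z ω j) 2 P ∧ ∫ ω, z ω j ∂P = 0 ∧ ∫ ω, z ω j ^ 2 ∂P = 1

/-- Existence of `E z_j⁴`, `E G(z_j)`, `E g(z_j)`, `Var g(z_j)`, `E [g(z_j) z_j]`, `E g'(z_j)` and
`E [g'(z_j) z_j]`. -/
structure HasMoments (P : Measure Ω) (G : ℝ → ℝ) (z : Ω → Fin p → ℝ) : Prop where
  fourth : ∀ j, Integrable (fun ω => z ω j ^ 4) P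
  contrast : ∀ j, Integrable (fun ω => G (z ω j)) P
  memLp_g : ∀ j, MemLp (fun ω => deriv G (z ω j)) 2 P
  g_mul : ∀ j, Integrable (fun ω => deriv G (z ω j) * z ω j) P
  g' : ∀ j, Integrable (fun ω => deriv (deriv G) (z ω j)) P
  g'_mul : ∀ j, Integrable (fun ω => deriv (deriv G) (z ω j) * z ω j) P

/-- Local domination of `g'` near the true parameter:
`E [(1 + ∑ z_k²) sup {|g'(z_j + t)| : |t| ≤ r (1 + ∑ |z_k|)}] < ∞` for some `r > 0`. The numbers
`z_j + t` are the numbers `γᵀ z + b` with `|γ_k - δ_jk| ≤ r` for all `k` and `|b| ≤ r`. -/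
def LocallyDominated (P : Measure Ω) (G : ℝ → ℝ) (z : Ω → Fin p → ℝ) : Prop :=
  ∀ j, ∃ r > 0, ∃ H : Ω → ℝ, Integrable H P ∧ ∀ᵐ ω ∂P, ∀ t : ℝ,
    |t| ≤ r * (1 + ∑ k, |z ω k|) →
      (1 + ∑ k, z ω k ^ 2) * |deriv (deriv G) (z ω j + t)| ≤ H ω

/-- `T_j = n⁻¹ ∑ (g(z_ij) - μ_j) z_i`. -/
def oracleT (P : Measure Ω) (G : ℝ → ℝ) (z : ℕ → Ω → Fin p → ℝ) (n : ℕ) (j : Fin p) (ω : Ω) :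
    Fin p → ℝ :=
  (n : ℝ)⁻¹ • ∑ i ∈ Finset.range n, (deriv G (z i ω j) - mu P G (z 0) j) • z i ω

/-- `T_2j = (n⁻¹ ∑ G(z_ij)) T_j`. -/
def oracleT2 (P : Measure Ω) (G : ℝ → ℝ) (z : ℕ → Ω → Fin p → ℝ) (n : ℕ) (j : Fin p) (ω : Ω) :
    Fin p → ℝ :=
  ((n : ℝ)⁻¹ * ∑ i ∈ Finset.range n, G (z i ω j)) • oracleT P G z n j ω

/-- Index pairs `(j, l)` with `j ≠ l`. -/
abbrev OffDiag (p : ℕ) : Type := {q : Fin p × Fin p // q.1 ≠ q.2}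

/-- The random vector formed by `√n T_jl` and `√n T_2jl` for `j ≠ l`, and by
`√n (Ŝ_jl - δ_jl)` for all `j, l`. -/
def jointStat (P : Measure Ω) (G : ℝ → ℝ) (z X : ℕ → Ω → Fin p → ℝ) (n : ℕ) (ω : Ω) :
    (OffDiag p → ℝ) × (OffDiag p → ℝ) × (Fin p × Fin p → ℝ) :=
  (fun q => √(n : ℝ) * oracleT P G z n q.1.1 ω q.1.2,
   fun q => √(n : ℝ) * oracleT2 P G z n q.1.1 ω q.1.2,
   fun q => √(n : ℝ) * (sampleCov (firstObs X n ω) - 1) q.1 q.2)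

/-- `Y_n` converges in distribution to a (possibly degenerate) multivariate normal law. -/
def IsAsympNormal {E : Type*} [AddCommGroup E] [Module ℝ E] [TopologicalSpace E]
    [MeasurableSpace E] [OpensMeasurableSpace E]
    (P : Measure Ω) [IsProbabilityMeasure P] (Y : ℕ → Ω → E) : Prop :=
  ∃ (ρ : Measure E) (_ : IsGaussian ρ), TendstoInDistribution Y atTop id (fun _ => P) ρ

/-- A sequence of matrix-valued statistics: for each sample size a function of the data with
measurable entries. -/
structure Estimator (p : ℕ) where
  toFun : (n : ℕ) → (Fin n → Fin p → ℝ) → Matrix (Fin p) (Fin p) ℝ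
  measurable : ∀ n j l, Measurable fun x => toFun n x j l

/-- `Γ̂` is a sequence of solutions converging to `I_p`: with probability tending to one it solves
the estimating equations `Sol`, and it converges to `I_p` in probability. -/
structure IsConsistentSolution (P : Measure Ω) (X : ℕ → Ω → Fin p → ℝ)
    (Sol : (n : ℕ) → (Fin n → Fin p → ℝ) → Matrix (Fin p) (Fin p) ℝ → Prop)
    (Γ : Estimator p) : Prop where
  solves : Tendsto (fun n => P {ω | ¬ Sol n (firstObs X n ω) (Γ.toFun n (firstObs X n ω))})
    atTop (𝓝 0)
  consistent : ∀ j l, TendstoInMeasure P (fun n ω => Γ.toFun n (firstObs X n ω) j l) atTop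
    (fun _ => (1 : Matrix (Fin p) (Fin p) ℝ) j l)

/-- The random vector `√n vec(Γ̂ - I_p)`. -/
def scaledError (X : ℕ → Ω → Fin p → ℝ) (Γ : Estimator p) (n : ℕ) (ω : Ω) :
    Fin p × Fin p → ℝ :=
  √(n : ℝ) • vec (Γ.toFun n (firstObs X n ω) - 1)

/-- A sequence of solutions converging to `I_p` exists, and for each such sequence
`√n vec(Γ̂ - I_p)` is asymptotically multivariate normal. -/
def SolutionsAsympNormal (P : Measure Ω) [IsProbabilityMeasure P] (X : ℕ → Ω → Fin p → ℝ)
    (Sol : (n : ℕ) → (Fin n → Fin p → ℝ) → Matrix (Fin p) (Fin p) ℝ → Prop) : Prop :=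
  (∃ Γ : Estimator p, IsConsistentSolution P X Sol Γ) ∧
    ∀ Γ : Estimator p, IsConsistentSolution P X Sol Γ → IsAsympNormal P (scaledError X Γ)

end Random

end FastICA

end

/-! Convergence in probability is convergence along one filter `whp` on pairs (n, ω), so stochastic
Landau symbols become ordinary ones and `StochBdd` plays the role of O_P(1). Along this filter the
sample statistics are strictly differentiable functions of Γ at the identity, uniformly with
probability tending to one (`HasSDeriv`). The source is `IsICSample.hasSDeriv_empMean`: the law of
large numbers identifies the derivative, and (A4) controls a modulus of continuity of g'.

Each system of equations has the form α_jl γ_lᵀT̂(γ_j) = α_lj γ_jᵀT̂(γ_l) together with the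
whitening constraint. The weights α are indicators of j < l for deflation, sign Ĝ(γ_j) in the
symmetric case and Ĝ(γ_j) in the squared symmetric case. By independence the derivative of
γ_lᵀT̂(γ_j) at the identity is λ_j Γ_lj + δ_j Γ_jl, and that of the constraint is Γ_jl + Γ_lj.
Eliminating Γ_lj leaves Γ_jl with a coefficient κ_jl, which the hypotheses make nonzero. Division by
κ_jl gives a map (`estMap`) with the same zeros and with derivative the identity. For such a map B
the iteration Γ ↦ Γ - B Γ from the identity contracts to a zero that is a measurable function of the
data, and every consistent zero satisfies √n(Γ̂ - I) = -√n B(I) + o_P(1)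
(`HasSDeriv.expansion_of_zero`). For nonrandom limiting weights √n B(I) is a fixed linear image of
the joint statistic up to o_P(1). This settles deflation and the squared symmetric equations
(`Weights.solutionsAsympNormal`).

In the symmetric case (A5) allows at most one J with ν_J = 0, and then the sign of Ĝ(γ_J) stays
random in the limit. Since λ_J = δ_J, this sign does not affect κ, so √n-consistency is available
before the sign is known. The expansion of Ĝ and the constraint then show that √n Ĝ(γ_J) is a
normalized sum of functions of z_i^(J) alone, up to o_P(1). Such a sum does not concentrate at zero
(`anticoncentration`, which needs no moments), so the sign is that of the sum. It is therefore a
function of the J-th column of the latent sample.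

The leading term splits into the sign times a sum of terms u, plus sums of terms v and w. Both u and
v are centred conditionally on z^(J), w depends on z^(J) only, and u is orthogonal to v. Given the
J-th column, the conditional characteristic function of the sum of ±u + v concentrates at a Gaussian
value that does not depend on the sign (`tendsto_integral_norm_sq_prod_condChar`). The sign can thus
be replaced by +1 without changing the limit law (`IsICSample.isAsympNormal_sign`), and with a
constant sign the leading term is again linear in the joint statistic. -/

noncomputable section

namespace FastICA

open Asymptotics

/-! ### Stochastic orders through a filter -/

section Whp

variable {Ω : Type*} [MeasurableSpace Ω] {P : Measure Ω}

/-- The filter of sets of pairs `(n, ω)` whose sections have probability tending to one. -/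
def whp (P : Measure Ω) : Filter (ℕ × Ω) where
  sets := {s | Tendsto (fun n => P {ω | (n, ω) ∉ s}) atTop (𝓝 0)}
  univ_sets := by simp
  sets_of_superset {s t} hs hst := by
    refine tendsto_of_tendsto_of_tendsto_of_le_of_le tendsto_const_nhds hs
      (fun _ => zero_le) (fun n => measure_mono fun ω hω h => hω (hst h))
  inter_sets {s t} hs ht := by
    have h := Tendsto.add hs ht
    rw [add_zero] at h
    refine tendsto_of_tendsto_of_tendsto_of_le_of_le tendsto_const_nhds h
      (fun _ => zero_le) (fun n => ?_)
    refine (measure_mono fun ω hω => ?_).trans (measure_union_le _ _)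
    by_contra hcon
    simp only [Set.mem_union, Set.mem_ofPred_eq, not_or, not_not] at hcon
    exact hω ⟨hcon.1, hcon.2⟩

lemma eventually_whp {p : ℕ × Ω → Prop} :
    (∀ᶠ q in whp P, p q) ↔ Tendsto (fun n => P {ω | ¬ p (n, ω)}) atTop (𝓝 0) := Iff.rfl

lemma eventually_whp_of_atTop {p : ℕ → Prop} (h : ∀ᶠ n in atTop, p n) :
    ∀ᶠ q in whp P, p q.1 := by
  rw [eventually_whp]
  refine tendsto_const_nhds.congr' ?_
  filter_upwards [h] with n hn
  simp [hn]

lemma tendsto_fst_whp : Tendsto Prod.fst (whp P) atTop :=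
  fun _ hs => eventually_whp_of_atTop hs

/-- This dictionary makes the `=o` and `=O` calculus of filters available for convergence in
probability. -/
lemma tendsto_whp_iff {E : Type*} [PseudoMetricSpace E] {f : ℕ × Ω → E} {c : E} :
    Tendsto f (whp P) (𝓝 c) ↔
      TendstoInMeasure P (fun n ω => f (n, ω)) atTop (fun _ => c) := by
  rw [tendstoInMeasure_iff_dist, Metric.tendsto_nhds]
  simp only [eventually_whp, not_lt]

/-- A sequence of random variables is stochastically bounded if its product with any sequence
converging to zero in probability converges to zero in probability. -/
def StochBdd (P : Measure Ω) (f : ℕ × Ω → ℝ) : Prop :=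
  ∀ r : ℕ × Ω → ℝ, Tendsto r (whp P) (𝓝 0) → Tendsto (fun q => r q * f q) (whp P) (𝓝 0)

namespace StochBdd

variable {f g : ℕ × Ω → ℝ}

lemma add (hf : StochBdd P f) (hg : StochBdd P g) : StochBdd P (fun q => f q + g q) := by
  intro r hr
  simpa [mul_add] using (hf r hr).add (hg r hr)

lemma of_isBigO (hf : StochBdd P f) {F : Type*} [SeminormedAddCommGroup F] {g : ℕ × Ω → F}
    (h : g =O[whp P] f) : StochBdd P (fun q => ‖g q‖) := by
  intro r hr
  have h1 : (fun q => r q * ‖g q‖) =O[whp P] (fun q => r q * f q) :=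
    (isBigO_refl r _).mul h.norm_left
  exact h1.trans_tendsto (hf r hr)

lemma of_isBigO' (hf : StochBdd P f) {g : ℕ × Ω → ℝ}
    (h : g =O[whp P] f) : StochBdd P g := by
  intro r hr
  have h1 : (fun q => r q * g q) =O[whp P] (fun q => r q * f q) := (isBigO_refl r _).mul h
  exact h1.trans_tendsto (hf r hr)

lemma tendsto_of_isLittleO (hf : StochBdd P f) {F : Type*} [SeminormedAddCommGroup F]
    {g : ℕ × Ω → F} (h : g =o[whp P] f) : Tendsto g (whp P) (𝓝 0) := by
  have h2 : (fun q => ‖g q‖) =o[whp P] f := h.norm_left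
  obtain ⟨φ, hφ, he⟩ := isLittleO_iff_exists_eq_mul.mp h2
  rw [tendsto_zero_iff_norm_tendsto_zero]
  exact (hf φ hφ).congr' (he.mono fun q hq => hq.symm)

lemma of_tendsto {c : ℝ} (h : Tendsto f (whp P) (𝓝 c)) : StochBdd P f := by
  intro r hr
  simpa using hr.mul h

lemma congr' (hf : StochBdd P f) (h : f =ᶠ[whp P] g) : StochBdd P g :=
  fun r hr => (hf r hr).congr' (h.mono fun q hq => by simp [hq])

lemma norm_pi {ι : Type*} [Fintype ι] {f : ℕ × Ω → ι → ℝ}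
    (h : ∀ i, StochBdd P (fun q => f q i)) : StochBdd P (fun q => ‖f q‖) := by
  intro r hr
  have : Tendsto (fun q => r q • f q) (whp P) (𝓝 0) := by
    rw [tendsto_pi_nhds]
    intro i
    simpa using h i r hr
  rw [tendsto_zero_iff_norm_tendsto_zero] at this ⊢
  simpa [norm_smul] using this

/-- A tight sequence of random variables is stochastically bounded. -/
lemma of_tight (h : ∀ η : ENNReal, 0 < η → ∃ M : ℝ, ∀ᶠ n in atTop, P {ω | M ≤ |f (n, ω)|} ≤ η) :
    StochBdd P f := by
  intro r hr
  rw [Metric.tendsto_nhds]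
  intro ε hε
  rw [eventually_whp, ENNReal.tendsto_nhds_zero]
  intro η hη
  obtain ⟨M, hM⟩ := h (η / 2) (by simpa using hη.ne')
  -- Off an event of small probability |f| < |M| + 1; adding one also keeps the threshold meaningful
  -- when M = 0.
  have hr' := (Metric.tendsto_nhds.mp hr (ε / (|M| + 1)) (by positivity))
  rw [eventually_whp, ENNReal.tendsto_nhds_zero] at hr'
  filter_upwards [hM, hr' (η / 2) (by simpa using hη.ne')] with n h1 h2
  calc P {ω | ¬ dist (r (n, ω) * f (n, ω)) 0 < ε}
      ≤ P ({ω | M ≤ |f (n, ω)|} ∪ {ω | ¬ dist (r (n, ω)) 0 < ε / (|M| + 1)}) := by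
        refine measure_mono fun ω hω => ?_
        by_contra hcon
        simp only [Set.mem_union, Set.mem_ofPred_eq, not_or, not_not, not_le] at hcon
        obtain ⟨ha, hb⟩ := hcon
        apply hω
        rw [dist_zero_right, Real.norm_eq_abs] at hb ⊢
        rw [abs_mul]
        calc |r (n, ω)| * |f (n, ω)| ≤ |r (n, ω)| * (|M| + 1) := by
              gcongr
              linarith [le_abs_self M]
          _ < ε / (|M| + 1) * (|M| + 1) := by gcongr
          _ = ε := by field_simp
    _ ≤ η / 2 + η / 2 := (measure_union_le _ _).trans (add_le_add h1 h2)
    _ = η := ENNReal.add_halves η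

variable [IsProbabilityMeasure P]

/-- Tightness of a weakly convergent sequence: the limit law has small mass on the closed set {k ≤
|x|} for large k, and the portmanteau theorem passes this bound to the laws of Y_n for all large n.
-/
lemma of_tendstoInDistribution {Ω' : Type*} [MeasurableSpace Ω'] {ρ : Measure Ω'}
    [IsProbabilityMeasure ρ] {Z : Ω' → ℝ} {Y : ℕ → Ω → ℝ}
    (h : TendstoInDistribution Y atTop Z (fun _ => P) ρ) :
    StochBdd P (fun q => Y q.1 q.2) := by
  apply of_tight
  intro η hη
  have hlim : Tendsto (fun k : ℕ => (ρ.map Z) {x | (k : ℝ) ≤ |x|}) atTop (𝓝 0) := by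
    have : IsProbabilityMeasure (ρ.map Z) := Measure.isProbabilityMeasure_map h.aemeasurable_limit
    have h0 : (⋂ k : ℕ, {x : ℝ | (k : ℝ) ≤ |x|}) = ∅ := by
      ext x
      simp only [Set.mem_iInter, Set.mem_ofPred_eq, Set.mem_empty_iff_false, iff_false, not_forall,
        not_le]
      exact exists_nat_gt |x|
    rw [← measure_empty (μ := ρ.map Z), ← h0]
    refine tendsto_measure_iInter_atTop (fun k => ?_) (fun a b hab x hx => ?_) ⟨0, by simp⟩
    · exact (measurableSet_le measurable_const measurable_norm).nullMeasurableSet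
    · exact le_trans (Nat.cast_le.mpr hab : (a : ℝ) ≤ b) hx
  obtain ⟨k, hk⟩ := (hlim.eventually (gt_mem_nhds hη)).exists
  refine ⟨k, ?_⟩
  have hcl : IsClosed {x : ℝ | (k : ℝ) ≤ |x|} := isClosed_le continuous_const continuous_abs
  have h1 := ProbabilityMeasure.limsup_measure_closed_le_of_tendsto h.tendsto hcl
  have h2 := eventually_lt_of_limsup_lt (h1.trans_lt hk)
  filter_upwards [h2] with n hn
  have h3 : (P.map (Y n)) {x : ℝ | (k : ℝ) ≤ |x|} < η := hn
  rw [Measure.map_apply_of_aemeasurable (h.forall_aemeasurable n) hcl.measurableSet] at h3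
  exact h3.le

end StochBdd

end Whp

/-! ### Strict differentiability, uniform along a filter -/

section SDeriv

variable {Q : Type*} {L : Filter Q}
  {V W U : Type*} [NormedAddCommGroup V] [NormedSpace ℝ V] [NormedAddCommGroup W] [NormedSpace ℝ W]
  [NormedAddCommGroup U] [NormedSpace ℝ U]

/-- Strict differentiability at `x₀` of functions `f q`, uniformly along the filter `L`, with
derivative `f'` in the limit. -/
def HasSDeriv (L : Filter Q) (f : Q → V → W) (f' : V →L[ℝ] W) (x₀ : V) : Prop :=
  (fun t : Q × V × V => f t.1 t.2.1 - f t.1 t.2.2 - f' (t.2.1 - t.2.2))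
    =o[L ×ˢ 𝓝 (x₀, x₀)] (fun t => t.2.1 - t.2.2)

namespace HasSDeriv

variable {f g : Q → V → W} {f' g' : V →L[ℝ] W} {x₀ : V}

lemma congr_deriv (hf : HasSDeriv L f f' x₀) (h : f' = g') : HasSDeriv L f g' x₀ := h ▸ hf

lemma isBigO_sub (hf : HasSDeriv L f f' x₀) :
    (fun t : Q × V × V => f t.1 t.2.1 - f t.1 t.2.2) =O[L ×ˢ 𝓝 (x₀, x₀)]
      (fun t => t.2.1 - t.2.2) := by
  have h1 : (fun t : Q × V × V => f' (t.2.1 - t.2.2)) =O[L ×ˢ 𝓝 (x₀, x₀)]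
      (fun t => t.2.1 - t.2.2) := f'.isBigO_comp _ _
  simpa using (IsLittleO.isBigO hf).add h1

lemma tendsto_sub {V : Type*} [NormedAddCommGroup V] (x₀ : V) :
    Tendsto (fun t : Q × V × V => t.2.1 - t.2.2) (L ×ˢ 𝓝 (x₀, x₀))
    (𝓝 0) := by
  have h : Tendsto (fun t : V × V => t.1 - t.2) (𝓝 (x₀, x₀)) (𝓝 (x₀ - x₀)) :=
    (continuous_fst.sub continuous_snd).tendsto (x₀, x₀)
  rw [sub_self] at h
  exact h.comp tendsto_snd

/-- Uniform convergence near `x₀`. -/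
lemma tendsto_uncurry (hf : HasSDeriv L f f' x₀) {a : W} (ha : Tendsto (fun q => f q x₀) L (𝓝 a)) :
    Tendsto (fun t : Q × V => f t.1 t.2) (L ×ˢ 𝓝 x₀) (𝓝 a) := by
  have h0 := hf.isBigO_sub.trans_tendsto (tendsto_sub x₀)
  have hc : Tendsto (fun t : Q × V => (t.1, t.2, x₀)) (L ×ˢ 𝓝 x₀) (L ×ˢ 𝓝 (x₀, x₀)) := by
    refine tendsto_fst.prodMk ?_
    rw [nhds_prod_eq]
    exact tendsto_snd.prodMk (tendsto_const_nhds)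
  have h1 := (h0.comp hc).add (ha.comp tendsto_fst)
  simpa using h1

lemma const (c : Q → W) : HasSDeriv L (fun q (_ : V) => c q) 0 x₀ := by
  simp [HasSDeriv]

lemma clm (A : V →L[ℝ] W) : HasSDeriv L (fun _ x => A x) A x₀ := by
  simp [HasSDeriv]

lemma sub (hf : HasSDeriv L f f' x₀) (hg : HasSDeriv L g g' x₀) :
    HasSDeriv L (fun q x => f q x - g q x) (f' - g') x₀ := by
  refine (IsLittleO.sub hf hg).congr_left fun t => ?_
  simp only [_root_.sub_apply]
  abel

lemma sum {ι : Type*} {s : Finset ι} {f : ι → Q → V → W} {f' : ι → V →L[ℝ] W}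
    (hf : ∀ i ∈ s, HasSDeriv L (f i) (f' i) x₀) :
    HasSDeriv L (fun q x => ∑ i ∈ s, f i q x) (∑ i ∈ s, f' i) x₀ := by
  refine (IsLittleO.sum hf).congr_left fun t => ?_
  simp only [Finset.sum_apply, _root_.sum_apply, Finset.sum_sub_distrib]

lemma mul {f g : Q → V → ℝ} {f' g' : V →L[ℝ] ℝ} (hf : HasSDeriv L f f' x₀)
    (hg : HasSDeriv L g g' x₀) {a b : ℝ} (ha : Tendsto (fun q => f q x₀) L (𝓝 a))
    (hb : Tendsto (fun q => g q x₀) L (𝓝 b)) :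
    HasSDeriv L (fun q x => f q x * g q x) (a • g' + b • f') x₀ := by
  have hfst : Tendsto (fun t : Q × V × V => (t.1, t.2.1)) (L ×ˢ 𝓝 (x₀, x₀)) (L ×ˢ 𝓝 x₀) := by
    rw [nhds_prod_eq]
    exact tendsto_fst.prodMk (tendsto_fst.comp tendsto_snd)
  have hsnd : Tendsto (fun t : Q × V × V => (t.1, t.2.2)) (L ×ˢ 𝓝 (x₀, x₀)) (L ×ˢ 𝓝 x₀) := by
    rw [nhds_prod_eq]
    exact tendsto_fst.prodMk (tendsto_snd.comp tendsto_snd)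
  have hfa : Tendsto (fun t : Q × V × V => f t.1 t.2.1) (L ×ˢ 𝓝 (x₀, x₀)) (𝓝 a) :=
    (hf.tendsto_uncurry ha).comp hfst
  have hgb : Tendsto (fun t : Q × V × V => g t.1 t.2.2) (L ×ˢ 𝓝 (x₀, x₀)) (𝓝 b) :=
    (hg.tendsto_uncurry hb).comp hsnd
  -- With increments Δ, f g changes by f(x) Δg + g(y) Δf. Replacing f(x) and g(y) by their limits a
  -- and b costs the two products bounded here and in `e2`.
  have e1 : (fun t : Q × V × V => (f t.1 t.2.1 - a) * (g t.1 t.2.1 - g t.1 t.2.2))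
      =o[L ×ˢ 𝓝 (x₀, x₀)] (fun t => ‖t.2.1 - t.2.2‖) := by
    have h0 : (fun t : Q × V × V => f t.1 t.2.1 - a) =o[L ×ˢ 𝓝 (x₀, x₀)] (fun _ => (1 : ℝ)) := by
      rw [isLittleO_one_iff]
      simpa using hfa.sub_const a
    simpa using h0.mul_isBigO hg.isBigO_sub.norm_right
  have e2 : (fun t : Q × V × V => (g t.1 t.2.2 - b) * (f t.1 t.2.1 - f t.1 t.2.2))
      =o[L ×ˢ 𝓝 (x₀, x₀)] (fun t => ‖t.2.1 - t.2.2‖) := by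
    have h0 : (fun t : Q × V × V => g t.1 t.2.2 - b) =o[L ×ˢ 𝓝 (x₀, x₀)] (fun _ => (1 : ℝ)) := by
      rw [isLittleO_one_iff]
      simpa using hgb.sub_const b
    simpa using h0.mul_isBigO hf.isBigO_sub.norm_right
  have e3 := (IsLittleO.const_mul_left hf b).norm_right
  have e4 := (IsLittleO.const_mul_left hg a).norm_right
  refine (((e1.add e2).add (e3.add e4)).of_norm_right).congr_left fun t => ?_
  simp only [_root_.add_apply, _root_.smul_apply, smul_eq_mul]
  ring

lemma comp {u : Q → V → W} {u' : V →L[ℝ] W} {g : Q → W → U} {g' : W →L[ℝ] U} {y₀ : W}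
    (hg : HasSDeriv L g g' y₀) (hu : HasSDeriv L u u' x₀)
    (h0 : Tendsto (fun q => u q x₀) L (𝓝 y₀)) :
    HasSDeriv L (fun q x => g q (u q x)) (g'.comp u') x₀ := by
  have hut := hu.tendsto_uncurry h0
  have hmap : Tendsto (fun t : Q × V × V => (t.1, u t.1 t.2.1, u t.1 t.2.2))
      (L ×ˢ 𝓝 (x₀, x₀)) (L ×ˢ 𝓝 (y₀, y₀)) := by
    refine tendsto_fst.prodMk ?_
    rw [nhds_prod_eq, nhds_prod_eq]
    exact (hut.comp (tendsto_fst.prodMk (tendsto_fst.comp tendsto_snd))).prodMk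
      (hut.comp (tendsto_fst.prodMk (tendsto_snd.comp tendsto_snd)))
  have e1 := (IsLittleO.comp_tendsto hg hmap).trans_isBigO hu.isBigO_sub
  have e2 := (g'.isBigO_comp (fun t : Q × V × V => u t.1 t.2.1 - u t.1 t.2.2 - u' (t.2.1 - t.2.2))
    (L ×ˢ 𝓝 (x₀, x₀))).trans_isLittleO hu
  refine (e1.add e2).congr_left fun t => ?_
  simp [map_sub]

/-- Evaluation of the expansion at random points converging to `x₀`. -/
lemma isLittleO_eval (hf : HasSDeriv L f f' x₀) {u v : Q → V} (hu : Tendsto u L (𝓝 x₀))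
    (hv : Tendsto v L (𝓝 x₀)) :
    (fun q => f q (u q) - f q (v q) - f' (u q - v q)) =o[L] (fun q => u q - v q) := by
  have hmap : Tendsto (fun q => (q, u q, v q)) L (L ×ˢ 𝓝 (x₀, x₀)) := by
    refine tendsto_id.prodMk ?_
    rw [nhds_prod_eq]
    exact hu.prodMk hv
  exact IsLittleO.comp_tendsto hf hmap

end HasSDeriv

end SDeriv

/-! ### Zeros of maps close to the identity -/

section Newton

variable {V : Type*} [NormedAddCommGroup V] [CompleteSpace V]

/-- If `B` is close to the identity map near `x₀` and `B x₀` is small, the iteration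
`x ↦ x - B x` started at `x₀` converges to a zero of `B`. -/
lemma exists_zero_of_approx_id {B : V → V} {x₀ : V} {ρ : ℝ} (hρ : 0 ≤ ρ)
    (hB : ∀ x ∈ Metric.closedBall x₀ ρ, ∀ y ∈ Metric.closedBall x₀ ρ,
      ‖B x - B y - (x - y)‖ ≤ 1 / 2 * ‖x - y‖) (h0 : ‖B x₀‖ ≤ ρ / 2) :
    ∃ y ∈ Metric.closedBall x₀ ρ, B y = 0 ∧
      Tendsto (fun k => (fun x => x - B x)^[k] x₀) atTop (𝓝 y) := by
  set f : V → V := fun x => x - B x with hf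
  set s := Metric.closedBall x₀ ρ with hs
  have hx₀ : x₀ ∈ s := Metric.mem_closedBall_self hρ
  have hlip : ∀ x ∈ s, ∀ y ∈ s, ‖f x - f y‖ ≤ 1 / 2 * ‖x - y‖ := by
    intro x hx y hy
    have := hB x hx y hy
    rw [← norm_neg] at this
    convert! this using 2
    simp only [hf]
    abel
  have hmaps : Set.MapsTo f s s := by
    intro x hx
    have h1 := hlip x hx x₀ hx₀
    have h2 : ‖x - x₀‖ ≤ ρ := by simpa [hs, dist_eq_norm] using hx
    rw [hs, Metric.mem_closedBall, dist_eq_norm]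
    calc ‖f x - x₀‖ = ‖(f x - f x₀) + (-B x₀)‖ := by
          congr 1
          simp only [hf]
          abel
      _ ≤ ‖f x - f x₀‖ + ‖-B x₀‖ := norm_add_le _ _
      _ ≤ ρ := by rw [norm_neg]; linarith
  have hcontr : ContractingWith (1 / 2) (hmaps.restrict f s s) := by
    refine ⟨by
      rw [← NNReal.coe_lt_coe]
      norm_num, ?_⟩
    refine LipschitzWith.of_dist_le_mul fun x y => ?_
    rw [Subtype.dist_eq, Subtype.dist_eq, dist_eq_norm, dist_eq_norm]
    simpa using hlip x x.2 y y.2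
  obtain ⟨y, hy, hfix, hlim, -⟩ := ContractingWith.exists_fixedPoint'
    (Metric.isClosed_closedBall.isComplete) hmaps hcontr hx₀ (edist_ne_top _ _)
  refine ⟨y, hy, ?_, hlim⟩
  have : y - B y = y := hfix
  simpa using this

variable [NormedSpace ℝ V] {Q : Type*} {L : Filter Q}

/-- Along `L`, the iteration `x ↦ x - B x` converges to zeros of `B` which tend to `x₀`. -/
lemma HasSDeriv.eventually_exists_zero {B : Q → V → V} {x₀ : V}
    (hB : HasSDeriv L B (ContinuousLinearMap.id ℝ V) x₀)
    (h0 : Tendsto (fun q => B q x₀) L (𝓝 0)) {ε : ℝ} (hε : 0 < ε) :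
    ∀ᶠ q in L, ∃ y ∈ Metric.closedBall x₀ ε, B q y = 0 ∧
      Tendsto (fun k => (fun x => x - B q x)^[k] x₀) atTop (𝓝 y) := by
  have h1 := isLittleO_iff.mp hB (show (0 : ℝ) < 1 / 2 by norm_num)
  rw [eventually_prod_iff] at h1
  obtain ⟨p, hp, r, hr, hpr⟩ := h1
  obtain ⟨ρ, hρ, hball⟩ := Metric.eventually_nhds_iff.mp hr
  have hρ' : 0 < min ε (ρ / 2) := by positivity
  have h2 := Metric.tendsto_nhds.mp h0 (min ε (ρ / 2) / 2) (by positivity)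
  filter_upwards [hp, h2] with q hq hq2
  obtain ⟨y, hy, hy0, hy1⟩ := exists_zero_of_approx_id (B := B q) (x₀ := x₀)
    (ρ := min ε (ρ / 2)) hρ'.le (by
      intro x hx y hy
      have hxy : dist (x, y) (x₀, x₀) < ρ := by
        rw [Prod.dist_eq, max_lt_iff]
        constructor
        · exact (Metric.mem_closedBall.mp hx).trans_lt
            ((min_le_right _ _).trans_lt (half_lt_self hρ))
        · exact (Metric.mem_closedBall.mp hy).trans_lt
            ((min_le_right _ _).trans_lt (half_lt_self hρ))
      simpa using hpr hq (hball hxy)) (by simpa using hq2.le)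
  exact ⟨y, Metric.closedBall_subset_closedBall (min_le_left _ _) hy, hy0, hy1⟩

end Newton

/-! ### First-order expansion of consistent zeros -/

section Expansion

variable {V : Type*} [NormedAddCommGroup V] [NormedSpace ℝ V]
  {Ω : Type*} [MeasurableSpace Ω] {P : Measure Ω}

/-- Zeros of `B` converging to `x₀` in probability are `√n`-consistent, with first-order term
`-B x₀`. -/
lemma HasSDeriv.expansion_of_zero {B : ℕ × Ω → V → V} {x₀ : V}
    (hB : HasSDeriv (whp P) B (ContinuousLinearMap.id ℝ V) x₀) {N : ℕ × Ω → V}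
    (hN : Tendsto (fun q => √(q.1 : ℝ) • B q x₀ - N q) (whp P) (𝓝 0))
    (hNb : StochBdd P (fun q => ‖N q‖)) {Γ : ℕ × Ω → V} (hΓ : Tendsto Γ (whp P) (𝓝 x₀))
    (h0 : ∀ᶠ q in whp P, B q (Γ q) = 0) :
    StochBdd P (fun q => ‖√(q.1 : ℝ) • (Γ q - x₀)‖) ∧
      Tendsto (fun q => √(q.1 : ℝ) • (Γ q - x₀) + N q) (whp P) (𝓝 0) := by
  have hBb : StochBdd P (fun q => ‖√(q.1 : ℝ) • B q x₀‖) := by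
    have h1 := hNb.add (StochBdd.of_tendsto (tendsto_zero_iff_norm_tendsto_zero.mp hN))
    refine h1.of_isBigO' (isBigO_of_le _ fun q => ?_)
    rw [norm_norm, Real.norm_of_nonneg (by positivity)]
    calc ‖√(q.1 : ℝ) • B q x₀‖ = ‖N q + (√(q.1 : ℝ) • B q x₀ - N q)‖ := by congr 1; abel
      _ ≤ _ := norm_add_le _ _
  -- The strict expansion between Γ and x₀, with B Γ = 0 inserted.
  have e1 : (fun q => B q x₀ + (Γ q - x₀)) =o[whp P] (fun q => Γ q - x₀) := by
    refine ((hB.isLittleO_eval hΓ tendsto_const_nhds).neg_left).congr' ?_ EventuallyEq.rfl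
    filter_upwards [h0] with q hq
    rw [hq]
    simp [add_comm]
  -- Half of ‖Γ - x₀‖ is absorbed on the left, so mere consistency already yields the rate √n.
  have e2 : (fun q => Γ q - x₀) =O[whp P] (fun q => B q x₀) := by
    have h := isLittleO_iff.mp e1 (show (0 : ℝ) < 1 / 2 by norm_num)
    refine IsBigO.of_bound 2 ?_
    filter_upwards [h] with q hq
    have h3 : ‖Γ q - x₀‖ ≤ ‖B q x₀ + (Γ q - x₀)‖ + ‖B q x₀‖ := by
      calc ‖Γ q - x₀‖ = ‖(B q x₀ + (Γ q - x₀)) - B q x₀‖ := by congr 1; abel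
        _ ≤ _ := norm_sub_le _ _
    linarith
  have e3 := e1.trans_isBigO e2
  have hs : (fun q : ℕ × Ω => √(q.1 : ℝ)) =O[whp P] (fun q => √(q.1 : ℝ)) := isBigO_refl _ _
  refine ⟨?_, ?_⟩
  · exact hBb.of_isBigO ((hs.smul e2).norm_right)
  · have h4 := hBb.tendsto_of_isLittleO ((hs.smul_isLittleO e3).norm_right)
    have h5 := h4.sub hN
    rw [sub_zero] at h5
    refine h5.congr fun q => ?_
    rw [smul_add]
    abel

end Expansion

/-! ### Measurable dependence of the zeros on the data -/

section Iterate

variable {p : ℕ}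

/-- The limit of the iteration `Γ ↦ Γ - B x Γ` started at `Γ₀`, read off entrywise. -/
def iterLimit {D : Type*} (B : D → (Fin p → Fin p → ℝ) → Fin p → Fin p → ℝ)
    (Γ₀ : Fin p → Fin p → ℝ) (x : D) : Fin p → Fin p → ℝ :=
  fun j l => limsup (fun k => (fun Γ => Γ - B x Γ)^[k] Γ₀ j l) atTop

/-- An entrywise limsup is measurable whether or not the iteration converges, so no measurable
selection of zeros is needed; where it converges, `iterLimit_eq` identifies the limsup with the
limit. -/
lemma measurable_iterLimit {D : Type*} [MeasurableSpace D]
    {B : D → (Fin p → Fin p → ℝ) → Fin p → Fin p → ℝ} (hB : Measurable (Function.uncurry B))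
    (Γ₀ : Fin p → Fin p → ℝ) (j l : Fin p) : Measurable fun x => iterLimit B Γ₀ x j l := by
  have h : ∀ k, Measurable fun x => (fun Γ => Γ - B x Γ)^[k] Γ₀ := by
    intro k
    induction k with
    | zero => simp
    | succ k ih =>
      simp only [Function.iterate_succ_apply']
      exact ih.sub (hB.comp (measurable_id.prodMk ih))
  refine Measurable.limsup fun k => ?_
  exact (measurable_pi_apply l).comp ((measurable_pi_apply j).comp (h k))

lemma iterLimit_eq {D : Type*} {B : D → (Fin p → Fin p → ℝ) → Fin p → Fin p → ℝ}
    {Γ₀ Γ : Fin p → Fin p → ℝ} {x : D}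
    (h : Tendsto (fun k => (fun Γ => Γ - B x Γ)^[k] Γ₀) atTop (𝓝 Γ)) : iterLimit B Γ₀ x = Γ := by
  ext j l
  have h1 := (tendsto_pi_nhds.mp ((tendsto_pi_nhds.mp h) j)) l
  exact h1.limsup_eq

end Iterate

/-! ### Empirical means: law of large numbers and differentiability -/

section EmpiricalMean

variable {Ω : Type*} {p : ℕ}

/-- The average of `φ` over the first `n` latent observations, at `q = (n, ω)`. -/
def empMean (z : ℕ → Ω → Fin p → ℝ) (φ : (Fin p → ℝ) → ℝ) (q : ℕ × Ω) : ℝ :=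
  (q.1 : ℝ)⁻¹ * ∑ i ∈ Finset.range q.1, φ (z i q.2)

variable {z : ℕ → Ω → Fin p → ℝ}

lemma empMean_add (φ ψ : (Fin p → ℝ) → ℝ) (q : ℕ × Ω) :
    empMean z (fun y => φ y + ψ y) q = empMean z φ q + empMean z ψ q := by
  simp [empMean, Finset.sum_add_distrib, mul_add]

lemma empMean_sub (φ ψ : (Fin p → ℝ) → ℝ) (q : ℕ × Ω) :
    empMean z (fun y => φ y - ψ y) q = empMean z φ q - empMean z ψ q := by
  simp [empMean, Finset.sum_sub_distrib, mul_sub]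

lemma empMean_const_mul (c : ℝ) (φ : (Fin p → ℝ) → ℝ) (q : ℕ × Ω) :
    empMean z (fun y => c * φ y) q = c * empMean z φ q := by
  simp only [empMean, ← Finset.mul_sum]
  ring

lemma empMean_mul_const (c : ℝ) (φ : (Fin p → ℝ) → ℝ) (q : ℕ × Ω) :
    empMean z (fun y => φ y * c) q = empMean z φ q * c := by
  simp only [empMean, ← Finset.sum_mul]
  ring

lemma empMean_sum {ι : Type*} (s : Finset ι) (φ : ι → (Fin p → ℝ) → ℝ) (q : ℕ × Ω) :
    empMean z (fun y => ∑ k ∈ s, φ k y) q = ∑ k ∈ s, empMean z (φ k) q := by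
  simp only [empMean, ← Finset.mul_sum]
  rw [Finset.sum_comm]

lemma empMean_one {q : ℕ × Ω} (hq : q.1 ≠ 0) : empMean z (fun _ => 1) q = 1 := by
  simp [empMean, hq]

lemma abs_empMean_le_of_le {φ ψ : (Fin p → ℝ) → ℝ} (h : ∀ y, |φ y| ≤ ψ y) (q : ℕ × Ω) :
    |empMean z φ q| ≤ empMean z ψ q := by
  rw [empMean, empMean, abs_mul, abs_of_nonneg (by positivity : (0 : ℝ) ≤ (q.1 : ℝ)⁻¹)]
  gcongr
  exact (Finset.abs_sum_le_sum_abs _ _).trans (Finset.sum_le_sum fun i _ => h _)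

variable [MeasurableSpace Ω] {P : Measure Ω}

/-- Law of large numbers. -/
lemma IsICSample.tendsto_empMean [IsProbabilityMeasure P] (hz : IsICSample P z)
    {φ : (Fin p → ℝ) → ℝ}
    (hφ : Measurable φ) (hint : Integrable (fun ω => φ (z 0 ω)) P) :
    Tendsto (empMean z φ) (whp P) (𝓝 (∫ ω, φ (z 0 ω) ∂P)) := by
  rw [tendsto_whp_iff]
  have hm : ∀ i, Measurable fun ω => φ (z i ω) := fun i => hφ.comp (hz.measurable i)
  refine tendstoInMeasure_of_tendsto_ae (fun n => ?_) ?_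
  · refine Measurable.aestronglyMeasurable ?_
    simp only [empMean]
    exact (Finset.measurable_sum _ fun i _ => hm i).const_mul _
  · exact strong_law_ae (fun i ω => φ (z i ω)) hint
      (fun i j hij => (hz.iIndep.indepFun hij).comp hφ hφ)
      (fun i => (hz.identDistrib i).comp hφ)

/-- A weighted modulus of continuity of `h'` at the `j`-th coordinate. -/
def modulus (h' : ℝ → ℝ) (w : (Fin p → ℝ) → ℝ) (j : Fin p) (ρ : ℝ) (y : Fin p → ℝ) : ℝ :=
  |w y| * (1 + ∑ k, |y k|) *
    sSup ((fun τ => |h' (y j + τ * (ρ * (1 + ∑ k, |y k|))) - h' (y j)|) '' Set.Icc (-1) 1)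

/-- Writing the increment as τ times the radius keeps the index set [-1, 1] fixed and compact, so
the supremum is jointly continuous in radius and point. This gives both its measurability and its
decay as the radius shrinks. -/
lemma continuous_modulus {h' : ℝ → ℝ} {w : (Fin p → ℝ) → ℝ} (hh : Continuous h')
    (hw : Continuous w) (j : Fin p) :
    Continuous fun t : ℝ × (Fin p → ℝ) => modulus h' w j t.1 t.2 := by
  unfold modulus
  refine Continuous.mul (by fun_prop) ?_
  refine IsCompact.continuous_sSup (f := fun (t : ℝ × (Fin p → ℝ)) τ =>
    |h' (t.2 j + τ * (t.1 * (1 + ∑ k, |t.2 k|))) - h' (t.2 j)|) isCompact_Icc ?_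
  simp only [Function.HasUncurry.uncurry, id]
  fun_prop

lemma modulus_zero (h' : ℝ → ℝ) (w : (Fin p → ℝ) → ℝ) (j : Fin p) (y : Fin p → ℝ) :
    modulus h' w j 0 y = 0 := by
  have : (fun τ : ℝ => |h' (y j + τ * (0 * (1 + ∑ k, |y k|))) - h' (y j)|) = fun _ => 0 := by
    ext τ
    simp
  rw [modulus, this, Set.Nonempty.image_const ⟨0, by simp⟩]
  simp

lemma modulus_nonneg (h' : ℝ → ℝ) (w : (Fin p → ℝ) → ℝ) (j : Fin p) (ρ : ℝ) (y : Fin p → ℝ) :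
    0 ≤ modulus h' w j ρ y := by
  refine mul_nonneg (by positivity) (Real.sSup_nonneg ?_)
  rintro _ ⟨τ, _, rfl⟩
  positivity

lemma modulus_le {h' : ℝ → ℝ} {w : (Fin p → ℝ) → ℝ} {j : Fin p} {ρ r H : ℝ} {y : Fin p → ℝ}
    (hρ : 0 ≤ ρ) (hρr : ρ ≤ r) (hH : ∀ t : ℝ, |t| ≤ r * (1 + ∑ k, |y k|) →
      |w y| * (1 + ∑ k, |y k|) * |h' (y j + t) - h' (y j)| ≤ H) :
    modulus h' w j ρ y ≤ H := by
  have hN : 0 < 1 + ∑ k, |y k| := by positivity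
  have hne : ((fun τ => |h' (y j + τ * (ρ * (1 + ∑ k, |y k|))) - h' (y j)|) ''
      Set.Icc (-1 : ℝ) 1).Nonempty := ⟨_, 0, by simp, rfl⟩
  have hτ : ∀ τ ∈ Set.Icc (-1 : ℝ) 1,
      |w y| * (1 + ∑ k, |y k|) * |h' (y j + τ * (ρ * (1 + ∑ k, |y k|))) - h' (y j)| ≤ H := by
    intro τ hτ
    apply hH
    rw [abs_mul, abs_of_nonneg (by positivity : 0 ≤ ρ * (1 + ∑ k, |y k|))]
    calc |τ| * (ρ * (1 + ∑ k, |y k|)) ≤ 1 * (r * (1 + ∑ k, |y k|)) := by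
          gcongr
          exact abs_le.mpr hτ
      _ = _ := one_mul _
  unfold modulus
  -- The weight has to be divided out to reach the supremum. If it vanishes, the modulus is zero and
  -- the case τ = 0 shows that H is nonnegative.
  rcases eq_or_ne (w y) 0 with h0 | h0
  · have := hτ 0 (by simp)
    simpa [h0] using this
  have hc : 0 < |w y| * (1 + ∑ k, |y k|) := by positivity
  rw [← le_div_iff₀' hc]
  refine csSup_le hne ?_
  rintro _ ⟨τ, hτ', rfl⟩
  rw [le_div_iff₀' hc]
  exact hτ τ hτ'

lemma le_sSup_modulus {h' : ℝ → ℝ} (hh : Continuous h') {a R : ℝ} (hR : 0 < R) {t : ℝ}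
    (ht : |t| ≤ R) :
    |h' (a + t) - h' a| ≤
      sSup ((fun τ => |h' (a + τ * R) - h' a|) '' Set.Icc (-1) 1) := by
  refine le_csSup (isCompact_Icc.bddAbove_image (by fun_prop)) ⟨t / R, ?_, ?_⟩
  · rw [Set.mem_Icc, ← abs_le, abs_div, abs_of_pos hR]
    exact div_le_one_of_le₀ ht hR.le
  · simp [div_mul_cancel₀ _ hR.ne']

/-- The linear form `(γ, c) ↦ ∑ a_k γ_k - d c`. -/
def affForm (a : Fin p → ℝ) (d : ℝ) : (Fin p → ℝ) × ℝ →L[ℝ] ℝ :=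
  ∑ k, a k • (ContinuousLinearMap.proj k).comp (ContinuousLinearMap.fst ℝ (Fin p → ℝ) ℝ)
    - d • ContinuousLinearMap.snd ℝ (Fin p → ℝ) ℝ

lemma affForm_apply (a : Fin p → ℝ) (d : ℝ) (θ : (Fin p → ℝ) × ℝ) :
    affForm a d θ = ∑ k, a k * θ.1 k - d * θ.2 := by
  simp [affForm, _root_.sum_apply]

lemma abs_dotProduct_sub_le (y : Fin p → ℝ) (θ : (Fin p → ℝ) × ℝ) :
    |θ.1 ⬝ᵥ y - θ.2| ≤ ‖θ‖ * (1 + ∑ k, |y k|) := by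
  have h1 : |θ.1 ⬝ᵥ y| ≤ ∑ k, ‖θ‖ * |y k| := by
    rw [dotProduct]
    refine (Finset.abs_sum_le_sum_abs _ _).trans (Finset.sum_le_sum fun k _ => ?_)
    rw [abs_mul]
    gcongr
    exact (norm_le_pi_norm θ.1 k).trans (norm_fst_le θ)
  have h2 : |θ.2| ≤ ‖θ‖ := norm_snd_le θ
  calc |θ.1 ⬝ᵥ y - θ.2| ≤ |θ.1 ⬝ᵥ y| + |θ.2| := abs_sub _ _
    _ ≤ ∑ k, ‖θ‖ * |y k| + ‖θ‖ := add_le_add h1 h2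
    _ = _ := by rw [← Finset.mul_sum]; ring

/-- Mean value inequality for x ↦ h x - h'(y_j) x on the ball around y_j that contains all arguments
γᵀy - c with (γ, c) within ρ of (e_j, 0). The factor 1 + ∑|y_k| in `modulus` bounds the change of
the argument relative to ‖θ - θ'‖. -/
lemma abs_taylor_le_modulus {h h' : ℝ → ℝ} (hd : ∀ x, HasDerivAt h (h' x) x) (hh : Continuous h')
    (w : (Fin p → ℝ) → ℝ) (j : Fin p) {ρ : ℝ} (hρ : 0 < ρ) (y : Fin p → ℝ)
    {θ θ' : (Fin p → ℝ) × ℝ} (hθ : ‖θ - (Pi.single j 1, 0)‖ ≤ ρ)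
    (hθ' : ‖θ' - (Pi.single j 1, 0)‖ ≤ ρ) :
    |h (θ.1 ⬝ᵥ y - θ.2) * w y - h (θ'.1 ⬝ᵥ y - θ'.2) * w y -
      h' (y j) * w y * ((θ - θ').1 ⬝ᵥ y - (θ - θ').2)| ≤ modulus h' w j ρ y * ‖θ - θ'‖ := by
  have hN : 0 < 1 + ∑ k, |y k| := by positivity
  set R := ρ * (1 + ∑ k, |y k|) with hR
  set S := sSup ((fun τ => |h' (y j + τ * R) - h' (y j)|) '' Set.Icc (-1) 1) with hS
  have hmem : ∀ θ : (Fin p → ℝ) × ℝ, ‖θ - (Pi.single j 1, 0)‖ ≤ ρ →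
      θ.1 ⬝ᵥ y - θ.2 ∈ Metric.closedBall (y j) R := by
    intro θ hθ
    rw [Metric.mem_closedBall, Real.dist_eq]
    have h1 := abs_dotProduct_sub_le y (θ - (Pi.single j 1, 0))
    have h2 : (θ - (Pi.single j 1, 0)).1 ⬝ᵥ y - (θ - (Pi.single j 1, 0)).2 =
        θ.1 ⬝ᵥ y - θ.2 - y j := by
      simp [sub_dotProduct]
      ring
    rw [h2] at h1
    exact h1.trans (by rw [hR]; gcongr)
  have hkey := Convex.norm_image_sub_le_of_norm_deriv_le (f := fun x => h x - h' (y j) * x)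
    (s := Metric.closedBall (y j) R) (C := S) (x := θ'.1 ⬝ᵥ y - θ'.2) (y := θ.1 ⬝ᵥ y - θ.2)
    (fun x _ => ((hd x).sub ((hasDerivAt_id x).const_mul _)).differentiableAt)
    (by
      intro x hx
      have : HasDerivAt (fun x => h x - h' (y j) * x) (h' x - h' (y j) * 1) x :=
        (hd x).sub ((hasDerivAt_id x).const_mul _)
      rw [this.deriv, mul_one, Real.norm_eq_abs]
      rw [Metric.mem_closedBall, Real.dist_eq] at hx
      have := le_sSup_modulus hh (a := y j) (by positivity : 0 < R) hx
      simpa using this)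
    (convex_closedBall _ _) (hmem θ' hθ') (hmem θ hθ)
  have hdiff := abs_dotProduct_sub_le y (θ - θ')
  have e : h (θ.1 ⬝ᵥ y - θ.2) * w y - h (θ'.1 ⬝ᵥ y - θ'.2) * w y -
      h' (y j) * w y * ((θ - θ').1 ⬝ᵥ y - (θ - θ').2) =
      w y * ((h (θ.1 ⬝ᵥ y - θ.2) - h' (y j) * (θ.1 ⬝ᵥ y - θ.2)) -
        (h (θ'.1 ⬝ᵥ y - θ'.2) - h' (y j) * (θ'.1 ⬝ᵥ y - θ'.2))) := by
    simp only [Prod.fst_sub, Prod.snd_sub, sub_dotProduct]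
    ring
  have e2 : θ.1 ⬝ᵥ y - θ.2 - (θ'.1 ⬝ᵥ y - θ'.2) = (θ - θ').1 ⬝ᵥ y - (θ - θ').2 := by
    simp only [Prod.fst_sub, Prod.snd_sub, sub_dotProduct]
    ring
  have hS0 : 0 ≤ S := by
    refine Real.sSup_nonneg ?_
    rintro _ ⟨τ, _, rfl⟩
    positivity
  rw [e, abs_mul]
  rw [Real.norm_eq_abs, Real.norm_eq_abs, e2] at hkey
  calc |w y| * _ ≤ |w y| * (S * (‖θ - θ'‖ * (1 + ∑ k, |y k|))) := by
        gcongr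
        exact hkey.trans (by gcongr)
    _ = modulus h' w j ρ y * ‖θ - θ'‖ := by
        rw [modulus]
        ring

/-- Empirical means of `h (γ ⬝ z - c) w(z)` are strictly differentiable at `(e_j, 0)`, uniformly
with probability tending to one. -/
lemma IsICSample.hasSDeriv_empMean [IsProbabilityMeasure P] (hz : IsICSample P z) {h h' : ℝ → ℝ}
    (hd : ∀ x, HasDerivAt h (h' x) x) (hh : Continuous h') {w : (Fin p → ℝ) → ℝ}
    (hw : Continuous w) (j : Fin p)
    (hint : ∀ k, Integrable (fun ω => h' (z 0 ω j) * w (z 0 ω) * z 0 ω k) P)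
    (hint' : Integrable (fun ω => h' (z 0 ω j) * w (z 0 ω)) P)
    (hdom : ∃ r > 0, ∃ H : Ω → ℝ, Integrable H P ∧ ∀ᵐ ω ∂P, ∀ t : ℝ,
      |t| ≤ r * (1 + ∑ k, |z 0 ω k|) →
      |w (z 0 ω)| * (1 + ∑ k, |z 0 ω k|) * |h' (z 0 ω j + t) - h' (z 0 ω j)| ≤ H ω) :
    HasSDeriv (whp P) (fun q (θ : (Fin p → ℝ) × ℝ) =>
      empMean z (fun y => h (θ.1 ⬝ᵥ y - θ.2) * w y) q)
      (affForm (fun k => ∫ ω, h' (z 0 ω j) * w (z 0 ω) * z 0 ω k ∂P)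
        (∫ ω, h' (z 0 ω j) * w (z 0 ω) ∂P)) (Pi.single j 1, 0) := by
  obtain ⟨r, hr, H, hH, hdom⟩ := hdom
  set a : Fin p → ℝ := fun k => ∫ ω, h' (z 0 ω j) * w (z 0 ω) * z 0 ω k ∂P with ha
  set d : ℝ := ∫ ω, h' (z 0 ω j) * w (z 0 ω) ∂P with hd'
  set aq : ℕ × Ω → Fin p → ℝ := fun q k => empMean z (fun y => h' (y j) * w y * y k) q with haq
  set dq : ℕ × Ω → ℝ := fun q => empMean z (fun y => h' (y j) * w y) q with hdq
  have hhm : Measurable h' := hh.measurable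
  have hwm : Measurable w := hw.measurable
  have hform : Tendsto (fun q => affForm (aq q) (dq q) - affForm a d) (whp P) (𝓝 0) := by
    have h1 : ∀ k, Tendsto (fun q => aq q k) (whp P) (𝓝 (a k)) := fun k =>
      hz.tendsto_empMean (φ := fun y => h' (y j) * w y * y k) (by fun_prop) (hint k)
    have h2 : Tendsto dq (whp P) (𝓝 d) :=
      hz.tendsto_empMean (φ := fun y => h' (y j) * w y) (by fun_prop) hint'
    have h3 : Tendsto (fun q => affForm (aq q) (dq q)) (whp P) (𝓝 (affForm a d)) :=
      (tendsto_finsetSum _ fun k _ => (h1 k).smul_const _).sub (h2.smul_const _)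
    simpa using h3.sub_const (affForm a d)
  -- the part due to the fluctuation of the derivative
  have e1 : (fun t : (ℕ × Ω) × ((Fin p → ℝ) × ℝ) × ((Fin p → ℝ) × ℝ) =>
      (affForm (aq t.1) (dq t.1) - affForm a d) (t.2.1 - t.2.2))
      =o[whp P ×ˢ 𝓝 ((Pi.single j 1, 0), (Pi.single j 1, 0))] (fun t => t.2.1 - t.2.2) := by
    refine isLittleO_iff.mpr fun c hc => ?_
    have h4 := (tendsto_zero_iff_norm_tendsto_zero.mp hform).eventually (ge_mem_nhds hc)
    filter_upwards [tendsto_fst.eventually h4] with t ht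
    exact (ContinuousLinearMap.le_opNorm _ _).trans (by gcongr)
  -- the part due to the remainder of the Taylor expansion
  have e2 : (fun t : (ℕ × Ω) × ((Fin p → ℝ) × ℝ) × ((Fin p → ℝ) × ℝ) =>
      empMean z (fun y => h (t.2.1.1 ⬝ᵥ y - t.2.1.2) * w y) t.1 -
      empMean z (fun y => h (t.2.2.1 ⬝ᵥ y - t.2.2.2) * w y) t.1 -
      affForm (aq t.1) (dq t.1) (t.2.1 - t.2.2))
      =o[whp P ×ˢ 𝓝 ((Pi.single j 1, 0), (Pi.single j 1, 0))] (fun t => t.2.1 - t.2.2) := by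
    refine isLittleO_iff.mpr fun c hc => ?_
    -- A sequence of radii below r, along which dominated convergence shows that the expected
    -- modulus tends to zero.
    have hρ0 : Tendsto (fun k : ℕ => r / ((k : ℝ) + 1)) atTop (𝓝 0) :=
      tendsto_const_nhds.div_atTop (tendsto_atTop_add_const_right _ _ tendsto_natCast_atTop_atTop)
    have hmodc := continuous_modulus (p := p) hh hw j
    have hmm : ∀ ρ, Measurable (modulus h' w j ρ) := fun ρ =>
      (hmodc.comp (continuous_const.prodMk continuous_id)).measurable
    have hle : ∀ k : ℕ, r / ((k : ℝ) + 1) ≤ r := fun k =>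
      div_le_self hr.le (by linarith [(Nat.cast_nonneg k : (0 : ℝ) ≤ k)])
    have hbd : ∀ k : ℕ, ∀ᵐ ω ∂P, ‖modulus h' w j (r / ((k : ℝ) + 1)) (z 0 ω)‖ ≤ H ω := by
      intro k
      filter_upwards [hdom] with ω hω
      rw [Real.norm_of_nonneg (modulus_nonneg _ _ _ _ _)]
      exact modulus_le (by positivity) (hle k) hω
    have hms : ∀ k : ℕ, AEStronglyMeasurable
        (fun ω => modulus h' w j (r / ((k : ℝ) + 1)) (z 0 ω)) P := fun k =>
      ((hmm _).comp (hz.measurable 0)).aestronglyMeasurable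
    have hlim : Tendsto (fun k : ℕ => ∫ ω, modulus h' w j (r / ((k : ℝ) + 1)) (z 0 ω) ∂P)
        atTop (𝓝 (∫ _, (0 : ℝ) ∂P)) := by
      refine tendsto_integral_of_dominated_convergence H hms hH hbd (ae_of_all _ fun ω => ?_)
      have h5 : Tendsto (fun ρ => modulus h' w j ρ (z 0 ω)) (𝓝 0)
          (𝓝 (modulus h' w j 0 (z 0 ω))) :=
        (hmodc.comp (continuous_id.prodMk continuous_const)).tendsto 0
      rw [modulus_zero] at h5
      exact h5.comp hρ0
    rw [integral_zero] at hlim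
    -- The radius is fixed before n grows: its expected modulus is below c, hence by the law of
    -- large numbers so is its empirical modulus with probability tending to one.
    obtain ⟨k, hk⟩ := (hlim.eventually (gt_mem_nhds hc)).exists
    set ρ := r / ((k : ℝ) + 1) with hρ
    have hρpos : 0 < ρ := by positivity
    have hmean := (hz.tendsto_empMean (hmm ρ) (hH.mono' (hms k) (hbd k))).eventually
      (gt_mem_nhds hk)
    have hball : ∀ᶠ t in 𝓝 (((Pi.single j 1, 0), (Pi.single j 1, 0)) :
        ((Fin p → ℝ) × ℝ) × ((Fin p → ℝ) × ℝ)),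
        ‖t.1 - (Pi.single j 1, 0)‖ ≤ ρ ∧ ‖t.2 - (Pi.single j 1, 0)‖ ≤ ρ := by
      filter_upwards [Metric.closedBall_mem_nhds _ hρpos] with t ht
      rw [Metric.mem_closedBall, Prod.dist_eq, max_le_iff, dist_eq_norm, dist_eq_norm] at ht
      exact ht
    filter_upwards [tendsto_fst.eventually hmean, tendsto_snd.eventually hball] with t h1 h2
    have h3 : empMean z (fun y => h (t.2.1.1 ⬝ᵥ y - t.2.1.2) * w y) t.1 -
        empMean z (fun y => h (t.2.2.1 ⬝ᵥ y - t.2.2.2) * w y) t.1 -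
        affForm (aq t.1) (dq t.1) (t.2.1 - t.2.2) =
        empMean z (fun y => h (t.2.1.1 ⬝ᵥ y - t.2.1.2) * w y - h (t.2.2.1 ⬝ᵥ y - t.2.2.2) * w y -
          h' (y j) * w y * ((t.2.1 - t.2.2).1 ⬝ᵥ y - (t.2.1 - t.2.2).2)) t.1 := by
      rw [empMean_sub, empMean_sub, affForm_apply]
      congr 1
      simp only [mul_sub, empMean_sub, empMean_mul_const, dotProduct, Finset.mul_sum, empMean_sum,
        haq, hdq]
      congr 1
      refine Finset.sum_congr rfl fun k _ => ?_
      rw [← empMean_mul_const]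
      congr 1
      ext y
      ring
    rw [h3, Real.norm_eq_abs]
    refine (abs_empMean_le_of_le (ψ := fun y => modulus h' w j ρ y * ‖t.2.1 - t.2.2‖)
      (fun y => abs_taylor_le_modulus hd hh w j hρpos y h2.1 h2.2) _).trans ?_
    rw [empMean_mul_const]
    gcongr
  refine (e1.add e2).congr_left fun t => ?_
  simp only [_root_.sub_apply]
  ring

end EmpiricalMean

/-- The identity matrix as an array. -/
def idArr (p : ℕ) : Fin p → Fin p → ℝ := fun j => Pi.single j 1

lemma idArr_apply {p : ℕ} (j l : Fin p) : idArr p j l = (1 : Matrix (Fin p) (Fin p) ℝ) j l := by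
  simp [idArr, Matrix.one_apply, Pi.single_apply, eq_comm]

/-- The coordinate functional `Γ ↦ Γ j l`. -/
def coord {p : ℕ} (j l : Fin p) : (Fin p → Fin p → ℝ) →L[ℝ] ℝ :=
  (ContinuousLinearMap.proj l).comp
    (ContinuousLinearMap.proj (R := ℝ) (φ := fun _ : Fin p => Fin p → ℝ) j)

@[simp]
lemma coord_apply {p : ℕ} (j l : Fin p) (Γ : Fin p → Fin p → ℝ) : coord j l Γ = Γ j l := rfl

/-! ### The model: moments and domination -/

section Model

variable {Ω : Type*} [MeasurableSpace Ω] {P : Measure Ω} {p : ℕ} {G : ℝ → ℝ}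
  {z : ℕ → Ω → Fin p → ℝ}

/-- The standing assumptions on the contrast function and the latent sample. -/
structure Model (P : Measure Ω) (G : ℝ → ℝ) (z : ℕ → Ω → Fin p → ℝ) : Prop where
  contrast : IsContrast G
  sample : IsICSample P z
  standardized : IsStandardized P (z 0)
  moments : HasMoments P G (z 0)
  dominated : LocallyDominated P G (z 0)

namespace Model

lemma hasDerivAt_contrast (hM : Model P G z) (x : ℝ) : HasDerivAt G (deriv G x) x :=
  ((hM.contrast.contDiff.differentiable (by norm_num)) x).hasDerivAt

lemma contDiff_deriv (hM : Model P G z) : ContDiff ℝ 1 (deriv G) := by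
  have h := hM.contrast.contDiff
  rw [show (2 : WithTop ℕ∞) = 1 + 1 by norm_num, contDiff_succ_iff_deriv] at h
  exact h.2.2

lemma continuous_g (hM : Model P G z) : Continuous (deriv G) := hM.contDiff_deriv.continuous

lemma continuous_contrast (hM : Model P G z) : Continuous G := hM.contrast.contDiff.continuous

lemma continuous_g' (hM : Model P G z) : Continuous (deriv (deriv G)) :=
  hM.contDiff_deriv.continuous_deriv le_rfl

lemma hasDerivAt_g (hM : Model P G z) (x : ℝ) :
    HasDerivAt (deriv G) (deriv (deriv G) x) x :=
  ((hM.contDiff_deriv.differentiable (by norm_num)) x).hasDerivAt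

lemma measurable_comp (hM : Model P G z) (k : Fin p) : Measurable fun ω => z 0 ω k :=
  (measurable_pi_apply k).comp (hM.sample.measurable 0)

lemma memLp (hM : Model P G z) (k : Fin p) : MemLp (fun ω => z 0 ω k) 2 P :=
  (hM.standardized k).1

lemma integral_eq_zero (hM : Model P G z) (k : Fin p) : ∫ ω, z 0 ω k ∂P = 0 :=
  (hM.standardized k).2.1

lemma integral_sq (hM : Model P G z) (k : Fin p) : ∫ ω, z 0 ω k ^ 2 ∂P = 1 :=
  (hM.standardized k).2.2

lemma indepFun_comp (hM : Model P G z) {j l : Fin p} (h : j ≠ l) {φ ψ : ℝ → ℝ}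
    (hφ : Measurable φ) (hψ : Measurable ψ) :
    IndepFun (fun ω => φ (z 0 ω j)) (fun ω => ψ (z 0 ω l)) P :=
  (hM.sample.iIndep_components.indepFun h).comp hφ hψ

lemma integral_mul (hM : Model P G z) {j l : Fin p} (h : j ≠ l) {φ ψ : ℝ → ℝ}
    (hφ : Measurable φ) (hψ : Measurable ψ) :
    ∫ ω, φ (z 0 ω j) * ψ (z 0 ω l) ∂P = (∫ ω, φ (z 0 ω j) ∂P) * ∫ ω, ψ (z 0 ω l) ∂P :=
  (hM.indepFun_comp h hφ hψ).integral_fun_mul_eq_mul_integral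
    (hφ.comp (hM.measurable_comp j)).aestronglyMeasurable
    (hψ.comp (hM.measurable_comp l)).aestronglyMeasurable

/-- The l-th component is centred and independent of the pair of the j-th and k-th ones; j = k is
allowed. -/
lemma integral_mul_mul (hM : Model P G z) {j k l : Fin p} (hj : j ≠ l) (hk : k ≠ l)
    {φ ψ : ℝ → ℝ} (hφ : Measurable φ) (hψ : Measurable ψ) :
    ∫ ω, φ (z 0 ω j) * ψ (z 0 ω k) * z 0 ω l ∂P = 0 := by
  have h1 := (hM.sample.iIndep_components.indepFun_prodMk
    (fun k => hM.measurable_comp k) j k l hj hk).comp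
      (φ := fun t : ℝ × ℝ => φ t.1 * ψ t.2) (ψ := fun t : ℝ => t) (by fun_prop) measurable_id
  have h2 := h1.integral_fun_mul_eq_mul_integral
    (by
      have := hM.measurable_comp j
      have := hM.measurable_comp k
      exact Measurable.aestronglyMeasurable (by fun_prop))
    (hM.measurable_comp l).aestronglyMeasurable
  simp only [Function.comp_def] at h2
  rw [h2, hM.integral_eq_zero, mul_zero]

/-- By Cauchy–Schwarz, squares of weights of linear growth are covered by the weight 1 + ∑ z_k² of
(A4). -/
lemma sq_one_add_sum_abs_le (y : Fin p → ℝ) :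
    (1 + ∑ k, |y k|) ^ 2 ≤ (p + 1) * (1 + ∑ k, y k ^ 2) := by
  have h1 : (∑ k, |y k|) ^ 2 ≤ p * ∑ k, y k ^ 2 := by
    simpa using sq_sum_le_card_mul_sum_sq (s := Finset.univ) (f := fun k => |y k|)
  have h2 : 2 * ∑ k, |y k| ≤ p + ∑ k, y k ^ 2 := by
    rw [Finset.mul_sum]
    calc ∑ k, 2 * |y k| ≤ ∑ k : Fin p, (1 + y k ^ 2) := by
          refine Finset.sum_le_sum fun k _ => ?_
          nlinarith [sq_nonneg (|y k| - 1), sq_abs (y k)]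
      _ = _ := by simp [Finset.sum_add_distrib]
  nlinarith

/-- Domination of `g'` with weights of linear growth. -/
lemma dominated_g (hM : Model P G z) (j : Fin p) {w : (Fin p → ℝ) → ℝ}
    (hw : ∀ y, |w y| ≤ 1 + ∑ k, |y k|) :
    ∃ r > 0, ∃ H : Ω → ℝ, Integrable H P ∧ ∀ᵐ ω ∂P, ∀ t : ℝ,
      |t| ≤ r * (1 + ∑ k, |z 0 ω k|) →
      |w (z 0 ω)| * (1 + ∑ k, |z 0 ω k|) *
        |deriv (deriv G) (z 0 ω j + t) - deriv (deriv G) (z 0 ω j)| ≤ H ω := by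
  obtain ⟨r, hr, H, hH, hdom⟩ := hM.dominated j
  refine ⟨r, hr, fun ω => (p + 1) * (2 * H ω), (hH.const_mul _).const_mul _, ?_⟩
  filter_upwards [hdom] with ω hω t ht
  -- The increment t = 0 is admissible, so the same H bounds g' at z_j itself.
  have h0 := hω 0 (by simp; positivity)
  have h1 := hω t ht
  rw [add_zero] at h0
  have hN : 0 ≤ 1 + ∑ k, |z 0 ω k| := by positivity
  calc |w (z 0 ω)| * (1 + ∑ k, |z 0 ω k|) *
        |deriv (deriv G) (z 0 ω j + t) - deriv (deriv G) (z 0 ω j)|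
      ≤ (1 + ∑ k, |z 0 ω k|) * (1 + ∑ k, |z 0 ω k|) *
        (|deriv (deriv G) (z 0 ω j + t)| + |deriv (deriv G) (z 0 ω j)|) := by
        gcongr
        · exact hw _
        · exact abs_sub _ _
    _ ≤ ((p + 1) * (1 + ∑ k, z 0 ω k ^ 2)) *
        (|deriv (deriv G) (z 0 ω j + t)| + |deriv (deriv G) (z 0 ω j)|) := by
        refine mul_le_mul_of_nonneg_right ?_ (by positivity)
        rw [← sq]
        exact sq_one_add_sum_abs_le _
    _ = (p + 1) * ((1 + ∑ k, z 0 ω k ^ 2) * |deriv (deriv G) (z 0 ω j + t)| +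
        (1 + ∑ k, z 0 ω k ^ 2) * |deriv (deriv G) (z 0 ω j)|) := by ring
    _ ≤ (p + 1) * (2 * H ω) := by
        gcongr
        linarith

/-- Domination of the increments of `g`. -/
lemma dominated_contrast (hM : Model P G z) (j : Fin p) :
    ∃ r > 0, ∃ H : Ω → ℝ, Integrable H P ∧ ∀ᵐ ω ∂P, ∀ t : ℝ,
      |t| ≤ r * (1 + ∑ k, |z 0 ω k|) →
      |(1 : ℝ)| * (1 + ∑ k, |z 0 ω k|) *
        |deriv G (z 0 ω j + t) - deriv G (z 0 ω j)| ≤ H ω := by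
  obtain ⟨r, hr, H, hH, hdom⟩ := hM.dominated j
  refine ⟨r, hr, fun ω => (p + 1) * (r * H ω), (hH.const_mul _).const_mul _, ?_⟩
  filter_upwards [hdom] with ω hω t ht
  set N := 1 + ∑ k, |z 0 ω k| with hN
  set D := 1 + ∑ k, z 0 ω k ^ 2 with hD
  have hNpos : 0 < N := by positivity
  have hDpos : 0 < D := by positivity
  have hH0 : 0 ≤ H ω := le_trans (by positivity) (hω 0 (by simp; positivity))
  -- On the ball of radius r N one has |g'| ≤ H / D, so the increments of g are at most r N H / D;
  -- the extra weight N makes N² / D ≤ p + 1.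
  have hkey := Convex.norm_image_sub_le_of_norm_deriv_le (f := deriv G)
    (s := Metric.closedBall (z 0 ω j) (r * N)) (C := H ω / D) (x := z 0 ω j) (y := z 0 ω j + t)
    (fun x _ => (hM.hasDerivAt_g x).differentiableAt)
    (by
      intro x hx
      rw [Metric.mem_closedBall, Real.dist_eq] at hx
      have := hω _ hx
      rw [le_div_iff₀' hDpos, Real.norm_eq_abs]
      simpa using this)
    (convex_closedBall _ _) (Metric.mem_closedBall_self (by positivity))
    (by simpa [Real.dist_eq] using ht)
  rw [Real.norm_eq_abs, Real.norm_eq_abs, add_sub_cancel_left] at hkey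
  calc |(1 : ℝ)| * N * |deriv G (z 0 ω j + t) - deriv G (z 0 ω j)|
      ≤ 1 * N * (H ω / D * (r * N)) := by
        rw [abs_one]
        gcongr
        exact hkey.trans (by gcongr)
    _ = N ^ 2 * (H ω / D * r) := by ring
    _ ≤ ((p + 1) * D) * (H ω / D * r) := by
        gcongr
        exact sq_one_add_sum_abs_le _
    _ = (p + 1) * (r * H ω) := by field_simp

/-- The zero-increment case of (A4) provides the integrable majorant. -/
lemma integrable_g'_mul (hM : Model P G z) (j : Fin p) {w : (Fin p → ℝ) → ℝ} (hwm : Measurable w)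
    (hw : ∀ y, |w y| ≤ (1 + ∑ k, |y k|) ^ 2) :
    Integrable (fun ω => deriv (deriv G) (z 0 ω j) * w (z 0 ω)) P := by
  obtain ⟨r, hr, H, hH, hdom⟩ := hM.dominated j
  have hm := hM.measurable_comp j
  have hm' := hM.sample.measurable 0
  refine (hH.const_mul (p + 1 : ℝ)).mono'
    (((hM.continuous_g'.measurable.comp hm).mul (hwm.comp hm')).aestronglyMeasurable) ?_
  filter_upwards [hdom] with ω hω
  have h0 := hω 0 (by simp; positivity)
  rw [add_zero] at h0
  rw [Real.norm_eq_abs, abs_mul]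
  calc |deriv (deriv G) (z 0 ω j)| * |w (z 0 ω)|
      ≤ |deriv (deriv G) (z 0 ω j)| * ((p + 1) * (1 + ∑ k, z 0 ω k ^ 2)) := by
        gcongr
        exact (hw _).trans (sq_one_add_sum_abs_le _)
    _ = (p + 1) * ((1 + ∑ k, z 0 ω k ^ 2) * |deriv (deriv G) (z 0 ω j)|) := by ring
    _ ≤ (p + 1) * H ω := by gcongr

lemma abs_le_one_add_sum (y : Fin p → ℝ) (k : Fin p) : |y k| ≤ 1 + ∑ k, |y k| := by
  have := Finset.single_le_sum (f := fun k => |y k|) (fun i _ => abs_nonneg _) (Finset.mem_univ k)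
  linarith

lemma one_le_one_add_sum (y : Fin p → ℝ) : 1 ≤ 1 + ∑ k, |y k| := by
  have : 0 ≤ ∑ k, |y k| := by positivity
  linarith

variable [IsProbabilityMeasure P]

/-- The empirical mean of `g (γ ⬝ z - c) w(z)`. -/
lemma hasSDeriv_g (hM : Model P G z) (j : Fin p) {w : (Fin p → ℝ) → ℝ} (hwc : Continuous w)
    (hw : ∀ y, |w y| ≤ 1 + ∑ k, |y k|) :
    HasSDeriv (whp P) (fun q (θ : (Fin p → ℝ) × ℝ) =>
      empMean z (fun y => deriv G (θ.1 ⬝ᵥ y - θ.2) * w y) q)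
      (affForm (fun k => ∫ ω, deriv (deriv G) (z 0 ω j) * w (z 0 ω) * z 0 ω k ∂P)
        (∫ ω, deriv (deriv G) (z 0 ω j) * w (z 0 ω) ∂P)) (Pi.single j 1, 0) := by
  refine hM.sample.hasSDeriv_empMean hM.hasDerivAt_g hM.continuous_g' hwc j (fun k => ?_) ?_
    (hM.dominated_g j hw)
  · have hwm := hwc.measurable
    have := hM.integrable_g'_mul j (w := fun y => w y * y k) (by fun_prop) (fun y => by
      rw [abs_mul, sq]
      exact mul_le_mul (hw y) (abs_le_one_add_sum y k) (abs_nonneg _)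
        (zero_le_one.trans (one_le_one_add_sum y)))
    simpa [mul_assoc] using this
  · refine hM.integrable_g'_mul j hwc.measurable fun y => (hw y).trans ?_
    nlinarith [one_le_one_add_sum y]

lemma hasSDeriv_contrast (hM : Model P G z) (j : Fin p) :
    HasSDeriv (whp P) (fun q (θ : (Fin p → ℝ) × ℝ) =>
      empMean z (fun y => G (θ.1 ⬝ᵥ y - θ.2) * 1) q)
      (affForm (fun k => ∫ ω, deriv G (z 0 ω j) * 1 * z 0 ω k ∂P)
        (∫ ω, deriv G (z 0 ω j) * 1 ∂P)) (Pi.single j 1, 0) := by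
  refine hM.sample.hasSDeriv_empMean hM.hasDerivAt_contrast hM.continuous_g continuous_const j
    (fun k => ?_) ?_ (hM.dominated_contrast j)
  · simp only [mul_one]
    exact (hM.moments.memLp_g j).integrable_mul (hM.memLp k)
  · simp only [mul_one]
    exact (hM.moments.memLp_g j).integrable one_le_two

/-- The mean of the latent sample. -/
def zbar (z : ℕ → Ω → Fin p → ℝ) (q : ℕ × Ω) : Fin p → ℝ := fun k => empMean z (fun y => y k) q

lemma tendsto_zbar (hM : Model P G z) (k : Fin p) :
    Tendsto (fun q => zbar z q k) (whp P) (𝓝 0) := by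
  have := hM.sample.tendsto_empMean (φ := fun y => y k) (measurable_pi_apply k)
    ((hM.memLp k).integrable one_le_two)
  rwa [hM.integral_eq_zero] at this

/-- Scaled means of centred square-integrable functions are stochastically bounded. -/
lemma stochBdd_sqrt_mul_empMean (hM : Model P G z) {φ : (Fin p → ℝ) → ℝ} (hφ : Measurable φ)
    (hφ2 : MemLp (fun ω => φ (z 0 ω)) 2 P) (h0 : ∫ ω, φ (z 0 ω) ∂P = 0) :
    StochBdd P (fun q => √(q.1 : ℝ) * empMean z φ q) := by
  have h := tendstoInDistribution_inv_sqrt_mul_sum_sub (P := P) (X := fun i ω => φ (z i ω))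
    (Y := id) (P' := gaussianReal 0 Var[fun ω => φ (z 0 ω); P].toNNReal) HasLaw.id hφ2
    (hM.sample.iIndep.comp (fun _ => φ) (fun _ => hφ))
    (fun i => (hM.sample.identDistrib i).comp hφ)
  refine (StochBdd.of_tendstoInDistribution h).congr' (Eventually.of_forall fun q => ?_)
  simp only [h0, mul_zero, sub_zero, empMean]
  rw [← mul_assoc]
  congr 1
  rw [← Real.sqrt_div_self, div_eq_mul_inv]

lemma stochBdd_zbar (hM : Model P G z) (k : Fin p) :
    StochBdd P (fun q => √(q.1 : ℝ) * zbar z q k) :=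
  hM.stochBdd_sqrt_mul_empMean (measurable_pi_apply k) (hM.memLp k) (hM.integral_eq_zero k)

end Model

end Model

/-! ### Sample statistics as empirical means of the latent vectors -/

section SampleFormulas

variable {Ω : Type*} {p : ℕ} {G : ℝ → ℝ} {z : ℕ → Ω → Fin p → ℝ} {m : Fin p → ℝ}

/-- The observed data set at `q = (n, ω)`. -/
def obs (m : Fin p → ℝ) (z : ℕ → Ω → Fin p → ℝ) (q : ℕ × Ω) : Fin q.1 → Fin p → ℝ :=
  firstObs (icObs m 1 z) q.1 q.2

/-- The location m cancels against its contribution to the sample mean; an index `i : Fin q.1`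
already forces a nonempty sample. -/
lemma centered_obs (q : ℕ × Ω) (i : Fin q.1) :
    centered (obs m z q) i = z i q.2 - Model.zbar z q := by
  have hq : (q.1 : ℝ) ≠ 0 := by
    have := i.pos
    positivity
  ext k
  simp only [centered, obs, firstObs, icObs, sampleMean, Model.zbar, empMean, one_mulVec,
    Pi.sub_apply, Pi.add_apply, Pi.smul_apply, Finset.sum_apply, smul_eq_mul]
  rw [Finset.sum_add_distrib, Finset.sum_const, Finset.card_univ, Fintype.card_fin, nsmul_eq_mul,
    mul_add]
  rw [Fin.sum_univ_eq_sum_range (fun i => z i q.2 k) q.1]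
  field_simp
  ring

lemma sampleG_obs (q : ℕ × Ω) (γ : Fin p → ℝ) :
    sampleG G (obs m z q) γ =
      empMean z (fun y => G (γ ⬝ᵥ y - γ ⬝ᵥ Model.zbar z q) * 1) q := by
  simp only [sampleG, centered_obs, dotProduct_sub, empMean, mul_one]
  rw [Fin.sum_univ_eq_sum_range (fun i => G (γ ⬝ᵥ z i q.2 - γ ⬝ᵥ Model.zbar z q)) q.1]

lemma sampleT_obs (q : ℕ × Ω) (γ : Fin p → ℝ) (l : Fin p) :
    sampleT G (obs m z q) γ l =
      empMean z (fun y => deriv G (γ ⬝ᵥ y - γ ⬝ᵥ Model.zbar z q) * y l) q -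
      Model.zbar z q l * empMean z (fun y => deriv G (γ ⬝ᵥ y - γ ⬝ᵥ Model.zbar z q) * 1) q := by
  rw [mul_comm, ← empMean_mul_const, ← empMean_sub]
  simp only [sampleT, centered_obs, dotProduct_sub, empMean, Pi.smul_apply, Finset.sum_apply,
    smul_eq_mul, Pi.sub_apply]
  rw [Fin.sum_univ_eq_sum_range (fun i => deriv G (γ ⬝ᵥ z i q.2 - γ ⬝ᵥ Model.zbar z q) *
    (z i q.2 l - Model.zbar z q l)) q.1]
  simp only [mul_sub, mul_one]

lemma sampleCov_obs (q : ℕ × Ω) (j l : Fin p) :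
    sampleCov (obs m z q) j l =
      empMean z (fun y => y j * y l) q - Model.zbar z q j * Model.zbar z q l := by
  -- For the empty sample both sides are zero.
  rcases eq_or_ne q.1 0 with hq | hq
  · simp [sampleCov, Model.zbar, empMean, hq]
  have hq' : (q.1 : ℝ) ≠ 0 := by exact_mod_cast hq
  simp only [sampleCov, centered_obs, Matrix.smul_apply, Matrix.sum_apply, vecMulVec_apply,
    Pi.sub_apply, smul_eq_mul]
  rw [Fin.sum_univ_eq_sum_range (fun i => (z i q.2 j - Model.zbar z q j) *
    (z i q.2 l - Model.zbar z q l)) q.1]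
  have h : empMean z (fun y => (y j - Model.zbar z q j) * (y l - Model.zbar z q l)) q =
      empMean z (fun y => y j * y l) q - Model.zbar z q j * Model.zbar z q l := by
    have e : (fun y : Fin p → ℝ => (y j - Model.zbar z q j) * (y l - Model.zbar z q l)) =
        fun y => y j * y l - y j * Model.zbar z q l - y l * Model.zbar z q j
          + (Model.zbar z q j * Model.zbar z q l) * 1 := by
      ext y
      ring
    rw [e, empMean_add, empMean_sub, empMean_sub, empMean_mul_const, empMean_mul_const,
      empMean_const_mul, empMean_one hq]
    simp only [Model.zbar]
    ring
  exact h

end SampleFormulas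

/-! ### Linearization of the sample statistics at the identity -/

namespace Model

variable {Ω : Type*} [MeasurableSpace Ω] {P : Measure Ω} {p : ℕ} {G : ℝ → ℝ}
  {z : ℕ → Ω → Fin p → ℝ} {m : Fin p → ℝ}

lemma oracleT_eq (q : ℕ × Ω) (j l : Fin p) :
    oracleT P G z q.1 j q.2 l =
      empMean z (fun y => deriv G (y j) * y l) q - mu P G (z 0) j * zbar z q l := by
  rw [zbar, ← empMean_const_mul, ← empMean_sub]
  simp [oracleT, empMean, sub_mul]

lemma integrable_g_mul (hM : Model P G z) (j l : Fin p) :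
    Integrable (fun ω => deriv G (z 0 ω j) * z 0 ω l) P :=
  (hM.moments.memLp_g j).integrable_mul (hM.memLp l)

lemma integral_g_mul (hM : Model P G z) {j l : Fin p} (h : j ≠ l) :
    ∫ ω, deriv G (z 0 ω j) * z 0 ω l ∂P = 0 := by
  rw [hM.integral_mul h hM.continuous_g.measurable measurable_id']
  simp [hM.integral_eq_zero]

lemma integral_g'_mul (hM : Model P G z) {j l : Fin p} (h : j ≠ l) :
    ∫ ω, deriv (deriv G) (z 0 ω j) * z 0 ω l ∂P = 0 := by
  rw [hM.integral_mul h hM.continuous_g'.measurable measurable_id']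
  simp [hM.integral_eq_zero]

lemma integral_g'_mul_mul (hM : Model P G z) {j l : Fin p} (h : j ≠ l) (k : Fin p) :
    ∫ ω, deriv (deriv G) (z 0 ω j) * z 0 ω l * z 0 ω k ∂P =
      if k = l then del P G (z 0) j else 0 := by
  have hm := hM.continuous_g'.measurable
  split_ifs with hk
  · subst hk
    have := hM.integral_mul h hm (ψ := fun x => x ^ 2) (by fun_prop)
    simp only [hM.integral_sq, mul_one] at this
    rw [del, ← this]
    congr 1
    ext ω
    ring
  · have := hM.integral_mul_mul (k := k) h hk hm measurable_id'
    rw [← this]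
    congr 1
    ext ω
    ring

variable [IsProbabilityMeasure P]

/-- Centring enters as the shift c = γᵀz̄. It contributes nothing to the derivative because z̄ tends
to zero in probability. -/
lemma hasSDeriv_centering (hM : Model P G z) (γ₀ : Fin p → ℝ) :
    HasSDeriv (whp P) (fun q (γ : Fin p → ℝ) => (γ, γ ⬝ᵥ zbar z q))
      (ContinuousLinearMap.inl ℝ (Fin p → ℝ) ℝ) γ₀ := by
  have h : ∀ k, (fun t : (ℕ × Ω) × (Fin p → ℝ) × (Fin p → ℝ) =>
      zbar z t.1 k * (t.2.1 k - t.2.2 k)) =o[whp P ×ˢ 𝓝 (γ₀, γ₀)] (fun t => t.2.1 - t.2.2) := by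
    intro k
    have h1 : (fun t : (ℕ × Ω) × (Fin p → ℝ) × (Fin p → ℝ) => zbar z t.1 k)
        =o[whp P ×ˢ 𝓝 (γ₀, γ₀)] (fun _ => (1 : ℝ)) := by
      rw [isLittleO_one_iff]
      exact (hM.tendsto_zbar k).comp tendsto_fst
    have h2 : (fun t : (ℕ × Ω) × (Fin p → ℝ) × (Fin p → ℝ) => t.2.1 k - t.2.2 k)
        =O[whp P ×ˢ 𝓝 (γ₀, γ₀)] (fun t => ‖t.2.1 - t.2.2‖) := by
      refine isBigO_of_le _ fun t => ?_
      rw [norm_norm]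
      exact norm_le_pi_norm (t.2.1 - t.2.2) k
    simpa using h1.mul_isBigO h2
  have h3 := IsLittleO.sum (fun k (_ : k ∈ Finset.univ) => h k)
  have h4 : (fun t : (ℕ × Ω) × (Fin p → ℝ) × (Fin p → ℝ) =>
      ((0 : Fin p → ℝ), (t.2.1 - t.2.2) ⬝ᵥ zbar z t.1)) =o[whp P ×ˢ 𝓝 (γ₀, γ₀)]
      (fun t => t.2.1 - t.2.2) := by
    refine IsLittleO.prod_left (isLittleO_zero _ _) (h3.congr_left fun t => ?_)
    simp [dotProduct, Finset.sum_apply, mul_comm]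
  refine h4.congr_left fun t => ?_
  simp [sub_dotProduct]

lemma tendsto_centering (hM : Model P G z) (γ₀ : Fin p → ℝ) :
    Tendsto (fun q => (γ₀, γ₀ ⬝ᵥ zbar z q)) (whp P) (𝓝 (γ₀, 0)) := by
  refine tendsto_const_nhds.prodMk_nhds ?_
  have : Tendsto (fun q => ∑ k, γ₀ k * zbar z q k) (whp P) (𝓝 (∑ k : Fin p, γ₀ k * 0)) :=
    tendsto_finsetSum _ fun k _ => (hM.tendsto_zbar k).const_mul _
  simpa [dotProduct] using this

lemma _root_.FastICA.HasSDeriv.tendsto_eval {Q V W : Type*} {L : Filter Q} [NormedAddCommGroup V]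
    [NormedSpace ℝ V] [NormedAddCommGroup W] [NormedSpace ℝ W] {f : Q → V → W} {f' : V →L[ℝ] W}
    {x₀ : V} (hf : HasSDeriv L f f' x₀) {a : W} (ha : Tendsto (fun q => f q x₀) L (𝓝 a))
    {u : Q → V} (hu : Tendsto u L (𝓝 x₀)) : Tendsto (fun q => f q (u q)) L (𝓝 a) :=
  (hf.tendsto_uncurry ha).comp (tendsto_id.prodMk hu)

lemma tendsto_g (hM : Model P G z) (j : Fin p) {w : (Fin p → ℝ) → ℝ} (hw : Measurable w)
    (hint : Integrable (fun ω => deriv G (z 0 ω j) * w (z 0 ω)) P) :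
    Tendsto (fun q => empMean z (fun y => deriv G
      (((Pi.single j 1, 0) : (Fin p → ℝ) × ℝ).1 ⬝ᵥ y - ((Pi.single j 1, 0) : (Fin p → ℝ) × ℝ).2)
        * w y) q) (whp P) (𝓝 (∫ ω, deriv G (z 0 ω j) * w (z 0 ω) ∂P)) := by
  have := hM.continuous_g.measurable
  simpa using hM.sample.tendsto_empMean (φ := fun y => deriv G (y j) * w y) (by fun_prop) hint

/-- The limit of `T̂(γ_j)`, and its derivative off the diagonal. -/
lemma sampleT_expansion (hM : Model P G z) (m : Fin p → ℝ) (j l : Fin p) :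
    ∃ D : (Fin p → Fin p → ℝ) →L[ℝ] ℝ,
      HasSDeriv (whp P) (fun q (Γ : Fin p → Fin p → ℝ) => sampleT G (obs m z q) (Γ j) l) D
        (idArr p) ∧
      Tendsto (fun q => sampleT G (obs m z q) (idArr p j) l) (whp P)
        (𝓝 (if j = l then lam P G (z 0) j else 0)) ∧
      (j ≠ l → D = del P G (z 0) j • coord j l) := by
  have hproj : HasSDeriv (whp P) (fun (_ : ℕ × Ω) (Γ : Fin p → Fin p → ℝ) => Γ j)
      (ContinuousLinearMap.proj (R := ℝ) (φ := fun _ : Fin p => Fin p → ℝ) j) (idArr p) :=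
    HasSDeriv.clm (ContinuousLinearMap.proj (R := ℝ) (φ := fun _ : Fin p => Fin p → ℝ) j)
  have hu := (hM.hasSDeriv_centering (idArr p j)).comp hproj tendsto_const_nhds
  have hu0 := hM.tendsto_centering (idArr p j)
  have h1 := hM.hasSDeriv_g j (continuous_apply l) (fun y => abs_le_one_add_sum y l)
  have h2 := hM.hasSDeriv_g j (continuous_const (y := (1 : ℝ)))
    (fun y => by simpa using one_le_one_add_sum y)
  have t1 := h1.tendsto_eval (hM.tendsto_g j (measurable_pi_apply l) (hM.integrable_g_mul j l)) hu0
  have t2 := h2.tendsto_eval (hM.tendsto_g j measurable_const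
    (by simpa using (hM.moments.memLp_g j).integrable one_le_two)) hu0
  have d1 := h1.comp hu hu0
  have d2 := h2.comp hu hu0
  have d3 := (HasSDeriv.const (V := Fin p → Fin p → ℝ) (x₀ := idArr p)
    (fun q => zbar z q l)).mul d2 (hM.tendsto_zbar l) t2
  have d4 := d1.sub d3
  have t4 := t1.sub ((hM.tendsto_zbar l).mul t2)
  simp only [sampleT_obs]
  refine ⟨_, d4, ?_, ?_⟩
  · convert! t4 using 2
    rw [zero_mul, sub_zero]
    split_ifs with h
    · subst h
      rfl
    · exact (hM.integral_g_mul h).symm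
  · intro h
    ext Γ
    simp [affForm_apply, hM.integral_g'_mul_mul h]

/-- `√n (T̂(e_j) - T_j)` is negligible off the diagonal. -/
lemma tendsto_sqrt_mul_sampleT_sub_oracleT (hM : Model P G z) (m : Fin p → ℝ) {j l : Fin p}
    (h : j ≠ l) :
    Tendsto (fun q : ℕ × Ω => √(q.1 : ℝ) * (sampleT G (obs m z q) (idArr p j) l -
      oracleT P G z q.1 j q.2 l)) (whp P) (𝓝 0) := by
  have hu0 := hM.tendsto_centering (idArr p j)
  have h1 := hM.hasSDeriv_g j (continuous_apply l) (fun y => abs_le_one_add_sum y l)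
  have h2 := hM.hasSDeriv_g j (continuous_const (y := (1 : ℝ)))
    (fun y => by simpa using one_le_one_add_sum y)
  have t2 := h2.tendsto_eval (hM.tendsto_g j measurable_const
    (by simpa using (hM.moments.memLp_g j).integrable one_le_two)) hu0
  have e1 := h1.isLittleO_eval hu0 tendsto_const_nhds
  -- Centring shifts the argument by z̄_j, with first-order effect -E[g'(z_j) z_l] z̄_j. The
  -- coefficient vanishes by independence, and the remainder is o(z̄_j) with √n z̄_j stochastically
  -- bounded.
  have e2 : (fun q => empMean z (fun y => deriv G (idArr p j ⬝ᵥ y - idArr p j ⬝ᵥ zbar z q) * y l) q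
      - empMean z (fun y => deriv G (y j) * y l) q) =o[whp P] (fun q => zbar z q j) := by
    refine (e1.trans_isBigO (k := fun q => zbar z q j) (isBigO_of_le _ fun q => ?_)).congr_left
      fun q => ?_
    · simp [idArr]
    · simp [idArr, affForm_apply, hM.integral_g'_mul h]
  have e3 := (hM.stochBdd_zbar j).tendsto_of_isLittleO
    ((isBigO_refl (fun q : ℕ × Ω => √(q.1 : ℝ)) (whp P)).mul_isLittleO e2)
  -- Replacing the mean of g by its limit μ_j costs o_P(1) times √n z̄_l.
  have e4 : Tendsto (fun q : ℕ × Ω => (empMean z (fun y =>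
      deriv G (idArr p j ⬝ᵥ y - idArr p j ⬝ᵥ zbar z q) * 1) q - mu P G (z 0) j) *
        (√(q.1 : ℝ) * zbar z q l)) (whp P) (𝓝 0) := by
    refine hM.stochBdd_zbar l _ ?_
    have := t2.sub_const (mu P G (z 0) j)
    simpa [mu] using this
  have e5 := e3.sub e4
  rw [sub_zero] at e5
  refine e5.congr fun q => ?_
  rw [sampleT_obs, oracleT_eq]
  ring

lemma tendsto_sampleCov (hM : Model P G z) (m : Fin p → ℝ) (j l : Fin p) :
    Tendsto (fun q => sampleCov (obs m z q) j l) (whp P)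
      (𝓝 ((1 : Matrix (Fin p) (Fin p) ℝ) j l)) := by
  have h1 := (hM.sample.tendsto_empMean (φ := fun y => y j * y l) (by fun_prop)
    ((hM.memLp j).integrable_mul (hM.memLp l))).sub ((hM.tendsto_zbar j).mul (hM.tendsto_zbar l))
  simp only [sampleCov_obs]
  convert! h1 using 2
  rw [Matrix.one_apply, mul_zero, sub_zero]
  split_ifs with h
  · subst h
    simpa [sq] using (hM.integral_sq j).symm
  · rw [hM.integral_mul h measurable_id' measurable_id']
    simp [hM.integral_eq_zero]

/-- The deviation from the whitening constraint. -/
def constraint {n : ℕ} (x : Fin n → Fin p → ℝ) (Γ : Fin p → Fin p → ℝ) (j l : Fin p) : ℝ :=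
  ∑ a, ∑ b, Γ j a * sampleCov x a b * Γ l b - (1 : Matrix (Fin p) (Fin p) ℝ) j l

lemma constraint_eq {n : ℕ} (x : Fin n → Fin p → ℝ) (Γ : Matrix (Fin p) (Fin p) ℝ) (j l : Fin p) :
    constraint x Γ j l = (Γ * sampleCov x * Γᵀ - 1) j l := by
  simp only [constraint, Matrix.sub_apply, Matrix.mul_apply, Matrix.transpose_apply,
    Finset.sum_mul]
  rw [Finset.sum_comm]

lemma constraint_idArr {n : ℕ} (x : Fin n → Fin p → ℝ) (j l : Fin p) :
    constraint x (idArr p) j l = (sampleCov x - 1) j l := by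
  have : idArr p = (1 : Matrix (Fin p) (Fin p) ℝ) := by
    ext j l
    exact idArr_apply j l
  rw [this, constraint_eq]
  simp

/-- Product rule for ΓŜΓᵀ, with Ŝ and the base point of Γ both tending to the identity. -/
lemma hasSDeriv_constraint (hM : Model P G z) (m : Fin p → ℝ) (j l : Fin p) :
    HasSDeriv (whp P) (fun q (Γ : Fin p → Fin p → ℝ) => constraint (obs m z q) Γ j l)
      (coord j l + coord l j) (idArr p) := by
  have hc : ∀ a b : Fin p, HasSDeriv (whp P) (fun (_ : ℕ × Ω) (Γ : Fin p → Fin p → ℝ) => Γ a b)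
      (coord a b) (idArr p) := fun a b => HasSDeriv.clm (coord a b)
  have ht : ∀ a b : Fin p, Tendsto (fun _ : ℕ × Ω => idArr p a b) (whp P) (𝓝 (idArr p a b)) :=
    fun a b => tendsto_const_nhds
  have h1 : ∀ a b : Fin p, HasSDeriv (whp P)
      (fun q (Γ : Fin p → Fin p → ℝ) => Γ j a * sampleCov (obs m z q) a b * Γ l b) _ (idArr p) :=
    fun a b => (((hc j a).mul (HasSDeriv.const (fun q => sampleCov (obs m z q) a b)) (ht j a)
      (hM.tendsto_sampleCov m a b)).mul (hc l b) ((ht j a).mul (hM.tendsto_sampleCov m a b))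
      (ht l b))
  have h2 := (HasSDeriv.sum (s := Finset.univ) fun a _ =>
    HasSDeriv.sum (s := Finset.univ) fun b _ => h1 a b).sub
      (HasSDeriv.const (fun _ => (1 : Matrix (Fin p) (Fin p) ℝ) j l))
  refine h2.congr_deriv ?_
  ext Γ
  simp [idArr_apply, Matrix.one_apply, Finset.sum_add_distrib, add_comm]

/-- The linearization of `γ_l ⬝ T̂(γ_j)` off the diagonal. -/
lemma hasSDeriv_dotProduct_sampleT (hM : Model P G z) (m : Fin p → ℝ) {j l : Fin p} (h : j ≠ l) :
    HasSDeriv (whp P) (fun q (Γ : Fin p → Fin p → ℝ) => Γ l ⬝ᵥ sampleT G (obs m z q) (Γ j))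
      (lam P G (z 0) j • coord l j + del P G (z 0) j • coord j l) (idArr p) := by
  choose D hD hDt hDe using fun k => hM.sampleT_expansion m j k
  have hc : ∀ a b : Fin p, HasSDeriv (whp P) (fun (_ : ℕ × Ω) (Γ : Fin p → Fin p → ℝ) => Γ a b)
      (coord a b) (idArr p) := fun a b => HasSDeriv.clm (coord a b)
  have h2 := (HasSDeriv.sum (s := Finset.univ) fun k _ =>
    (hc l k).mul (hD k) (tendsto_const_nhds (x := idArr p l k)) (hDt k))
  refine HasSDeriv.congr_deriv h2 ?_
  ext Γ
  simp [idArr_apply, Matrix.one_apply, Finset.sum_add_distrib, hDe l h,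
    add_comm]

lemma idArr_dotProduct (l : Fin p) (v : Fin p → ℝ) : idArr p l ⬝ᵥ v = v l := by
  simp [idArr]

/-- The linearization of `Ĝ(γ_j)`. -/
lemma hasSDeriv_sampleG (hM : Model P G z) (m : Fin p → ℝ) (j : Fin p) :
    ∃ D : (Fin p → Fin p → ℝ) →L[ℝ] ℝ,
      HasSDeriv (whp P) (fun q (Γ : Fin p → Fin p → ℝ) => sampleG G (obs m z q) (Γ j)) D
        (idArr p) ∧ ∀ Γ, D Γ = lam P G (z 0) j * Γ j j := by
  have hproj : HasSDeriv (whp P) (fun (_ : ℕ × Ω) (Γ : Fin p → Fin p → ℝ) => Γ j)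
      (ContinuousLinearMap.proj (R := ℝ) (φ := fun _ : Fin p => Fin p → ℝ) j) (idArr p) :=
    HasSDeriv.clm (ContinuousLinearMap.proj (R := ℝ) (φ := fun _ : Fin p => Fin p → ℝ) j)
  have hu := (hM.hasSDeriv_centering (idArr p j)).comp hproj tendsto_const_nhds
  have d1 := (hM.hasSDeriv_contrast j).comp hu (hM.tendsto_centering (idArr p j))
  simp only [sampleG_obs]
  refine ⟨_, d1, ?_⟩
  · intro Γ
    have h : ∀ k, ∫ ω, deriv G (z 0 ω j) * z 0 ω k ∂P = if k = j then lam P G (z 0) j else 0 := by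
      intro k
      split_ifs with hk
      · subst hk
        rfl
      · exact hM.integral_g_mul (Ne.symm hk)
    simp [affForm_apply, h]

lemma tendsto_contrast (hM : Model P G z) (j : Fin p) :
    Tendsto (fun q => empMean z (fun y => G (y j)) q) (whp P) (𝓝 (nu P G (z 0) j)) := by
  have := hM.continuous_contrast.measurable
  exact hM.sample.tendsto_empMean (φ := fun y => G (y j)) (by fun_prop) (hM.moments.contrast j)

lemma tendsto_sampleG (hM : Model P G z) (m : Fin p → ℝ) (j : Fin p) :
    Tendsto (fun q => sampleG G (obs m z q) (idArr p j)) (whp P) (𝓝 (nu P G (z 0) j)) := by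
  have h := (hM.hasSDeriv_contrast j).tendsto_eval (a := nu P G (z 0) j)
    (by simpa using hM.tendsto_contrast j) (hM.tendsto_centering (idArr p j))
  simpa only [sampleG_obs] using h

/-- Expansion of the empirical contrast at `e_j`. -/
lemma tendsto_sqrt_mul_sampleG_sub (hM : Model P G z) (m : Fin p → ℝ) (j : Fin p) :
    Tendsto (fun q : ℕ × Ω => √(q.1 : ℝ) * (sampleG G (obs m z q) (idArr p j) -
      (empMean z (fun y => G (y j)) q - mu P G (z 0) j * zbar z q j))) (whp P) (𝓝 0) := by
  have hu0 := hM.tendsto_centering (idArr p j)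
  have e1 := (hM.hasSDeriv_contrast j).isLittleO_eval hu0 tendsto_const_nhds
  have e2 : (fun q => sampleG G (obs m z q) (idArr p j) -
      (empMean z (fun y => G (y j)) q - mu P G (z 0) j * zbar z q j))
      =o[whp P] (fun q => zbar z q j) := by
    refine (e1.trans_isBigO (k := fun q => zbar z q j) (isBigO_of_le _ fun q => ?_)).congr_left
      fun q => ?_
    · simp [idArr]
    · simp [sampleG_obs, idArr, affForm_apply, mu]
      ring
  exact (hM.stochBdd_zbar j).tendsto_of_isLittleO
    ((isBigO_refl (fun q : ℕ × Ω => √(q.1 : ℝ)) (whp P)).mul_isLittleO e2)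

end Model

/-! ### Decoupling the linearized equations -/

section EstMap

variable {p : ℕ}

/-- The estimating equations `R j l = R l j` and the constraints `C j l = 0`, combined so that
their linearization is the identity. -/
def estMap (lm dl : Fin p → ℝ) (κ a R C : Fin p → Fin p → ℝ) : Fin p → Fin p → ℝ := fun j l =>
  if j = l then C j j / 2
  else (R j l - R l j - (a j l * lm j - a l j * dl l) * C j l) / κ j l

/-- The coefficient of `Γ j l` in the linearized equations. -/
def kappa (lm dl : Fin p → ℝ) (a : Fin p → Fin p → ℝ) (j l : Fin p) : ℝ :=
  a j l * (dl j - lm j) + a l j * (dl l - lm l)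

/-- The off-diagonal constraints are not imposed separately. Adding the entries (j, l) and (l, j)
cancels the estimating equations and leaves κ_jl C_jl = 0; once C vanishes, each entry returns its
estimating equation. -/
lemma estMap_eq_zero_iff {lm dl : Fin p → ℝ} {κ a R C : Fin p → Fin p → ℝ}
    (hC : ∀ j l, C j l = C l j) (hκ : ∀ j l, j ≠ l → κ j l = kappa lm dl a j l)
    (hκ0 : ∀ j l, j ≠ l → κ j l ≠ 0) :
    estMap lm dl κ a R C = 0 ↔ (∀ j l, C j l = 0) ∧ ∀ j l, R j l = R l j := by
  constructor
  · intro h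
    have h1 : ∀ j l, j ≠ l →
        R j l - R l j - (a j l * lm j - a l j * dl l) * C j l = 0 := by
      intro j l hjl
      have := congrFun (congrFun h j) l
      simpa [estMap, hjl, hκ0 j l hjl] using this
    have hC0 : ∀ j l, C j l = 0 := by
      intro j l
      by_cases hjl : j = l
      · subst hjl
        have := congrFun (congrFun h j) j
        simpa [estMap] using this
      · have e1 := h1 j l hjl
        have e2 := h1 l j (Ne.symm hjl)
        rw [hC l j] at e2
        have e3 : κ j l * C j l = 0 := by
          rw [hκ j l hjl, kappa]
          linarith
        exact (mul_eq_zero.mp e3).resolve_left (hκ0 j l hjl)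
    refine ⟨hC0, fun j l => ?_⟩
    by_cases hjl : j = l
    · rw [hjl]
    · have := h1 j l hjl
      rw [hC0, mul_zero, sub_zero] at this
      linarith
  · rintro ⟨h1, h2⟩
    ext j l
    by_cases hjl : j = l
    · simp [estMap, hjl, h1]
    · simp [estMap, hjl, h1, h2 j l]

/-- If the weighted equations and the constraints have the expected linearizations, then `estMap`
is strictly differentiable with derivative the identity. -/
lemma hasSDeriv_estMap {Q : Type*} {L : Filter Q} {lm dl : Fin p → ℝ} {κ : Fin p → Fin p → ℝ}
    {a : Q → Fin p → Fin p → ℝ} {R C : Q → (Fin p → Fin p → ℝ) → Fin p → Fin p → ℝ}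
    {x₀ : Fin p → Fin p → ℝ} {K : ℝ} (ha : ∀ q j l, |a q j l| ≤ K)
    (hκ : ∀ q j l, j ≠ l → κ j l = kappa lm dl (a q) j l) (hκ0 : ∀ j l, j ≠ l → κ j l ≠ 0)
    (hC : ∀ j l, HasSDeriv L (fun q Γ => C q Γ j l) (coord j l + coord l j) x₀)
    (hR : ∀ j l, j ≠ l → (fun t : Q × (Fin p → Fin p → ℝ) × (Fin p → Fin p → ℝ) =>
      R t.1 t.2.1 j l - R t.1 t.2.2 j l -
        a t.1 j l * (lm j * (t.2.1 - t.2.2) l j + dl j * (t.2.1 - t.2.2) j l))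
      =o[L ×ˢ 𝓝 (x₀, x₀)] (fun t => t.2.1 - t.2.2)) :
    HasSDeriv L (fun q Γ => estMap lm dl κ (a q) (R q Γ) (C q Γ))
      (ContinuousLinearMap.id ℝ _) x₀ := by
  refine isLittleO_pi.mpr fun j => isLittleO_pi.mpr fun l => ?_
  by_cases hjl : j = l
  · subst hjl
    refine (IsLittleO.const_mul_left (hC j j) (1 / 2)).congr_left fun t => ?_
    simp [estMap]
    ring
  · have h1 := hR j l hjl
    have h2 := hR l j (Ne.symm hjl)
    have hb : (fun t : Q × (Fin p → Fin p → ℝ) × (Fin p → Fin p → ℝ) =>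
        a t.1 j l * lm j - a t.1 l j * dl l) =O[L ×ˢ 𝓝 (x₀, x₀)] (fun _ => (1 : ℝ)) := by
      refine IsBigO.of_bound (K * |lm j| + K * |dl l|) (Eventually.of_forall fun t => ?_)
      rw [norm_one, mul_one, Real.norm_eq_abs]
      refine (abs_sub _ _).trans ?_
      rw [abs_mul, abs_mul]
      gcongr
      · exact ha _ _ _
      · exact ha _ _ _
    have h3 := hb.mul_isLittleO (IsLittleO.norm_right (hC j l))
    simp only [one_mul] at h3
    refine (IsLittleO.const_mul_left ((h1.sub h2).sub h3.of_norm_right) (κ j l)⁻¹).congr_left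
      fun t => ?_
    -- In the linearization of R_jl - R_lj the coefficient of Γ_lj is a_jl λ_j - a_lj δ_l.
    -- Subtracting this multiple of C_jl ≈ Γ_jl + Γ_lj removes Γ_lj and leaves κ_jl Γ_jl.
    have hne := hκ0 j l hjl
    have e : κ j l = _ := hκ t.1 j l hjl
    rw [kappa] at e
    simp only [estMap, if_neg hjl, Pi.sub_apply, _root_.add_apply, coord_apply,
      ContinuousLinearMap.coe_id', id]
    field_simp
    rw [e]
    ring

end EstMap

/-! ### Limit laws under linear maps and negligible perturbations -/

section Limit

variable {p : ℕ}

/-- The leading term of the estimating equations, as a function of the joint statistic. -/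
def linStat (lm dl : Fin p → ℝ) (κ a : Fin p → Fin p → ℝ)
    (s : (OffDiag p → ℝ) × (OffDiag p → ℝ) × (Fin p × Fin p → ℝ)) : Fin p → Fin p → ℝ :=
  estMap lm dl κ a (fun j l => if h : j ≠ l then a j l * s.1 ⟨(j, l), h⟩ else 0)
    (fun j l => s.2.2 (j, l))

/-- `linStat` for fixed weights, as a linear map into vectorized matrices, with opposite sign. -/
def linStatL (lm dl : Fin p → ℝ) (κ a : Fin p → Fin p → ℝ) :
    ((OffDiag p → ℝ) × (OffDiag p → ℝ) × (Fin p × Fin p → ℝ)) →L[ℝ] (Fin p × Fin p → ℝ) :=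
  LinearMap.toContinuousLinearMap
    -- `vec` stacks columns, so its index c stands for the entry (c.2, c.1). The sign is that of
    -- √n(Γ̂ - I) = -√n B(I) + o_P(1).
    { toFun := fun s c => -linStat lm dl κ a s c.2 c.1
      map_add' := by
        intro s t
        ext c
        by_cases h : c.2 = c.1
        · simp [linStat, estMap, h]
          ring
        · simp [linStat, estMap, h, Ne.symm h]
          ring
      map_smul' := by
        intro r s
        ext c
        by_cases h : c.2 = c.1
        · simp [linStat, estMap, h]
          ring
        · simp [linStat, estMap, h, Ne.symm h]
          ring }

@[simp]
lemma linStatL_apply (lm dl : Fin p → ℝ) (κ a : Fin p → Fin p → ℝ)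
    (s : (OffDiag p → ℝ) × (OffDiag p → ℝ) × (Fin p × Fin p → ℝ)) (c : Fin p × Fin p) :
    linStatL lm dl κ a s c = -linStat lm dl κ a s c.2 c.1 := rfl

variable {Ω : Type*} [MeasurableSpace Ω] {P : Measure Ω} [IsProbabilityMeasure P]

lemma IsAsympNormal.comp_clm {E F : Type*} [NormedAddCommGroup E] [NormedSpace ℝ E]
    [MeasurableSpace E] [BorelSpace E] [NormedAddCommGroup F] [NormedSpace ℝ F]
    [MeasurableSpace F] [BorelSpace F] {Y : ℕ → Ω → E} (hY : IsAsympNormal P Y) (A : E →L[ℝ] F) :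
    IsAsympNormal P (fun n ω => A (Y n ω)) := by
  obtain ⟨ρ, hρ, h⟩ := hY
  refine ⟨ρ.map A, isGaussian_map A, ?_⟩
  have h1 := h.continuous_comp A.continuous
  have hm : AEMeasurable (A : E → F) ρ := A.continuous.measurable.aemeasurable
  refine ⟨h1.forall_aemeasurable, aemeasurable_id, ?_⟩
  convert! h1.tendsto using 1
  congr 1
  refine Subtype.ext ?_
  simp

/-- Slutsky's lemma, with the negligible difference expressed along `whp`. -/
lemma IsAsympNormal.congr_of_tendsto {ι : Type*} [Fintype ι] {Y Y' : ℕ → Ω → ι → ℝ}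
    (hY : IsAsympNormal P Y) (hm : ∀ n, AEMeasurable (Y' n) P)
    (h : Tendsto (fun q : ℕ × Ω => Y' q.1 q.2 - Y q.1 q.2) (whp P) (𝓝 0)) :
    IsAsympNormal P Y' := by
  obtain ⟨ρ, hρ, hd⟩ := hY
  refine ⟨ρ, hρ, tendstoInDistribution_of_tendstoInMeasure_sub Y' _ hd ?_ hm⟩
  exact tendsto_whp_iff.mp h

lemma IsAsympNormal.stochBdd {E : Type*} [NormedAddCommGroup E] [NormedSpace ℝ E]
    [MeasurableSpace E] [BorelSpace E] {Y : ℕ → Ω → E} (hY : IsAsympNormal P Y) (A : E →L[ℝ] ℝ) :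
    StochBdd P (fun q => A (Y q.1 q.2)) := by
  obtain ⟨ρ, hρ, h⟩ := hY.comp_clm A
  exact StochBdd.of_tendstoInDistribution (ρ := ρ) (Z := id) (Y := fun n ω => A (Y n ω)) h

end Limit

/-! ### Weighted estimating equations: zeros and their expansion -/

namespace Model

variable {Ω : Type*} [MeasurableSpace Ω] {P : Measure Ω} {p : ℕ} {G : ℝ → ℝ}
  {z : ℕ → Ω → Fin p → ℝ} {m : Fin p → ℝ}

lemma constraint_comm {n : ℕ} (x : Fin n → Fin p → ℝ) (Γ : Fin p → Fin p → ℝ) (j l : Fin p) :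
    constraint x Γ j l = constraint x Γ l j := by
  have h : ∀ a b, sampleCov x a b = sampleCov x b a := by
    intro a b
    simp [sampleCov, Matrix.sum_apply, vecMulVec_apply, mul_comm]
  simp only [constraint]
  rw [Finset.sum_comm, Matrix.one_apply, Matrix.one_apply]
  simp only [eq_comm (a := j)]
  congr 1
  refine Finset.sum_congr rfl fun a _ => Finset.sum_congr rfl fun b _ => ?_
  rw [h b a]
  ring

/-- The estimating equations with weights `α`, where `a` are the reference weights. -/
def estFun (G : ℝ → ℝ) (lm dl : Fin p → ℝ) (κ a α : Fin p → Fin p → ℝ) {n : ℕ}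
    (x : Fin n → Fin p → ℝ) (Γ : Fin p → Fin p → ℝ) : Fin p → Fin p → ℝ :=
  estMap lm dl κ a (fun j l => α j l * (Γ l ⬝ᵥ sampleT G x (Γ j))) (constraint x Γ)

lemma estFun_eq_zero_iff {lm dl : Fin p → ℝ} {κ a α : Fin p → Fin p → ℝ} {n : ℕ}
    {x : Fin n → Fin p → ℝ} {Γ : Matrix (Fin p) (Fin p) ℝ}
    (hκ : ∀ j l, j ≠ l → κ j l = kappa lm dl a j l) (hκ0 : ∀ j l, j ≠ l → κ j l ≠ 0) :
    estFun G lm dl κ a α x Γ = 0 ↔ Γ * sampleCov x * Γᵀ = 1 ∧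
      ∀ j l, α j l * (Γ l ⬝ᵥ sampleT G x (Γ j)) = α l j * (Γ j ⬝ᵥ sampleT G x (Γ l)) := by
  unfold estFun
  rw [estMap_eq_zero_iff (constraint_comm x Γ) hκ hκ0, ← sub_eq_zero (b := (1 : Matrix _ _ ℝ))]
  refine and_congr_left fun _ => ?_
  simp only [constraint_eq]
  exact ⟨fun h => by ext j l; exact h j l, fun h j l => by rw [h]; rfl⟩

variable {κ : Fin p → Fin p → ℝ} {a : ℕ × Ω → Fin p → Fin p → ℝ}

/-- The leading term of the estimating equations at the truth. -/
def leadStat (P : Measure Ω) (G : ℝ → ℝ) (z : ℕ → Ω → Fin p → ℝ) (m : Fin p → ℝ)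
    (κ : Fin p → Fin p → ℝ) (a : ℕ × Ω → Fin p → Fin p → ℝ) (q : ℕ × Ω) : Fin p → Fin p → ℝ :=
  linStat (lam P G (z 0)) (del P G (z 0)) κ (a q) (jointStat P G z (icObs m 1 z) q.1 q.2)

lemma leadStat_self (q : ℕ × Ω) (j : Fin p) :
    leadStat P G z m κ a q j j = √(q.1 : ℝ) * constraint (obs m z q) (idArr p) j j / 2 := by
  simp [leadStat, linStat, estMap, jointStat, constraint_idArr, obs]

lemma leadStat_of_ne (q : ℕ × Ω) {j l : Fin p} (h : j ≠ l) :
    leadStat P G z m κ a q j l = (a q j l * (√(q.1 : ℝ) * oracleT P G z q.1 j q.2 l) -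
      a q l j * (√(q.1 : ℝ) * oracleT P G z q.1 l q.2 j) -
      (a q j l * lam P G (z 0) j - a q l j * del P G (z 0) l) *
        (√(q.1 : ℝ) * constraint (obs m z q) (idArr p) j l)) / κ j l := by
  simp [leadStat, linStat, estMap, jointStat, constraint_idArr, obs, h, Ne.symm h]

/-- The assumptions under which the leading term of the weighted estimating equations is known. -/
structure Weights (P : Measure Ω) (G : ℝ → ℝ) (z : ℕ → Ω → Fin p → ℝ) (m : Fin p → ℝ)
    (κ : Fin p → Fin p → ℝ) (a : ℕ × Ω → Fin p → Fin p → ℝ)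
    (α : ℕ × Ω → (Fin p → Fin p → ℝ) → Fin p → Fin p → ℝ) : Prop where
  bdd : ∃ K, ∀ q j l, |a q j l| ≤ K
  kappa_eq : ∀ q j l, j ≠ l → κ j l = kappa (lam P G (z 0)) (del P G (z 0)) (a q) j l
  kappa_ne : ∀ j l, j ≠ l → κ j l ≠ 0
  linear : ∀ j l, j ≠ l →
    (fun t : (ℕ × Ω) × (Fin p → Fin p → ℝ) × (Fin p → Fin p → ℝ) =>
      α t.1 t.2.1 j l * (t.2.1 l ⬝ᵥ sampleT G (obs m z t.1) (t.2.1 j)) -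
      α t.1 t.2.2 j l * (t.2.2 l ⬝ᵥ sampleT G (obs m z t.1) (t.2.2 j)) -
        a t.1 j l * (lam P G (z 0) j * (t.2.1 - t.2.2) l j +
          del P G (z 0) j * (t.2.1 - t.2.2) j l))
      =o[whp P ×ˢ 𝓝 (idArr p, idArr p)] (fun t => t.2.1 - t.2.2)
  leading : ∀ j l, j ≠ l → Tendsto (fun q : ℕ × Ω =>
    √(q.1 : ℝ) * (α q (idArr p) j l * sampleT G (obs m z q) (idArr p j) l) -
      a q j l * (√(q.1 : ℝ) * oracleT P G z q.1 j q.2 l)) (whp P) (𝓝 0)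

variable {α : ℕ × Ω → (Fin p → Fin p → ℝ) → Fin p → Fin p → ℝ}

lemma Weights.tendsto_leading (hW : Weights P G z m κ a α) :
    Tendsto (fun q : ℕ × Ω => √(q.1 : ℝ) • estFun G (lam P G (z 0)) (del P G (z 0)) κ (a q)
      (α q (idArr p)) (obs m z q) (idArr p) - leadStat P G z m κ a q) (whp P) (𝓝 0) := by
  refine tendsto_pi_nhds.mpr fun j => tendsto_pi_nhds.mpr fun l => ?_
  by_cases hjl : j = l
  · subst hjl
    refine tendsto_const_nhds.congr fun q => ?_
    simp only [Pi.sub_apply, Pi.smul_apply, smul_eq_mul, estFun, estMap, if_true, leadStat_self,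
      Pi.zero_apply]
    ring
  · have h1 := ((hW.leading j l hjl).sub (hW.leading l j (Ne.symm hjl))).div_const (κ j l)
    rw [sub_zero, zero_div] at h1
    refine h1.congr fun q => ?_
    simp only [Pi.sub_apply, Pi.smul_apply, smul_eq_mul, estFun, estMap, if_neg hjl,
      leadStat_of_ne q hjl, idArr_dotProduct]
    ring

variable [IsProbabilityMeasure P]

lemma Weights.hasSDeriv (hM : Model P G z) (hW : Weights P G z m κ a α) :
    HasSDeriv (whp P) (fun q Γ => estFun G (lam P G (z 0)) (del P G (z 0)) κ (a q) (α q Γ)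
      (obs m z q) Γ) (ContinuousLinearMap.id ℝ _) (idArr p) := by
  obtain ⟨K, hK⟩ := hW.bdd
  exact hasSDeriv_estMap hK hW.kappa_eq hW.kappa_ne (fun j l => hM.hasSDeriv_constraint m j l)
    hW.linear

lemma stochBdd_oracleT (hjoint : IsAsympNormal P (jointStat P G z (icObs m 1 z))) {j l : Fin p}
    (h : j ≠ l) : StochBdd P (fun q => √(q.1 : ℝ) * oracleT P G z q.1 j q.2 l) := by
  have := hjoint.stochBdd ((ContinuousLinearMap.proj (⟨(j, l), h⟩ : OffDiag p)).comp
    (ContinuousLinearMap.fst ℝ _ _))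
  exact this

lemma stochBdd_cov (hjoint : IsAsympNormal P (jointStat P G z (icObs m 1 z))) (j l : Fin p) :
    StochBdd P (fun q => √(q.1 : ℝ) * constraint (obs m z q) (idArr p) j l) := by
  have := hjoint.stochBdd (((ContinuousLinearMap.proj (j, l)).comp
    (ContinuousLinearMap.snd ℝ _ _)).comp (ContinuousLinearMap.snd ℝ _ _))
  simp only [constraint_idArr]
  exact this

/-- With random weights the leading term is no fixed linear image of the joint statistic and need
not converge, but its entries are bounded combinations of stochastically bounded terms. This is
enough for the rate √n. -/
lemma stochBdd_leadStat (hjoint : IsAsympNormal P (jointStat P G z (icObs m 1 z)))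
    (hbdd : ∃ K, ∀ q j l, |a q j l| ≤ K) :
    StochBdd P (fun q => ‖leadStat P G z m κ a q‖) := by
  obtain ⟨K, hK⟩ := hbdd
  have hcol : ∀ j, StochBdd P (fun q => ‖leadStat P G z m κ a q j‖) := by
    intro j
    refine StochBdd.norm_pi fun l => ?_
    by_cases hjl : j = l
    · subst hjl
      simp only [leadStat_self]
      refine (stochBdd_cov hjoint j j).of_isBigO' (IsBigO.of_bound (1 / 2)
        (Eventually.of_forall fun q => le_of_eq ?_))
      rw [norm_div, Real.norm_ofNat]
      ring
    · have ha : ∀ j l, (fun q => a q j l) =O[whp P] (fun _ => (1 : ℝ)) := fun j l =>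
        IsBigO.of_bound K (Eventually.of_forall fun q => by simpa using hK q j l)
      have hmul : ∀ {b f : ℕ × Ω → ℝ}, b =O[whp P] (fun _ => (1 : ℝ)) → StochBdd P f →
          StochBdd P (fun q => b q * f q) := by
        intro b f hb hf
        refine hf.of_isBigO' ?_
        simpa using hb.mul (isBigO_refl f _)
      have h1 := hmul (ha j l) (stochBdd_oracleT hjoint hjl)
      have h2 := hmul ((ha l j).const_mul_left (-1)) (stochBdd_oracleT hjoint (Ne.symm hjl))
      have h3 : StochBdd P (fun q => (-1 * (lam P G (z 0) j * a q j l - del P G (z 0) l * a q l j)) *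
          (√(q.1 : ℝ) * constraint (obs m z q) (idArr p) j l)) :=
        hmul ((((ha j l).const_mul_left _).sub ((ha l j).const_mul_left _)).const_mul_left (-1))
          (stochBdd_cov hjoint j l)
      refine ((h1.add h2).add h3).of_isBigO' (IsBigO.of_bound |(κ j l)⁻¹|
        (Eventually.of_forall fun q => le_of_eq ?_))
      rw [leadStat_of_ne q hjl, ← Real.norm_eq_abs, ← norm_mul]
      congr 1
      ring
  have h := StochBdd.norm_pi (f := fun q j => ‖leadStat P G z m κ a q j‖) hcol
  refine h.congr' (Eventually.of_forall fun q => ?_)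
  exact le_antisymm ((pi_norm_le_iff_of_nonneg (norm_nonneg _)).mpr fun j => by
      rw [norm_norm]; exact norm_le_pi_norm _ j)
    ((pi_norm_le_iff_of_nonneg (norm_nonneg _)).mpr fun j => by
      have := norm_le_pi_norm (fun j => ‖leadStat P G z m κ a q j‖) j
      simpa using this)

/-- First-order expansion of consistent zeros of the weighted estimating equations. -/
lemma Weights.expansion (hM : Model P G z) (hW : Weights P G z m κ a α)
    (hjoint : IsAsympNormal P (jointStat P G z (icObs m 1 z)))
    {Γ : ℕ × Ω → Fin p → Fin p → ℝ} (hΓ : Tendsto Γ (whp P) (𝓝 (idArr p)))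
    (h0 : ∀ᶠ q in whp P, estFun G (lam P G (z 0)) (del P G (z 0)) κ (a q) (α q (Γ q))
      (obs m z q) (Γ q) = 0) :
    StochBdd P (fun q => ‖√(q.1 : ℝ) • (Γ q - idArr p)‖) ∧
      Tendsto (fun q => √(q.1 : ℝ) • (Γ q - idArr p) + leadStat P G z m κ a q) (whp P) (𝓝 0) :=
  (hW.hasSDeriv hM).expansion_of_zero hW.tendsto_leading (stochBdd_leadStat hjoint hW.bdd) hΓ h0

/-- The equations at the identity are O_P(n^(-1/2)), hence small enough to start the contraction
there. -/
lemma Weights.tendsto_estFun (hW : Weights P G z m κ a α)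
    (hjoint : IsAsympNormal P (jointStat P G z (icObs m 1 z))) :
    Tendsto (fun q => estFun G (lam P G (z 0)) (del P G (z 0)) κ (a q)
      (α q (idArr p)) (obs m z q) (idArr p)) (whp P) (𝓝 0) := by
  have h1 : Tendsto (fun q : ℕ × Ω => (√(q.1 : ℝ))⁻¹) (whp P) (𝓝 0) :=
    (tendsto_inv_atTop_zero.comp (Real.tendsto_sqrt_atTop.comp tendsto_natCast_atTop_atTop)).comp
      tendsto_fst_whp
  have h2 := stochBdd_leadStat hjoint hW.bdd (κ := κ) _ h1
  have h3 : Tendsto (fun q : ℕ × Ω => (√(q.1 : ℝ))⁻¹ • leadStat P G z m κ a q) (whp P) (𝓝 0) := by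
    rw [tendsto_zero_iff_norm_tendsto_zero]
    refine h2.congr fun q => ?_
    rw [norm_smul, Real.norm_of_nonneg (by positivity)]
  have h4 := (h1.smul hW.tendsto_leading).add h3
  rw [zero_smul, zero_add] at h4
  refine h4.congr' ?_
  filter_upwards [eventually_whp_of_atTop (P := P) (eventually_gt_atTop 0)] with q hq
  have : √(q.1 : ℝ) ≠ 0 := by positivity
  rw [smul_sub, smul_smul, inv_mul_cancel₀ this, one_smul]
  abel

/-- The value of an estimator at the observed data. -/
def evalObs (Γ : Estimator p) (m : Fin p → ℝ) (z : ℕ → Ω → Fin p → ℝ) (q : ℕ × Ω) :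
    Fin p → Fin p → ℝ :=
  Γ.toFun q.1 (obs m z q)

/-- Existence of consistent zeros depending measurably on the data. -/
lemma Weights.exists_estimator (hM : Model P G z) (hW : Weights P G z m κ a α)
    (hjoint : IsAsympNormal P (jointStat P G z (icObs m 1 z)))
    (B : (n : ℕ) → (Fin n → Fin p → ℝ) → (Fin p → Fin p → ℝ) → Fin p → Fin p → ℝ)
    (hB : ∀ n, Measurable (Function.uncurry (B n)))
    (hBe : ∀ q Γ, B q.1 (obs m z q) Γ = estFun G (lam P G (z 0)) (del P G (z 0)) κ (a q) (α q Γ)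
      (obs m z q) Γ) :
    ∃ Γ : Estimator p, Tendsto (evalObs Γ m z) (whp P) (𝓝 (idArr p)) ∧
      ∀ᶠ q in whp P, estFun G (lam P G (z 0)) (del P G (z 0)) κ (a q)
        (α q (evalObs Γ m z q)) (obs m z q) (evalObs Γ m z q) = 0 := by
  -- The iteration runs on `B`, which sees only the data, so its limit is an estimator; `hBe`
  -- identifies it on the sample with the weighted equations.
  refine ⟨⟨fun n x => iterLimit (B n) (idArr p) x,
    fun n j l => measurable_iterLimit (hB n) (idArr p) j l⟩, ?_, ?_⟩
  all_goals
    have hex := fun (ε : ℝ) (hε : 0 < ε) =>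
      (hW.hasSDeriv hM).eventually_exists_zero (hW.tendsto_estFun hjoint) hε
    simp only [← hBe, evalObs] at hex ⊢
  · refine (Metric.nhds_basis_closedBall (x := idArr p)).tendsto_right_iff.mpr fun ε hε => ?_
    filter_upwards [hex ε hε]
    rintro q ⟨y, hy, -, hlim⟩
    change iterLimit _ _ _ ∈ _
    rw [iterLimit_eq hlim]
    exact hy
  · filter_upwards [hex 1 one_pos]
    rintro q ⟨y, -, hy, hlim⟩
    rw [iterLimit_eq hlim]
    exact hy

end Model

/-! ### Measurability of the equations in data and matrix -/

section Measurability

variable {n p : ℕ} {G : ℝ → ℝ}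

lemma continuous_centered (i : Fin n) :
    Continuous fun x : Fin n → Fin p → ℝ => centered x i := by
  unfold centered sampleMean
  fun_prop

lemma continuous_sampleG (hG : Continuous G) (j : Fin p) :
    Continuous fun t : (Fin n → Fin p → ℝ) × (Fin p → Fin p → ℝ) => sampleG G t.1 (t.2 j) := by
  have h : ∀ i, Continuous fun t : (Fin n → Fin p → ℝ) × (Fin p → Fin p → ℝ) =>
      t.2 j ⬝ᵥ centered t.1 i := fun i =>
    Continuous.dotProduct (by fun_prop) ((continuous_centered i).comp continuous_fst)
  unfold sampleG
  fun_prop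

lemma continuous_sampleT (hG : Continuous (deriv G)) (j : Fin p) :
    Continuous fun t : (Fin n → Fin p → ℝ) × (Fin p → Fin p → ℝ) => sampleT G t.1 (t.2 j) := by
  have h0 : ∀ i, Continuous fun t : (Fin n → Fin p → ℝ) × (Fin p → Fin p → ℝ) =>
      centered t.1 i := fun i => (continuous_centered i).comp continuous_fst
  have h : ∀ i, Continuous fun t : (Fin n → Fin p → ℝ) × (Fin p → Fin p → ℝ) =>
      t.2 j ⬝ᵥ centered t.1 i := fun i => Continuous.dotProduct (by fun_prop) (h0 i)
  unfold sampleT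
  fun_prop

lemma continuous_sampleCov (j l : Fin p) :
    Continuous fun x : Fin n → Fin p → ℝ => sampleCov x j l := by
  have h0 : ∀ i k, Continuous fun x : Fin n → Fin p → ℝ => centered x i k := fun i k =>
    (continuous_apply k).comp (continuous_centered i)
  simp only [sampleCov, Matrix.smul_apply, Matrix.sum_apply, vecMulVec_apply]
  fun_prop

lemma measurable_estFun (hG : Continuous (deriv G)) (lm dl : Fin p → ℝ) (κ : Fin p → Fin p → ℝ)
    {a : (Fin n → Fin p → ℝ) → Fin p → Fin p → ℝ} (ha : Measurable a)
    {α : (Fin n → Fin p → ℝ) × (Fin p → Fin p → ℝ) → Fin p → Fin p → ℝ} (hα : Measurable α) :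
    Measurable fun t : (Fin n → Fin p → ℝ) × (Fin p → Fin p → ℝ) =>
      Model.estFun G lm dl κ (a t.1) (α t) t.1 t.2 := by
  have hR : ∀ j l, Measurable fun t : (Fin n → Fin p → ℝ) × (Fin p → Fin p → ℝ) =>
      t.2 l ⬝ᵥ sampleT G t.1 (t.2 j) := fun j l =>
    (Continuous.dotProduct (by fun_prop) (continuous_sampleT hG j)).measurable
  have hC : ∀ j l, Measurable fun t : (Fin n → Fin p → ℝ) × (Fin p → Fin p → ℝ) =>
      Model.constraint t.1 t.2 j l := by
    intro j l
    have h := fun a b => (continuous_sampleCov (n := n) (p := p) a b).comp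
      (continuous_fst (Y := Fin p → Fin p → ℝ))
    simp only [Function.comp_def] at h
    unfold Model.constraint
    exact Continuous.measurable (by fun_prop)
  have ha' : ∀ j l, Measurable fun t : (Fin n → Fin p → ℝ) × (Fin p → Fin p → ℝ) => a t.1 j l :=
    fun j l => (measurable_pi_apply l).comp ((measurable_pi_apply j).comp (ha.comp measurable_fst))
  have hα' : ∀ j l, Measurable fun t => α t j l :=
    fun j l => (measurable_pi_apply l).comp ((measurable_pi_apply j).comp hα)
  refine measurable_pi_iff.mpr fun j => measurable_pi_iff.mpr fun l => ?_
  unfold Model.estFun estMap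
  by_cases hjl : j = l
  · simp only [hjl, if_true]
    exact (hC l l).div_const _
  · simp only [hjl, if_false]
    exact ((((hα' j l).mul (hR j l)).sub ((hα' l j).mul (hR l j))).sub
      ((((ha' j l).mul_const _).sub ((ha' l j).mul_const _)).mul (hC j l))).div_const _

end Measurability

/-! ### The deflation equations in pairwise form -/

section Equations

variable {n p : ℕ} {G : ℝ → ℝ}

/-- Under the whitening constraint the vectors ŜΓ_l form the basis dual to the rows Γ_l, so T̂ = ∑_l
(Γ_lᵀT̂) ŜΓ_l. The deflation equation truncates this expansion at l ≤ j, that is, the later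
coefficients vanish. -/
lemma isDeflationSolution_iff {x : Fin n → Fin p → ℝ} {Γ : Matrix (Fin p) (Fin p) ℝ} :
    IsDeflationSolution G x Γ ↔ Γ * sampleCov x * Γᵀ = 1 ∧
      ∀ j l, j < l → Γ l ⬝ᵥ sampleT G x (Γ j) = 0 := by
  rw [IsDeflationSolution, and_comm]
  refine and_congr_right fun h1 => ?_
  have hdot : ∀ k l, Γ k ⬝ᵥ (sampleCov x *ᵥ Γ l) = (1 : Matrix (Fin p) (Fin p) ℝ) k l := by
    intro k l
    rw [← h1, Matrix.mul_assoc, Matrix.mul_apply]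
    rfl
  have hinv : sampleCov x * Γᵀ * Γ = 1 := by
    rw [Matrix.mul_assoc] at h1
    exact mul_eq_one_comm.mp h1
  have hexp : ∀ (s : Finset (Fin p)) (v : Fin p → ℝ),
      (sampleCov x * ∑ l ∈ s, vecMulVec (Γ l) (Γ l)) *ᵥ v =
        ∑ l ∈ s, (Γ l ⬝ᵥ v) • (sampleCov x *ᵥ Γ l) := by
    intro s v
    rw [← Matrix.mulVec_mulVec, Matrix.sum_mulVec, Matrix.mulVec_sum]
    refine Finset.sum_congr rfl fun l _ => ?_
    rw [Matrix.vecMulVec_mulVec, ← Matrix.mulVec_smul]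
    congr 1
    ext k
    simp [mul_comm]
  constructor
  · intro h j l hjl
    have h2 := congrArg (fun v => Γ l ⬝ᵥ v) (h j)
    simp only [hexp] at h2
    rw [h2, dotProduct_sum]
    refine Finset.sum_eq_zero fun k hk => ?_
    have hkl : l ≠ k := by
      rintro rfl
      exact absurd (Finset.mem_Iic.mp hk) (not_le.mpr hjl)
    rw [dotProduct_smul, hdot, Matrix.one_apply_ne hkl, smul_zero]
  · intro h j
    rw [hexp]
    have hfull : sampleT G x (Γ j) =
        ∑ l, (Γ l ⬝ᵥ sampleT G x (Γ j)) • (sampleCov x *ᵥ Γ l) := by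
      rw [← hexp]
      have : ∑ l, vecMulVec (Γ l) (Γ l) = Γᵀ * Γ := by
        ext a b
        simp [Matrix.sum_apply, vecMulVec_apply, Matrix.mul_apply]
      rw [this, ← Matrix.mul_assoc, hinv, Matrix.one_mulVec]
    conv_lhs => rw [hfull]
    refine (Finset.sum_subset (Finset.subset_univ _) fun l _ hl => ?_).symm
    rw [h j l (by simpa using hl), zero_smul]

end Equations

/-! ### Deflation-based and squared symmetric equations -/

namespace Model

variable {Ω : Type*} [MeasurableSpace Ω] {P : Measure Ω} {p : ℕ} {G : ℝ → ℝ}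
  {z : ℕ → Ω → Fin p → ℝ} {m : Fin p → ℝ} {κ : Fin p → Fin p → ℝ}
  {Sol : (n : ℕ) → (Fin n → Fin p → ℝ) → Matrix (Fin p) (Fin p) ℝ → Prop}

lemma isConsistentSolution_iff {Γ : Estimator p} :
    IsConsistentSolution P (icObs m 1 z) Sol Γ ↔
      Tendsto (evalObs Γ m z) (whp P) (𝓝 (idArr p)) ∧
        ∀ᶠ q in whp P, Sol q.1 (obs m z q) (evalObs Γ m z q) := by
  have h : (∀ j l, TendstoInMeasure P (fun n ω => Γ.toFun n (firstObs (icObs m 1 z) n ω) j l) atTop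
      (fun _ => (1 : Matrix (Fin p) (Fin p) ℝ) j l)) ↔
      Tendsto (evalObs Γ m z) (whp P) (𝓝 (idArr p)) := by
    rw [tendsto_pi_nhds]
    simp only [tendsto_pi_nhds, idArr_apply]
    refine forall_congr' fun j => forall_congr' fun l => ?_
    rw [tendsto_whp_iff]
    rfl
  exact ⟨fun hc => ⟨h.mp hc.consistent, hc.solves⟩, fun hc => ⟨hc.2, h.mpr hc.1⟩⟩

lemma measurable_estimator (hM : Model P G z) (Γ : Estimator p) (n : ℕ) (j l : Fin p) :
    Measurable fun ω => Γ.toFun n (firstObs (icObs m 1 z) n ω) j l := by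
  refine (Γ.measurable n j l).comp ?_
  unfold firstObs icObs
  refine measurable_pi_iff.mpr fun i => ?_
  simp only [one_mulVec]
  exact (hM.sample.measurable i).const_add m

lemma aemeasurable_scaledError (hM : Model P G z) (Γ : Estimator p) (n : ℕ) :
    AEMeasurable (scaledError (icObs m 1 z) Γ n) P := by
  refine Measurable.aemeasurable (measurable_pi_iff.mpr fun c => ?_)
  simp only [scaledError, Pi.smul_apply, vec, Matrix.sub_apply, smul_eq_mul]
  exact ((hM.measurable_estimator Γ n c.2 c.1).sub_const _).const_mul _

variable [IsProbabilityMeasure P]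

/-- Asymptotic normality of an estimator with a given first-order term. -/
lemma isAsympNormal_scaledError (hM : Model P G z) {Γ : Estimator p}
    {N : ℕ × Ω → Fin p → Fin p → ℝ}
    (hN : IsAsympNormal P (fun n ω (c : Fin p × Fin p) => -N (n, ω) c.2 c.1))
    (h : Tendsto (fun q => √(q.1 : ℝ) • (evalObs Γ m z q - idArr p) + N q) (whp P) (𝓝 0)) :
    IsAsympNormal P (scaledError (icObs m 1 z) Γ) := by
  refine hN.congr_of_tendsto (fun n => hM.aemeasurable_scaledError Γ n) ?_
  refine tendsto_pi_nhds.mpr fun c => ?_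
  have h1 := (tendsto_pi_nhds.mp ((tendsto_pi_nhds.mp h) c.2)) c.1
  refine h1.congr fun q => ?_
  have e : scaledError (icObs m 1 z) Γ q.1 q.2 c =
      √(q.1 : ℝ) * (evalObs Γ m z q c.2 c.1 - (1 : Matrix (Fin p) (Fin p) ℝ) c.2 c.1) := rfl
  rw [Pi.sub_apply, e]
  simp [idArr_apply]

/-- The main argument for nonrandom reference weights. -/
lemma Weights.solutionsAsympNormal (hM : Model P G z) {a : Fin p → Fin p → ℝ}
    {α : (n : ℕ) → (Fin n → Fin p → ℝ) → (Fin p → Fin p → ℝ) → Fin p → Fin p → ℝ}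
    (hα : ∀ n, Measurable (Function.uncurry (α n)))
    (hW : Weights P G z m κ (fun _ => a) (fun q Γ => α q.1 (obs m z q) Γ))
    (hjoint : IsAsympNormal P (jointStat P G z (icObs m 1 z)))
    (hSol : ∀ n x (Γ : Matrix (Fin p) (Fin p) ℝ), Sol n x Γ ↔ Γ * sampleCov x * Γᵀ = 1 ∧
      ∀ j l, α n x Γ j l * (Γ l ⬝ᵥ sampleT G x (Γ j)) =
        α n x Γ l j * (Γ j ⬝ᵥ sampleT G x (Γ l))) :
    SolutionsAsympNormal P (icObs m 1 z) Sol := by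
  have hiff : ∀ (q : ℕ × Ω) (Γ : Matrix (Fin p) (Fin p) ℝ), Sol q.1 (obs m z q) Γ ↔
      estFun G (lam P G (z 0)) (del P G (z 0)) κ a (α q.1 (obs m z q) Γ) (obs m z q) Γ = 0 :=
    fun q Γ => (hSol _ _ _).trans (estFun_eq_zero_iff (hW.kappa_eq q) hW.kappa_ne).symm
  constructor
  · obtain ⟨Γ, h1, h2⟩ := hW.exists_estimator hM hjoint
      (fun n x Γ => estFun G (lam P G (z 0)) (del P G (z 0)) κ a (α n x Γ) x Γ)
      (fun n => measurable_estFun hM.continuous_g _ _ _ (measurable_const (a := a)) (hα n))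
      (fun q Γ => rfl)
    exact ⟨Γ, isConsistentSolution_iff.mpr ⟨h1, h2.mono fun q hq => (hiff _ _).mpr hq⟩⟩
  · intro Γ hΓ
    obtain ⟨h1, h2⟩ := isConsistentSolution_iff.mp hΓ
    have h3 := (hW.expansion hM hjoint h1 (h2.mono fun q hq => (hiff _ _).mp hq)).2
    refine hM.isAsympNormal_scaledError ?_ h3
    exact hjoint.comp_clm (linStatL (lam P G (z 0)) (del P G (z 0)) κ a)

/-- Weights not depending on the argument of the equations. -/
lemma weights_of_bdd (hM : Model P G z) {a : ℕ × Ω → Fin p → Fin p → ℝ}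
    (hbdd : ∃ K, ∀ q j l, |a q j l| ≤ K)
    (hκ : ∀ q j l, j ≠ l → κ j l = kappa (lam P G (z 0)) (del P G (z 0)) (a q) j l)
    (hκ0 : ∀ j l, j ≠ l → κ j l ≠ 0) : Weights P G z m κ a (fun q _ => a q) := by
  obtain ⟨K, hK⟩ := hbdd
  refine ⟨⟨K, hK⟩, hκ, hκ0, fun j l hjl => ?_, fun j l hjl => ?_⟩
  · have hb : (fun t : (ℕ × Ω) × (Fin p → Fin p → ℝ) × (Fin p → Fin p → ℝ) => a t.1 j l)
        =O[whp P ×ˢ 𝓝 (idArr p, idArr p)] (fun _ => (1 : ℝ)) :=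
      IsBigO.of_bound K (Eventually.of_forall fun t => by simpa using hK t.1 j l)
    have h := hb.mul_isLittleO (IsLittleO.norm_right (hM.hasSDeriv_dotProduct_sampleT m hjl))
    simp only [one_mul] at h
    refine h.of_norm_right.congr_left fun t => ?_
    simp
    ring
  · have hb : (fun q : ℕ × Ω => a q j l) =O[whp P] (fun _ => (1 : ℝ)) :=
      IsBigO.of_bound K (Eventually.of_forall fun q => by simpa using hK q j l)
    have h := hb.mul (isBigO_refl (fun q : ℕ × Ω => √(q.1 : ℝ) *
      (sampleT G (obs m z q) (idArr p j) l - oracleT P G z q.1 j q.2 l)) (whp P))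
    simp only [one_mul] at h
    refine (h.trans_tendsto (hM.tendsto_sqrt_mul_sampleT_sub_oracleT m hjl)).congr fun q => ?_
    ring

/-- Deflation-based FastICA. -/
lemma deflation (hM : Model P G z) (hjoint : IsAsympNormal P (jointStat P G z (icObs m 1 z)))
    (h : ∀ j : Fin p, (j : ℕ) + 1 < p → lam P G (z 0) j ≠ del P G (z 0) j) :
    SolutionsAsympNormal P (icObs m 1 z) (fun _ x Γ => IsDeflationSolution G x Γ) := by
  -- With these weights one side of each pairwise equation is zero, and the equation for j < l reads
  -- Γ_lᵀT̂(Γ_j) = 0.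
  set a : Fin p → Fin p → ℝ := fun j l => if j < l then 1 else 0 with ha
  have hW : Weights P G z m (kappa (lam P G (z 0)) (del P G (z 0)) a) (fun _ => a)
      (fun q _ => (fun (n : ℕ) (_ : Fin n → Fin p → ℝ) (_ : Fin p → Fin p → ℝ) => a) q.1
        (obs m z q) (idArr p)) := by
    refine hM.weights_of_bdd ⟨1, fun q j l => ?_⟩ (fun _ _ _ _ => rfl) (fun j l hjl => ?_)
    · simp only [ha]
      split_ifs <;> simp
    · have hne : ∀ j l : Fin p, j < l → del P G (z 0) j - lam P G (z 0) j ≠ 0 := by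
        intro j l hjl
        -- The smaller index of a pair is never the last one, so λ_j ≠ δ_j is needed only before the
        -- last component.
        have : (j : ℕ) + 1 < p := by
          have h1 : (j : ℕ) < l := hjl
          have h2 := l.2
          omega
        exact sub_ne_zero.mpr (h j this).symm
      rcases lt_or_gt_of_ne hjl with h1 | h1
      · simpa [kappa, ha, h1, h1.not_gt] using hne j l h1
      · simpa [kappa, ha, h1, h1.not_gt] using hne l j h1
  refine Weights.solutionsAsympNormal hM (a := a) (α := fun n _ _ => a)
    (fun n => measurable_const) hW hjoint fun n x Γ => ?_
  rw [isDeflationSolution_iff]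
  refine and_congr_right fun _ => ⟨fun h2 j l => ?_, fun h2 j l hjl => ?_⟩
  · rcases lt_trichotomy j l with h1 | h1 | h1
    · simp [ha, h1, h1.not_gt, h2 j l h1]
    · rw [h1]
    · simp [ha, h1, h1.not_gt, h2 l j h1]
  · simpa [ha, hjl, hjl.not_gt] using h2 j l

/-- Squared symmetric FastICA. -/
lemma squaredSymmetric (hM : Model P G z)
    (hjoint : IsAsympNormal P (jointStat P G z (icObs m 1 z)))
    (hnonneg : ∀ j, 0 ≤ nu P G (z 0) j * (lam P G (z 0) j - del P G (z 0) j))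
    (hone : ∀ j l, nu P G (z 0) j * (lam P G (z 0) j - del P G (z 0) j) = 0 →
      nu P G (z 0) l * (lam P G (z 0) l - del P G (z 0) l) = 0 → j = l) :
    SolutionsAsympNormal P (icObs m 1 z) (fun _ x Γ => IsSquaredSymmetricSolution G x Γ) := by
  set a : Fin p → Fin p → ℝ := fun j _ => nu P G (z 0) j with ha
  have hW : Weights P G z m (kappa (lam P G (z 0)) (del P G (z 0)) a) (fun _ => a)
      (fun q Γ => (fun (n : ℕ) (x : Fin n → Fin p → ℝ) (Γ : Fin p → Fin p → ℝ) (j _ : Fin p) =>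
        sampleG G x (Γ j)) q.1 (obs m z q) Γ) := by
    refine ⟨⟨∑ j, |nu P G (z 0) j|, fun q j l => ?_⟩, fun _ _ _ _ => rfl, fun j l hjl => ?_,
      fun j l hjl => ?_, fun j l hjl => ?_⟩
    · exact Finset.single_le_sum (f := fun j => |nu P G (z 0) j|) (fun i _ => abs_nonneg _)
        (Finset.mem_univ j)
    -- Here κ_jl is minus the sum of two nonnegative numbers. If it were zero, both would vanish,
    -- which (A5) excludes for j ≠ l.
    · intro h0
      simp only [kappa, ha] at h0
      have h1 := hnonneg j
      have h2 := hnonneg l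
      exact hjl (hone j l (by linarith) (by linarith))
    · obtain ⟨D, hD, -⟩ := hM.hasSDeriv_sampleG m j
      -- In the product rule the derivative of the random weight Ĝ(γ_j) is multiplied by this limit,
      -- so only the limit ν_j of the weight remains.
      have hR0 : Tendsto (fun q => idArr p l ⬝ᵥ sampleT G (obs m z q) (idArr p j)) (whp P)
          (𝓝 0) := by
        obtain ⟨_, _, ht, _⟩ := hM.sampleT_expansion m j l
        simpa [idArr_dotProduct, hjl] using ht
      have h1 := hD.mul (hM.hasSDeriv_dotProduct_sampleT m hjl) (hM.tendsto_sampleG m j) hR0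
      refine IsLittleO.congr_left h1 fun t => ?_
      simp [ha]
      ring
    · have h1 := (hM.tendsto_sampleG m j).mul (hM.tendsto_sqrt_mul_sampleT_sub_oracleT m hjl)
      -- Ĝ(e_j) - ν_j is o_P(1) and √n T_jl is O_P(1), so Ĝ(e_j) may be replaced by ν_j in the
      -- leading term.
      have h2 := stochBdd_oracleT hjoint hjl _
        (by simpa using (hM.tendsto_sampleG m j).sub_const (nu P G (z 0) j))
      have h3 := h1.add h2
      rw [mul_zero, zero_add] at h3
      refine h3.congr fun q => ?_
      simp only [ha]
      ring
  refine Weights.solutionsAsympNormal hM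
    (α := fun (n : ℕ) (x : Fin n → Fin p → ℝ) (Γ : Fin p → Fin p → ℝ) (j _ : Fin p) =>
      sampleG G x (Γ j))
    (fun n => ?_) hW hjoint fun n x Γ => ?_
  · exact measurable_pi_iff.mpr fun j => measurable_pi_iff.mpr fun l =>
      (continuous_sampleG hM.continuous_contrast j).measurable
  · rw [IsSquaredSymmetricSolution, and_comm]
    simp only [sampleT2, dotProduct_smul, smul_eq_mul]

end Model

/-! ### Anticoncentration of normalized sums -/

section Anticoncentration

/-- Symmetrization: |φ|² is the characteristic function of the difference of two independent copies.
-/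
lemma sq_norm_charFun_eq (κ : Measure ℝ) [IsProbabilityMeasure κ] (u : ℝ) :
    ‖charFun κ u‖ ^ 2 = ∫ t : ℝ × ℝ, Real.cos (u * (t.1 - t.2)) ∂(κ.prod κ) := by
  have h1 : ((‖charFun κ u‖ ^ 2 : ℝ) : ℂ) = charFun κ u * charFun κ (-u) := by
    rw [charFun_neg, Complex.mul_conj, Complex.normSq_eq_norm_sq]
  have h2 : charFun κ u * charFun κ (-u) =
      ∫ t : ℝ × ℝ, Complex.exp ((u * (t.1 - t.2) : ℝ) * Complex.I) ∂(κ.prod κ) := by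
    rw [charFun_apply_real, charFun_apply_real, ← integral_prod_mul]
    congr 1
    ext t
    rw [← Complex.exp_add]
    congr 1
    push_cast
    ring
  have hint : Integrable (fun t : ℝ × ℝ => Complex.exp ((u * (t.1 - t.2) : ℝ) * Complex.I))
      (κ.prod κ) := by
    refine Integrable.of_bound (Continuous.aestronglyMeasurable (by fun_prop)) 1
      (ae_of_all _ fun t => ?_)
    rw [Complex.norm_exp_ofReal_mul_I]
  have h3 := congrArg Complex.re (h1.trans h2)
  rw [Complex.ofReal_re] at h3
  rw [h3, ← Complex.reCLM_apply, ← Complex.reCLM.integral_comp_comm hint]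
  simp only [Complex.reCLM_apply, Complex.exp_ofReal_mul_I_re]

/-- If every truncated second moment of the difference of two independent copies vanished, the
copies would agree almost surely, and fixing one of them by Fubini would make the law a point mass.
The truncation replaces a moment assumption. -/
lemma exists_truncated_variance_pos {κ : Measure ℝ} [IsProbabilityMeasure κ]
    (hκ : ¬ ∃ c, ∀ᵐ x ∂κ, x = c) :
    ∃ K : ℕ, 0 < ∫ t : ℝ × ℝ, Set.indicator {t : ℝ × ℝ | |t.1 - t.2| ≤ K}
      (fun t => (t.1 - t.2) ^ 2) t ∂(κ.prod κ) := by
  by_contra hcon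
  push Not at hcon
  apply hκ
  have hms : ∀ K : ℕ, MeasurableSet {t : ℝ × ℝ | |t.1 - t.2| ≤ K} := fun K =>
    (isClosed_le (by fun_prop) continuous_const).measurableSet
  have hz : ∀ K : ℕ, ∀ᵐ t ∂(κ.prod κ), Set.indicator {t : ℝ × ℝ | |t.1 - t.2| ≤ K}
      (fun t => (t.1 - t.2) ^ 2) t = 0 := by
    intro K
    have hnn : 0 ≤ fun t : ℝ × ℝ => Set.indicator {t : ℝ × ℝ | |t.1 - t.2| ≤ K}
      (fun t => (t.1 - t.2) ^ 2) t := fun t => Set.indicator_nonneg (fun t _ => sq_nonneg _) t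
    have hint : Integrable (fun t : ℝ × ℝ => Set.indicator {t : ℝ × ℝ | |t.1 - t.2| ≤ K}
        (fun t => (t.1 - t.2) ^ 2) t) (κ.prod κ) := by
      refine Integrable.of_bound ((Continuous.aestronglyMeasurable (by fun_prop)).indicator
        (hms K)) ((K : ℝ) ^ 2) (ae_of_all _ fun t => ?_)
      rw [Real.norm_of_nonneg (hnn t)]
      refine Set.indicator_apply_le' (fun h => ?_) (fun _ => by positivity)
      rw [← sq_abs]
      exact pow_le_pow_left₀ (abs_nonneg _) h 2
    exact (integral_eq_zero_iff_of_nonneg hnn hint).mp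
      (le_antisymm (hcon K) (integral_nonneg hnn))
  have h0 : ∀ᵐ t ∂(κ.prod κ), t.1 = t.2 := by
    filter_upwards [ae_all_iff.mpr hz] with t ht
    obtain ⟨K, hK⟩ := exists_nat_ge |t.1 - t.2|
    have := ht K
    rw [Set.indicator_of_mem (show t ∈ {t : ℝ × ℝ | |t.1 - t.2| ≤ K} from hK)] at this
    exact sub_eq_zero.mp (pow_eq_zero_iff (two_ne_zero)|>.mp this)
  obtain ⟨c, hc⟩ := (Measure.ae_ae_of_ae_prod h0).exists
  exact ⟨c, hc.mono fun x hx => hx.symm⟩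

/-- Gaussian decay of the characteristic function of a nondegenerate law near the origin. -/
lemma norm_charFun_le_exp {κ : Measure ℝ} [IsProbabilityMeasure κ]
    (hκ : ¬ ∃ c, ∀ᵐ x ∂κ, x = c) :
    ∃ c > 0, ∃ u₀ > 0, ∀ u : ℝ, |u| ≤ u₀ → ‖charFun κ u‖ ≤ Real.exp (-(c * u ^ 2)) := by
  obtain ⟨K, hK⟩ := exists_truncated_variance_pos hκ
  set A := {t : ℝ × ℝ | |t.1 - t.2| ≤ K} with hA
  set v := ∫ t : ℝ × ℝ, A.indicator (fun t => (t.1 - t.2) ^ 2) t ∂(κ.prod κ) with hv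
  have hAm : MeasurableSet A := (isClosed_le (by fun_prop) continuous_const).measurableSet
  have hint : Integrable (A.indicator (fun t : ℝ × ℝ => (t.1 - t.2) ^ 2)) (κ.prod κ) := by
    by_contra hcon
    rw [hv, integral_undef hcon] at hK
    exact lt_irrefl _ hK
  -- For |u| ≤ π / (K + 1) the argument of the cosine stays in [-π, π] on the truncation set, where
  -- cos x ≤ 1 - 2x² / π². Hence |φ(u)|² ≤ 1 - 2vu² / π² ≤ exp(-2vu² / π²).
  refine ⟨v / Real.pi ^ 2, by positivity, Real.pi / (K + 1), by positivity, fun u hu => ?_⟩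
  have hcos : Integrable (fun t : ℝ × ℝ => Real.cos (u * (t.1 - t.2))) (κ.prod κ) :=
    Integrable.of_bound (Continuous.aestronglyMeasurable (by fun_prop)) 1
      (ae_of_all _ fun t => Real.abs_cos_le_one _)
  have h1 : ‖charFun κ u‖ ^ 2 ≤ 1 - 2 / Real.pi ^ 2 * u ^ 2 * v := by
    rw [sq_norm_charFun_eq, hv, ← integral_const_mul]
    have : (1 : ℝ) = ∫ _ : ℝ × ℝ, (1 : ℝ) ∂(κ.prod κ) := by simp
    rw [this, ← integral_sub (integrable_const _) (hint.const_mul _)]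
    refine integral_mono hcos ((integrable_const _).sub (hint.const_mul _)) fun t => ?_
    by_cases ht : t ∈ A
    · simp only [Set.indicator_of_mem ht]
      have hb : |u * (t.1 - t.2)| ≤ Real.pi := by
        rw [abs_mul]
        calc |u| * |t.1 - t.2| ≤ Real.pi / (K + 1) * K := by
              gcongr
              exact ht
          _ ≤ Real.pi / (K + 1) * (K + 1) := by gcongr; linarith
          _ = Real.pi := by field_simp
      calc Real.cos (u * (t.1 - t.2)) ≤ 1 - 2 / Real.pi ^ 2 * (u * (t.1 - t.2)) ^ 2 :=
            Real.cos_le_one_sub_mul_cos_sq hb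
        _ = _ := by ring
    · simp only [Set.indicator_of_notMem ht]
      simpa using Real.cos_le_one _
  have h2 : ‖charFun κ u‖ ^ 2 ≤ Real.exp (-(v / Real.pi ^ 2 * u ^ 2)) ^ 2 := by
    refine h1.trans ?_
    rw [← Real.exp_nat_mul]
    refine le_trans (le_of_eq ?_) (Real.add_one_le_exp _)
    push_cast
    ring
  exact (sq_le_sq₀ (norm_nonneg _) (Real.exp_pos _).le).mp h2

/-- The Gaussian kernel is the characteristic function of the standard normal law; Fubini exchanges
the two measures. -/
lemma integral_exp_neg_sq_eq (η : Measure ℝ) [IsProbabilityMeasure η] :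
    ∫ s, Complex.exp (-(s : ℂ) ^ 2 / 2) ∂η = ∫ t, charFun η t ∂(gaussianReal 0 1) := by
  have h1 : ∀ s : ℝ, Complex.exp (-(s : ℂ) ^ 2 / 2) =
      ∫ t : ℝ, Complex.exp (t * s * Complex.I) ∂(gaussianReal 0 1) := by
    intro s
    have := charFun_gaussianReal (μ := 0) (v := 1) s
    rw [charFun_apply_real] at this
    simp only [mul_comm (s : ℂ)] at this
    rw [this]
    congr 1
    push_cast
    ring
  simp only [h1, charFun_apply_real]
  rw [integral_integral_swap]
  refine Integrable.of_bound (Continuous.aestronglyMeasurable (by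
    simp only [Function.uncurry_def]
    fun_prop)) 1 (ae_of_all _ fun t => ?_)
  have : ((t.2 : ℂ) * (t.1 : ℂ)) * Complex.I = ((t.2 * t.1 : ℝ) : ℂ) * Complex.I := by push_cast; rfl
  simp only [Function.uncurry_def, this, Complex.norm_exp_ofReal_mul_I, le_refl]

/-- The indicator of |x| ≤ ε lies below e · exp(-(x / ε)² / 2), whose integral is a Gaussian average
of the characteristic function. -/
lemma measureReal_abs_le_le (η : Measure ℝ) [IsProbabilityMeasure η] {ε : ℝ} (hε : 0 < ε) :
    η.real {x | |x| ≤ ε} ≤ Real.exp 1 * ∫ t, ‖charFun η (ε⁻¹ * t)‖ ∂(gaussianReal 0 1) := by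
  have : IsProbabilityMeasure (η.map (ε⁻¹ * ·)) :=
    Measure.isProbabilityMeasure_map (by fun_prop)
  have h1 := integral_exp_neg_sq_eq (η.map (ε⁻¹ * ·))
  rw [integral_map (by fun_prop) (Continuous.aestronglyMeasurable (by fun_prop))] at h1
  simp only [charFun_map_mul] at h1
  have h2 : (∫ x, Real.exp (-(ε⁻¹ * x) ^ 2 / 2) ∂η) ≤
      ∫ t, ‖charFun η (ε⁻¹ * t)‖ ∂(gaussianReal 0 1) := by
    refine le_trans ?_ (norm_integral_le_integral_norm _)
    rw [← h1]
    have h3 : ∀ x : ℝ, Complex.exp (-((ε⁻¹ * x : ℝ) : ℂ) ^ 2 / 2) =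
        ((Real.exp (-(ε⁻¹ * x) ^ 2 / 2) : ℝ) : ℂ) := by
      intro x
      push_cast
      rfl
    simp only [h3]
    rw [integral_complex_ofReal, Complex.norm_real]
    exact le_abs_self _
  have hms : MeasurableSet {x : ℝ | |x| ≤ ε} :=
    (isClosed_le continuous_abs continuous_const).measurableSet
  have hint : Integrable (fun x => Real.exp (-(ε⁻¹ * x) ^ 2 / 2)) η := by
    refine Integrable.of_bound (Continuous.aestronglyMeasurable (by fun_prop)) 1
      (ae_of_all _ fun x => ?_)
    rw [Real.norm_of_nonneg (Real.exp_pos _).le, Real.exp_le_one_iff]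
    have : 0 ≤ (ε⁻¹ * x) ^ 2 := sq_nonneg _
    linarith
  calc η.real {x | |x| ≤ ε} = ∫ x, Set.indicator {x | |x| ≤ ε} (fun _ => (1 : ℝ)) x ∂η := by
        rw [integral_indicator hms]
        simp
    _ ≤ ∫ x, Real.exp 1 * Real.exp (-(ε⁻¹ * x) ^ 2 / 2) ∂η := by
        refine integral_mono ((integrable_const _).indicator hms) (hint.const_mul _) fun x => ?_
        refine Set.indicator_apply_le' (fun hx => ?_) (fun _ => by positivity)
        have hx' : |x| ≤ ε := hx
        rw [← Real.exp_add]
        refine Real.one_le_exp ?_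
        have : (ε⁻¹ * x) ^ 2 ≤ 1 := by
          rw [← sq_abs, abs_mul, abs_of_pos (by positivity : 0 < ε⁻¹)]
          refine pow_le_one₀ (by positivity) ?_
          rw [inv_mul_le_iff₀ hε, mul_one]
          exact hx'
        linarith
    _ = Real.exp 1 * ∫ x, Real.exp (-(ε⁻¹ * x) ^ 2 / 2) ∂η := integral_const_mul _ _
    _ ≤ _ := by gcongr

variable {Ω : Type*} [MeasurableSpace Ω] {P : Measure Ω} [IsProbabilityMeasure P]
  {X : ℕ → Ω → ℝ}

/-- Normalized sums of independent copies of a nondegenerate random variable do not concentrate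
near the origin. No moments are required. -/
lemma anticoncentration (hm : ∀ i, Measurable (X i)) (hindep : iIndepFun X P)
    (hident : ∀ i, IdentDistrib (X i) (X 0) P P) (hdeg : ¬ ∃ c, ∀ᵐ ω ∂P, X 0 ω = c)
    {η : ℝ} (hη : 0 < η) :
    ∃ ε > 0, ∀ᶠ n : ℕ in atTop,
      P.real {ω | |(√(n : ℝ))⁻¹ * ∑ k ∈ Finset.range n, X k ω| ≤ ε} ≤ η := by
  have hκp : IsProbabilityMeasure (P.map (X 0)) :=
    Measure.isProbabilityMeasure_map (hm 0).aemeasurable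
  obtain ⟨c, hc, u₀, hu₀, hφ⟩ := norm_charFun_le_exp (κ := P.map (X 0)) (by
    rintro ⟨c, hc'⟩
    exact hdeg ⟨c, ae_of_ae_map (hm 0).aemeasurable hc'⟩)
  set γ := gaussianReal 0 1 with hγ
  -- The width ε = 1 / K is chosen first: the Gaussian average of exp(-c K² t²) tends to zero as K
  -- grows.
  have hlimε : Tendsto (fun k : ℕ => ∫ t, Real.exp (-(c * (((k : ℝ) + 1) * t) ^ 2)) ∂γ) atTop
      (𝓝 (∫ _, (0 : ℝ) ∂γ)) := by
    refine tendsto_integral_of_dominated_convergence (fun _ => 1)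
      (fun k => Continuous.aestronglyMeasurable (by fun_prop)) (integrable_const _)
      (fun k => ae_of_all _ fun t => ?_) ?_
    · rw [Real.norm_of_nonneg (Real.exp_pos _).le, Real.exp_le_one_iff]
      have : 0 ≤ c * (((k : ℝ) + 1) * t) ^ 2 := by positivity
      linarith
    · have hna : NullSingletonClass γ := nullSingletonClass_gaussianReal one_ne_zero
      have h0 : ∀ᵐ t ∂γ, t ≠ 0 := by
        rw [ae_iff]
        simp
      filter_upwards [h0] with t ht
      refine Real.tendsto_exp_atBot.comp (tendsto_neg_atTop_atBot.comp ?_)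
      refine Tendsto.const_mul_atTop hc ?_
      have : Tendsto (fun k : ℕ => ((k : ℝ) + 1) ^ 2 * t ^ 2) atTop atTop := by
        refine Tendsto.atTop_mul_const (by positivity) ?_
        exact (tendsto_pow_atTop two_ne_zero).comp
          (tendsto_atTop_add_const_right _ _ tendsto_natCast_atTop_atTop)
      exact this.congr fun k => by ring
  rw [integral_zero] at hlimε
  obtain ⟨k, hk⟩ := (hlimε.eventually (gt_mem_nhds
    (show (0 : ℝ) < η / Real.exp 1 by positivity))).exists
  set K : ℝ := (k : ℝ) + 1 with hK
  have hKpos : 0 < K := by positivity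
  refine ⟨K⁻¹, by positivity, ?_⟩
  -- For fixed t the decay bound near the origin applies once K|t| / √n ≤ u₀. Taking the maximum
  -- with the bound gives an integrand that converges pointwise, although the powers of the
  -- characteristic function may not.
  have hlimn : Tendsto (fun n : ℕ => ∫ t, max (‖charFun (P.map (X 0)) ((√(n : ℝ))⁻¹ * (K * t)) ^ n‖)
      (Real.exp (-(c * (K * t) ^ 2))) ∂γ) atTop (𝓝 (∫ t, Real.exp (-(c * (K * t) ^ 2)) ∂γ)) := by
    refine tendsto_integral_of_dominated_convergence (fun _ => 1) (fun n => ?_)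
      (integrable_const _) (fun n => ae_of_all _ fun t => ?_) (ae_of_all _ fun t => ?_)
    · refine Continuous.aestronglyMeasurable ?_
      refine Continuous.max ?_ (by fun_prop)
      refine (Continuous.pow ?_ n).norm
      exact continuous_charFun.comp (by fun_prop)
    · rw [Real.norm_of_nonneg (le_max_of_le_left (norm_nonneg _))]
      refine max_le ?_ ?_
      · rw [norm_pow]
        exact pow_le_one₀ (norm_nonneg _) (norm_charFun_le_one _)
      · rw [Real.exp_le_one_iff]
        have : 0 ≤ c * (K * t) ^ 2 := by positivity
        linarith
    · refine tendsto_const_nhds.congr' ?_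
      have hs : Tendsto (fun n : ℕ => (√(n : ℝ))⁻¹ * (K * t)) atTop (𝓝 0) := by
        have := (tendsto_inv_atTop_zero.comp
          (Real.tendsto_sqrt_atTop.comp tendsto_natCast_atTop_atTop)).mul_const (K * t)
        simpa using this
      have hs' := (tendsto_zero_iff_abs_tendsto_zero _).mp hs
      filter_upwards [hs'.eventually (ge_mem_nhds hu₀), eventually_gt_atTop 0] with n hn hn0
      refine (max_eq_right ?_).symm
      rw [norm_pow]
      refine (pow_le_pow_left₀ (norm_nonneg _) (hφ _ hn) n).trans (le_of_eq ?_)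
      rw [← Real.exp_nat_mul]
      congr 1
      have : (0 : ℝ) < n := by exact_mod_cast hn0
      rw [mul_pow (√(n : ℝ))⁻¹, inv_pow, Real.sq_sqrt this.le]
      field_simp
  filter_upwards [hlimn.eventually (gt_mem_nhds hk)] with n hn
  have hY : Measurable fun ω => (√(n : ℝ))⁻¹ * ∑ k ∈ Finset.range n, X k ω :=
    (Finset.measurable_sum _ fun i _ => hm i).const_mul _
  set Y := fun ω => (√(n : ℝ))⁻¹ * ∑ k ∈ Finset.range n, X k ω with hYdef
  have hYp : IsProbabilityMeasure (P.map Y) := Measure.isProbabilityMeasure_map hY.aemeasurable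
  have hms : MeasurableSet {x : ℝ | |x| ≤ K⁻¹} :=
    (isClosed_le continuous_abs continuous_const).measurableSet
  have h1 := measureReal_abs_le_le (P.map Y) (by positivity : 0 < K⁻¹)
  rw [map_measureReal_apply hY hms, inv_inv] at h1
  have hchar : ∀ t, charFun (P.map Y) t = charFun (P.map (X 0)) ((√(n : ℝ))⁻¹ * t) ^ n := fun t =>
    charFun_inv_sqrt_mul_sum hindep hident
  simp only [hchar] at h1
  refine h1.trans ?_
  rw [← le_div_iff₀' (Real.exp_pos 1)]
  refine le_trans (integral_mono_of_nonneg (ae_of_all _ fun t => norm_nonneg _) ?_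
    (ae_of_all _ fun t => le_max_left _ _)) hn.le
  refine Integrable.of_bound ?_ 1 (ae_of_all _ fun t => ?_)
  · refine Continuous.aestronglyMeasurable (Continuous.max ?_ (by fun_prop))
    refine (Continuous.pow ?_ n).norm
    exact continuous_charFun.comp (by fun_prop)
  · rw [Real.norm_of_nonneg (le_max_of_le_left (norm_nonneg _))]
    refine max_le ?_ ?_
    · rw [norm_pow]
      exact pow_le_one₀ (norm_nonneg _) (norm_charFun_le_one _)
    · rw [Real.exp_le_one_iff]
      have : 0 ≤ c * (K * t) ^ 2 := by positivity
      linarith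

/-- Negligible perturbations do not change the sign of normalized sums of independent copies of a
nondegenerate random variable. -/
lemma eventually_abs_lt_of_tendsto_zero (hm : ∀ i, Measurable (X i)) (hindep : iIndepFun X P)
    (hident : ∀ i, IdentDistrib (X i) (X 0) P P) (hdeg : ¬ ∃ c, ∀ᵐ ω ∂P, X 0 ω = c)
    {r : ℕ × Ω → ℝ} (hr : Tendsto r (whp P) (𝓝 0)) :
    ∀ᶠ q in whp P, |r q| < |(√(q.1 : ℝ))⁻¹ * ∑ k ∈ Finset.range q.1, X k q.2| := by
  rw [eventually_whp, ENNReal.tendsto_nhds_zero]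
  intro η hη
  by_cases hηt : η = ⊤
  · simp [hηt]
  have hη2 : 0 < (η / 2).toReal := ENNReal.toReal_pos (by simpa using hη.ne')
    (ENNReal.div_lt_top hηt two_ne_zero).ne
  obtain ⟨ε, hε, h1⟩ := anticoncentration hm hindep hident hdeg hη2
  have h2 := Metric.tendsto_nhds.mp hr ε hε
  rw [eventually_whp, ENNReal.tendsto_nhds_zero] at h2
  filter_upwards [h1, h2 (η / 2) (by simpa using hη.ne')] with n hn1 hn2
  have hn1' : P {ω | |(√(n : ℝ))⁻¹ * ∑ k ∈ Finset.range n, X k ω| ≤ ε} ≤ η / 2 := by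
    rw [← ENNReal.toReal_le_toReal (measure_ne_top _ _) (ENNReal.div_lt_top hηt two_ne_zero).ne]
    exact hn1
  calc P {ω | ¬ |r (n, ω)| < |(√(n : ℝ))⁻¹ * ∑ k ∈ Finset.range n, X k ω|}
      ≤ P ({ω | |(√(n : ℝ))⁻¹ * ∑ k ∈ Finset.range n, X k ω| ≤ ε} ∪
          {ω | ¬ dist (r (n, ω)) 0 < ε}) := by
        refine measure_mono fun ω hω => ?_
        by_contra hcon
        simp only [Set.mem_union, Set.mem_ofPred_eq, not_or, not_not, not_le] at hcon
        apply hω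
        have := hcon.2
        rw [dist_zero_right, Real.norm_eq_abs] at this
        exact this.trans hcon.1
    _ ≤ η / 2 + η / 2 := (measure_union_le _ _).trans (add_le_add hn1' hn2)
    _ = η := ENNReal.add_halves η

end Anticoncentration

/-! ### Random signs and conditional characteristic functions -/

section RandomSign

/-- Powers of the characteristic function of a centred square-integrable variable. -/
lemma tendsto_charFun_pow {S : Type*} [MeasurableSpace S] {ρ : Measure S} [IsProbabilityMeasure ρ]
    {f : S → ℝ} (hf : MemLp f 2 ρ) (h0 : ∫ x, f x ∂ρ = 0) :
    Tendsto (fun n : ℕ => (∫ x, Complex.exp (((√(n : ℝ))⁻¹ * f x : ℝ) * Complex.I) ∂ρ) ^ n) atTop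
      (𝓝 (Real.exp (-(∫ x, f x ^ 2 ∂ρ) / 2) : ℂ)) := by
  set v := ∫ x, f x ^ 2 ∂ρ with hv
  have hv0 : 0 ≤ v := integral_nonneg fun x => sq_nonneg _
  -- A degenerate summand cannot be normalized to unit variance and is treated directly.
  rcases hv0.eq_or_lt with h | h
  · have hae : ∀ᵐ x ∂ρ, f x = 0 := by
      have := (integral_eq_zero_iff_of_nonneg (fun x => sq_nonneg (f x)) hf.integrable_sq).mp h.symm
      filter_upwards [this] with x hx
      simpa using hx
    have h1 : ∀ n : ℕ, ∫ x, Complex.exp (((√(n : ℝ))⁻¹ * f x : ℝ) * Complex.I) ∂ρ = 1 := by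
      intro n
      rw [integral_congr_ae (g := fun _ => (1 : ℂ))]
      · simp
      · filter_upwards [hae] with x hx
        simp [hx]
    simp only [h1, one_pow, ← h]
    simp
  · have hs : 0 < √v := Real.sqrt_pos.mpr h
    have hm : AEMeasurable (fun x => f x / √v) ρ := hf.aestronglyMeasurable.aemeasurable.div_const _
    have h1 := tendsto_charFun_inv_sqrt_mul_pow hm (by rw [integral_div, h0, zero_div])
      (by
        simp only [Pi.pow_apply, div_pow, Real.sq_sqrt hv0]
        rw [integral_div, ← hv, div_self h.ne']) (√v)
    convert! h1 using 2 with n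
    · congr 1
      rw [charFun_apply_real, integral_map hm (by fun_prop)]
      refine integral_congr_ae (Eventually.of_forall fun x => ?_)
      simp only
      congr 1
      push_cast
      have : (√v : ℂ) ≠ 0 := by exact_mod_cast hs.ne'
      field_simp
    · push_cast
      congr 2
      rw [← Complex.ofReal_pow, Real.sq_sqrt hv0]

variable {α β : Type*} [MeasurableSpace α] [MeasurableSpace β] {μ : Measure α} {ν : Measure β}
  [IsProbabilityMeasure μ] [IsProbabilityMeasure ν]

/-- The conditional characteristic function of `f (x, ·) / √n` at one. -/
def condChar (ν : Measure β) (f : α × β → ℝ) (n : ℕ) (x : α) : ℂ :=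
  ∫ y, Complex.exp (((√(n : ℝ))⁻¹ * f (x, y) : ℝ) * Complex.I) ∂ν

lemma measurable_condChar {f : α × β → ℝ} (hf : Measurable f) (n : ℕ) :
    Measurable (condChar ν f n) := by
  refine (StronglyMeasurable.integral_prod_right ?_).measurable
  exact Measurable.stronglyMeasurable (by fun_prop)

lemma norm_condChar_le {α : Type*} (f : α × β → ℝ) (n : ℕ) (x : α) : ‖condChar ν f n x‖ ≤ 1 := by
  refine (norm_integral_le_integral_norm _).trans ?_
  simp only [Complex.norm_exp_ofReal_mul_I]
  simp

lemma integrable_cexp {S : Type*} [MeasurableSpace S] {ρ : Measure S} [IsFiniteMeasure ρ]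
    {f : S → ℝ} (hf : Measurable f) : Integrable (fun x => Complex.exp (f x * Complex.I)) ρ :=
  Integrable.of_bound (Measurable.aestronglyMeasurable (by fun_prop)) 1
    (Eventually.of_forall fun x => by simp [Complex.norm_exp_ofReal_mul_I])

/-- Products of conditional characteristic functions concentrate at a constant. -/
lemma tendsto_integral_norm_sq_prod_condChar {f : α × β → ℝ} (hf : Measurable f)
    (hf2 : MemLp f 2 (μ.prod ν)) (h0 : ∀ x, ∫ y, f (x, y) ∂ν = 0) :
    Tendsto (fun n : ℕ => ∫ x : Fin n → α, ‖∏ i, condChar ν f n (x i) -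
      (Real.exp (-(∫ t, f t ^ 2 ∂(μ.prod ν)) / 2) : ℂ)‖ ^ 2 ∂(Measure.pi fun _ => μ))
      atTop (𝓝 0) := by
  set v := ∫ t, f t ^ 2 ∂(μ.prod ν) with hv
  set c := Real.exp (-v / 2) with hc
  have hint : ∫ t, f t ∂(μ.prod ν) = 0 := by
    rw [integral_prod _ (hf2.integrable one_le_two)]
    simp [h0]
  have h1 := tendsto_charFun_pow hf2 hint
  -- Two copies of y over the same x: the mean of |χ_n(x)|² is the characteristic function of f(x,
  -- y) - f(x, y'), whose variance is 2v because conditional centring kills the cross term.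
  have hp1 : MeasurePreserving (fun t : α × β × β => (t.1, t.2.1)) (μ.prod (ν.prod ν))
      (μ.prod ν) := (MeasurePreserving.id μ).prod measurePreserving_fst
  have hp2 : MeasurePreserving (fun t : α × β × β => (t.1, t.2.2)) (μ.prod (ν.prod ν))
      (μ.prod ν) := (MeasurePreserving.id μ).prod measurePreserving_snd
  have hm1 := hf2.comp_measurePreserving hp1
  have hm2 := hf2.comp_measurePreserving hp2
  simp only [Function.comp_def] at hm1 hm2
  have hmul : Integrable (fun t : α × β × β => f (t.1, t.2.1) * f (t.1, t.2.2))
      (μ.prod (ν.prod ν)) := hm1.integrable_mul hm2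
  have hcross : ∫ t : α × β × β, f (t.1, t.2.1) * f (t.1, t.2.2) ∂(μ.prod (ν.prod ν)) = 0 := by
    rw [integral_prod _ hmul]
    refine integral_eq_zero_of_ae (Eventually.of_forall fun x => ?_)
    simp only
    rw [integral_prod_mul (fun y => f (x, y)) (fun y => f (x, y)), h0, zero_mul]
    rfl
  have hi1 : ∫ t : α × β × β, f (t.1, t.2.1) ∂(μ.prod (ν.prod ν)) = 0 := by
    rw [← hint, ← hp1.map_eq, integral_map hp1.measurable.aemeasurable (by fun_prop)]
  have hi2 : ∫ t : α × β × β, f (t.1, t.2.2) ∂(μ.prod (ν.prod ν)) = 0 := by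
    rw [← hint, ← hp2.map_eq, integral_map hp2.measurable.aemeasurable (by fun_prop)]
  have hs1 : ∫ t : α × β × β, f (t.1, t.2.1) ^ 2 ∂(μ.prod (ν.prod ν)) = v := by
    rw [hv, ← hp1.map_eq, integral_map hp1.measurable.aemeasurable (by fun_prop)]
  have hs2 : ∫ t : α × β × β, f (t.1, t.2.2) ^ 2 ∂(μ.prod (ν.prod ν)) = v := by
    rw [hv, ← hp2.map_eq, integral_map hp2.measurable.aemeasurable (by fun_prop)]
  have h2 := tendsto_charFun_pow (hm1.sub hm2) (by
    simp only [Pi.sub_apply]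
    rw [integral_sub (hm1.integrable one_le_two) (hm2.integrable one_le_two), hi1, hi2, sub_zero])
  have hvar : ∫ t : α × β × β, ((fun t : α × β × β => f (t.1, t.2.1)) -
      fun t : α × β × β => f (t.1, t.2.2)) t ^ 2 ∂(μ.prod (ν.prod ν)) = 2 * v := by
    have e : ∀ t : α × β × β, ((fun t : α × β × β => f (t.1, t.2.1)) -
        fun t : α × β × β => f (t.1, t.2.2)) t ^ 2 =
        f (t.1, t.2.1) ^ 2 + f (t.1, t.2.2) ^ 2 - 2 * (f (t.1, t.2.1) * f (t.1, t.2.2)) := by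
      intro t
      simp only [Pi.sub_apply]
      ring
    simp only [e]
    have hadd : Integrable (fun t : α × β × β => f (t.1, t.2.1) ^ 2 + f (t.1, t.2.2) ^ 2)
        (μ.prod (ν.prod ν)) := hm1.integrable_sq.add hm2.integrable_sq
    rw [integral_sub hadd (hmul.const_mul 2), integral_add hm1.integrable_sq hm2.integrable_sq,
      integral_const_mul, hcross, hs1, hs2]
    ring
  rw [hvar] at h2
  have e1 : ∀ n : ℕ, ∫ t, Complex.exp (((√(n : ℝ))⁻¹ * f t : ℝ) * Complex.I) ∂(μ.prod ν) =
      ∫ x, condChar ν f n x ∂μ := fun n =>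
    integral_prod _ (integrable_cexp (f := fun t => (√(n : ℝ))⁻¹ * f t) (by fun_prop))
  have e2 : ∀ n : ℕ, ∫ t : α × β × β, Complex.exp (((√(n : ℝ))⁻¹ *
      ((fun t : α × β × β => f (t.1, t.2.1)) - fun t : α × β × β => f (t.1, t.2.2)) t : ℝ) *
        Complex.I) ∂(μ.prod (ν.prod ν)) = ((∫ x, Complex.normSq (condChar ν f n x) ∂μ : ℝ) : ℂ) := by
    intro n
    rw [integral_prod _ (integrable_cexp (f := fun t : α × β × β => (√(n : ℝ))⁻¹ *
      ((fun t : α × β × β => f (t.1, t.2.1)) - fun t : α × β × β => f (t.1, t.2.2)) t) (by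
        simp only [Pi.sub_apply]
        fun_prop)), ← integral_complex_ofReal]
    refine integral_congr_ae (Eventually.of_forall fun x => ?_)
    simp only [Pi.sub_apply]
    rw [← Complex.mul_conj, condChar, ← integral_conj, ← integral_prod_mul]
    refine integral_congr_ae (Eventually.of_forall fun y => ?_)
    simp only
    rw [← Complex.exp_conj, ← Complex.exp_add]
    congr 1
    simp
    ring
  simp only [e1] at h1
  simp only [e2] at h2
  have hre1 : Tendsto (fun n : ℕ => ((∫ x, condChar ν f n x ∂μ) ^ n).re) atTop (𝓝 c) := by
    have := (Complex.continuous_re.tendsto _).comp h1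
    rwa [Complex.ofReal_re] at this
  have hre2 : Tendsto (fun n : ℕ => (∫ x, Complex.normSq (condChar ν f n x) ∂μ) ^ n) atTop
      (𝓝 (c ^ 2)) := by
    have := (Complex.continuous_re.tendsto _).comp h2
    rw [Complex.ofReal_re] at this
    convert! this using 2 with n
    · simp only [Function.comp_apply, ← Complex.ofReal_pow, Complex.ofReal_re]
    · rw [hc, ← Real.exp_nat_mul]
      congr 1
      push_cast
      ring
  -- Expansion of E|∏χ_n - c|²: the second moment tends to c² and the mean to c, so no conditional
  -- central limit theorem is needed.
  have h3 := (hre2.sub (hre1.const_mul (2 * c))).add_const (c ^ 2)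
  rw [show c ^ 2 - 2 * c * c + c ^ 2 = 0 by ring] at h3
  refine h3.congr fun n => ?_
  have hbd : ∀ x : Fin n → α, ‖∏ i, condChar ν f n (x i)‖ ≤ 1 := fun x => by
    rw [norm_prod]
    exact Finset.prod_le_one (fun i _ => norm_nonneg _) fun i _ => norm_condChar_le f n (x i)
  have hmp : Measurable fun x : Fin n → α => ∏ i, condChar ν f n (x i) :=
    Finset.measurable_prod _ fun i _ => (measurable_condChar hf n).comp (measurable_pi_apply i)
  have i1 : Integrable (fun x : Fin n → α => ∏ i, condChar ν f n (x i))
      (Measure.pi fun _ => μ) :=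
    Integrable.of_bound hmp.aestronglyMeasurable 1 (Eventually.of_forall hbd)
  have i2 : Integrable (fun x : Fin n → α => ∏ i, Complex.normSq (condChar ν f n (x i)))
      (Measure.pi fun _ => μ) := by
    refine Integrable.of_bound (Measurable.aestronglyMeasurable ?_) 1
      (Eventually.of_forall fun x => ?_)
    · exact Finset.measurable_prod _ fun i _ => Complex.continuous_normSq.measurable.comp
        ((measurable_condChar hf n).comp (measurable_pi_apply i))
    · rw [norm_prod]
      refine Finset.prod_le_one (fun i _ => norm_nonneg _) fun i _ => ?_
      rw [Real.norm_of_nonneg (Complex.normSq_nonneg _), Complex.normSq_eq_norm_sq]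
      exact pow_le_one₀ (norm_nonneg _) (norm_condChar_le f n (x i))
  have e3 : ∀ x : Fin n → α, ‖∏ i, condChar ν f n (x i) - (c : ℂ)‖ ^ 2 =
      ∏ i, Complex.normSq (condChar ν f n (x i)) - 2 * c * (∏ i, condChar ν f n (x i)).re
        + c ^ 2 := by
    intro x
    rw [← Complex.normSq_eq_norm_sq, Complex.normSq_sub, map_prod, Complex.normSq_ofReal,
      Complex.conj_ofReal, Complex.re_mul_ofReal]
    ring
  simp only [e3]
  have i1re : Integrable (fun x : Fin n → α => (∏ i, condChar ν f n (x i)).re)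
      (Measure.pi fun _ => μ) := i1.re
  have i3 : Integrable (fun x : Fin n → α => ∏ i, Complex.normSq (condChar ν f n (x i)) -
      2 * c * (∏ i, condChar ν f n (x i)).re) (Measure.pi fun _ => μ) :=
    i2.sub (i1re.const_mul _)
  rw [integral_add i3 (integrable_const _),
    integral_sub i2 (i1re.const_mul _), integral_const_mul,
    integral_fintype_prod_eq_pow (fun x => Complex.normSq (condChar ν f n x))]
  have : ∫ x : Fin n → α, (∏ i, condChar ν f n (x i)).re ∂(Measure.pi fun _ => μ) =
      ((∫ x, condChar ν f n x ∂μ) ^ n).re := by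
    have h5 := integral_fintype_prod_eq_pow (ι := Fin n) (μ := μ) (fun x => condChar ν f n x)
    rw [Fintype.card_fin] at h5
    rw [← h5]
    exact integral_re i1
  rw [this]
  simp

/-- Averages of random variables of modulus one, conditionally on the first components. -/
lemma tendsto_integral_mul_cexp_sub {f : α × β → ℝ} (hf : Measurable f)
    (hf2 : MemLp f 2 (μ.prod ν)) (h0 : ∀ x, ∫ y, f (x, y) ∂ν = 0)
    {Φ : (n : ℕ) → (Fin n → α) → ℂ} (hΦ : ∀ n, Measurable (Φ n)) (hΦ1 : ∀ n x, ‖Φ n x‖ ≤ 1) :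
    Tendsto (fun n : ℕ => ∫ t : (Fin n → α) × (Fin n → β), Φ n t.1 *
      (Complex.exp (((√(n : ℝ))⁻¹ * ∑ i, f (t.1 i, t.2 i) : ℝ) * Complex.I) -
        (Real.exp (-(∫ t, f t ^ 2 ∂(μ.prod ν)) / 2) : ℂ))
      ∂((Measure.pi fun _ => μ).prod (Measure.pi fun _ => ν))) atTop (𝓝 0) := by
  set c : ℂ := (Real.exp (-(∫ t, f t ^ 2 ∂(μ.prod ν)) / 2) : ℂ) with hc
  have hlim := tendsto_integral_norm_sq_prod_condChar hf hf2 h0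
  rw [← hc] at hlim
  have hsq := hlim.sqrt
  rw [Real.sqrt_zero] at hsq
  refine squeeze_zero_norm (fun n => ?_) hsq
  have hmp : Measurable fun x : Fin n → α => ∏ i, condChar ν f n (x i) :=
    Finset.measurable_prod _ fun i _ => (measurable_condChar hf n).comp (measurable_pi_apply i)
  have hmF : Measurable fun t : (Fin n → α) × (Fin n → β) =>
      (√(n : ℝ))⁻¹ * ∑ i, f (t.1 i, t.2 i) := by fun_prop
  have hE := integrable_cexp (ρ := (Measure.pi fun _ : Fin n => μ).prod
    (Measure.pi fun _ : Fin n => ν)) hmF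
  have hint : Integrable (fun t : (Fin n → α) × (Fin n → β) => Φ n t.1 *
      (Complex.exp (((√(n : ℝ))⁻¹ * ∑ i, f (t.1 i, t.2 i) : ℝ) * Complex.I) - c))
      ((Measure.pi fun _ => μ).prod (Measure.pi fun _ => ν)) :=
    (hE.sub (integrable_const c)).bdd_mul ((hΦ n).comp measurable_fst).aestronglyMeasurable
      (Eventually.of_forall fun t => hΦ1 n t.1)
  have hinner : ∀ x : Fin n → α, ∫ y : Fin n → β, Φ n x *
      (Complex.exp (((√(n : ℝ))⁻¹ * ∑ i, f (x i, y i) : ℝ) * Complex.I) - c)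
      ∂(Measure.pi fun _ => ν) = Φ n x * (∏ i, condChar ν f n (x i) - c) := by
    intro x
    have hx : Measurable fun y : Fin n → β => (√(n : ℝ))⁻¹ * ∑ i, f (x i, y i) := by fun_prop
    rw [integral_const_mul, integral_sub (integrable_cexp hx) (integrable_const c)]
    congr 2
    · unfold condChar
      rw [← integral_fintype_prod_eq_prod (fun i y =>
        Complex.exp (((√(n : ℝ))⁻¹ * f (x i, y) : ℝ) * Complex.I)) (μ := fun _ => ν)]
      refine integral_congr_ae (Eventually.of_forall fun y => ?_)
      simp only
      rw [← Complex.exp_sum]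
      congr 1
      push_cast
      rw [Finset.mul_sum, Finset.sum_mul]
    · simp
  rw [integral_prod _ hint]
  simp only [hinner]
  have hbd : ∀ x : Fin n → α, ‖∏ i, condChar ν f n (x i) - c‖ ≤ 1 + ‖c‖ := fun x => by
    refine (norm_sub_le _ _).trans (add_le_add_left ?_ _)
    rw [norm_prod]
    exact Finset.prod_le_one (fun i _ => norm_nonneg _) fun i _ => norm_condChar_le f n (x i)
  have hL : MemLp (fun x : Fin n → α => ‖∏ i, condChar ν f n (x i) - c‖) 2
      (Measure.pi fun _ => μ) :=
    MemLp.of_bound (hmp.sub_const c).norm.aestronglyMeasurable (1 + ‖c‖)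
      (Eventually.of_forall fun x => by simpa using hbd x)
  calc ‖∫ x : Fin n → α, Φ n x * (∏ i, condChar ν f n (x i) - c) ∂(Measure.pi fun _ => μ)‖
      ≤ ∫ x : Fin n → α, ‖∏ i, condChar ν f n (x i) - c‖ ∂(Measure.pi fun _ => μ) := by
        refine norm_integral_le_of_norm_le (hL.integrable one_le_two)
          (Eventually.of_forall fun x => ?_)
        rw [norm_mul]
        exact mul_le_of_le_one_left (norm_nonneg _) (hΦ1 n x)
    _ ≤ _ := by
        -- The L¹ norm is at most the L² norm, read off from nonnegativity of the variance.
        refine Real.le_sqrt_of_sq_le ?_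
        have h := variance_nonneg (fun x : Fin n → α => ‖∏ i, condChar ν f n (x i) - c‖)
          (Measure.pi fun _ => μ)
        rw [variance_eq_sub hL] at h
        simpa using h

/-- A sign depending on the first components does not affect the limit. -/
lemma tendsto_integral_cexp_sign {u v : α × β → ℝ} {w : α → ℝ} (hu : Measurable u)
    (hv : Measurable v) (hw : Measurable w) (hu2 : MemLp u 2 (μ.prod ν))
    (hv2 : MemLp v 2 (μ.prod ν)) (hu0 : ∀ x, ∫ y, u (x, y) ∂ν = 0)
    (hui : ∀ x, Integrable (fun y => u (x, y)) ν) (hvi : ∀ x, Integrable (fun y => v (x, y)) ν)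
    (hv0 : ∀ x, ∫ y, v (x, y) ∂ν = 0) (huv : ∫ t, u t * v t ∂(μ.prod ν) = 0)
    {s : (n : ℕ) → (Fin n → α) → ℝ} (hs : ∀ n, Measurable (s n))
    (hs1 : ∀ n x, s n x = 1 ∨ s n x = -1) :
    Tendsto (fun n : ℕ => ∫ t : (Fin n → α) × (Fin n → β),
      (Complex.exp (((√(n : ℝ))⁻¹ *
        ∑ i, (s n t.1 * u (t.1 i, t.2 i) + (v (t.1 i, t.2 i) + w (t.1 i))) : ℝ) * Complex.I) -
      Complex.exp (((√(n : ℝ))⁻¹ *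
        ∑ i, (u (t.1 i, t.2 i) + (v (t.1 i, t.2 i) + w (t.1 i))) : ℝ) * Complex.I))
      ∂((Measure.pi fun _ => μ).prod (Measure.pi fun _ => ν))) atTop (𝓝 0) := by
  set f : ℝ → α × β → ℝ := fun σ t => σ * u t + v t with hf
  have hfm : ∀ σ, Measurable (f σ) := fun σ => (hu.const_mul σ).add hv
  have hf2 : ∀ σ, MemLp (f σ) 2 (μ.prod ν) := fun σ => (hu2.const_mul σ).add hv2
  have hf0 : ∀ σ x, ∫ y, f σ (x, y) ∂ν = 0 := fun σ x => by
    simp only [hf]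
    rw [integral_add ((hui x).const_mul σ) (hvi x), integral_const_mul, hu0, hv0]
    simp
  -- Orthogonality of u and v makes the variances of u + v and -u + v equal, so both signs lead to
  -- the same constant c.
  have hvar : ∫ t, f (-1) t ^ 2 ∂(μ.prod ν) = ∫ t, f 1 t ^ 2 ∂(μ.prod ν) := by
    have hi : Integrable (fun t => u t * v t) (μ.prod ν) := hu2.integrable_mul hv2
    have e : ∀ t, f (-1) t ^ 2 = f 1 t ^ 2 - 4 * (u t * v t) := by
      intro t
      simp only [hf]
      ring
    simp only [e]
    rw [integral_sub (hf2 1).integrable_sq (hi.const_mul 4), integral_const_mul, huv]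
    simp
  set c : ℂ := (Real.exp (-(∫ t, f 1 t ^ 2 ∂(μ.prod ν)) / 2) : ℂ) with hc
  set W : (n : ℕ) → (Fin n → α) → ℂ := fun n x =>
    Complex.exp (((√(n : ℝ))⁻¹ * ∑ i, w (x i) : ℝ) * Complex.I) with hW
  have hWm : ∀ n, Measurable (W n) := fun n => by
    simp only [hW]
    fun_prop
  have hWn : ∀ n x, ‖W n x‖ = 1 := fun n x => Complex.norm_exp_ofReal_mul_I _
  have hset : ∀ n, MeasurableSet {x | s n x = -1} := fun n => hs n (measurableSet_singleton _)
  -- The two exponentials differ only where s = -1. That indicator and the factor from w depend on x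
  -- alone and serve as Φ; on subtraction of the cases σ = ±1 the constant c cancels.
  have key : ∀ σ, (∫ t, f σ t ^ 2 ∂(μ.prod ν) = ∫ t, f 1 t ^ 2 ∂(μ.prod ν)) →
      Tendsto (fun n : ℕ => ∫ t : (Fin n → α) × (Fin n → β),
        Set.indicator {x | s n x = -1} (W n) t.1 *
        (Complex.exp (((√(n : ℝ))⁻¹ * ∑ i, f σ (t.1 i, t.2 i) : ℝ) * Complex.I) - c)
        ∂((Measure.pi fun _ => μ).prod (Measure.pi fun _ => ν))) atTop (𝓝 0) := by
    intro σ hσ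
    have := tendsto_integral_mul_cexp_sub (hfm σ) (hf2 σ) (hf0 σ)
      (Φ := fun n => Set.indicator {x | s n x = -1} (W n)) (fun n => (hWm n).indicator (hset n))
      (fun n x => (norm_indicator_le_norm_self _ _).trans (hWn n x).le)
    rwa [hσ] at this
  have hint : ∀ σ n, Integrable (fun t : (Fin n → α) × (Fin n → β) =>
      Set.indicator {x | s n x = -1} (W n) t.1 *
        (Complex.exp (((√(n : ℝ))⁻¹ * ∑ i, f σ (t.1 i, t.2 i) : ℝ) * Complex.I) - c))
      ((Measure.pi fun _ => μ).prod (Measure.pi fun _ => ν)) := by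
    intro σ n
    have := hfm σ
    refine ((integrable_cexp (f := fun t : (Fin n → α) × (Fin n → β) =>
      (√(n : ℝ))⁻¹ * ∑ i, f σ (t.1 i, t.2 i)) (by fun_prop)).sub (integrable_const c)).bdd_mul
      (((hWm n).indicator (hset n)).comp measurable_fst).aestronglyMeasurable
      (c := 1) (Eventually.of_forall fun t =>
        (norm_indicator_le_norm_self _ _).trans (hWn n t.1).le)
  have h := (key (-1) hvar).sub (key 1 rfl)
  rw [sub_zero] at h
  refine h.congr fun n => ?_
  rw [← integral_sub (hint _ n) (hint _ n)]
  refine integral_congr_ae (Eventually.of_forall fun t => ?_)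
  simp only
  by_cases hst : s n t.1 = -1
  · rw [Set.indicator_of_mem (by exact hst), hst, ← mul_sub, sub_sub_sub_cancel_right, mul_sub]
    have e : ∀ σ : ℝ, W n t.1 * Complex.exp (((√(n : ℝ))⁻¹ * ∑ i, f σ (t.1 i, t.2 i) : ℝ) *
        Complex.I) = Complex.exp (((√(n : ℝ))⁻¹ * ∑ i, (σ * u (t.1 i, t.2 i) +
          (v (t.1 i, t.2 i) + w (t.1 i))) : ℝ) * Complex.I) := by
      intro σ
      simp only [hW, ← Complex.exp_add, hf, ← add_mul, ← Complex.ofReal_add, ← mul_add,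
        ← Finset.sum_add_distrib]
      refine congrArg (fun r : ℝ => Complex.exp (r * Complex.I)) (congrArg _ ?_)
      refine Finset.sum_congr rfl fun i _ => ?_
      ring
    rw [e, e]
    simp only [one_mul]
  · have h1 : s n t.1 = 1 := (hs1 n t.1).resolve_right hst
    rw [Set.indicator_of_notMem (by exact hst), h1]
    simp

end RandomSign

/-! ### Sums with a sign determined by one component -/

section SignedSums

variable {Ω : Type*} [MeasurableSpace Ω] {P : Measure Ω} {p : ℕ} {z : ℕ → Ω → Fin p → ℝ}

/-- `f (z)` is square-integrable and centred conditionally on the component `J`. -/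
structure CondCentered (P : Measure Ω) (z : ℕ → Ω → Fin p → ℝ) (J : Fin p)
    (f : (Fin p → ℝ) → ℝ) : Prop where
  measurable : Measurable f
  memLp : MemLp (fun ω => f (z 0 ω)) 2 P
  integrable : ∀ x, Integrable (fun ω => f (Function.update (z 0 ω) J x)) P
  integral : ∀ x, ∫ ω, f (Function.update (z 0 ω) J x) ∂P = 0

namespace CondCentered

variable {J : Fin p} {f f' : (Fin p → ℝ) → ℝ}

lemma zero : CondCentered P z J (fun _ => 0) :=
  ⟨measurable_const, MemLp.zero, fun _ => integrable_zero _ _ _, fun _ => by simp⟩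

lemma const_mul (hf : CondCentered P z J f) (c : ℝ) : CondCentered P z J (fun y => c * f y) :=
  ⟨hf.measurable.const_mul c, hf.memLp.const_mul c, fun x => (hf.integrable x).const_mul c,
    fun x => by rw [integral_const_mul, hf.integral, mul_zero]⟩

lemma add (hf : CondCentered P z J f) (hf' : CondCentered P z J f') :
    CondCentered P z J (fun y => f y + f' y) :=
  ⟨hf.measurable.add hf'.measurable, hf.memLp.add hf'.memLp,
    fun x => (hf.integrable x).add (hf'.integrable x),
    fun x => by rw [integral_add (hf.integrable x) (hf'.integrable x), hf.integral, hf'.integral,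
      add_zero]⟩

lemma sum {ι : Type*} {s : Finset ι} {f : ι → (Fin p → ℝ) → ℝ}
    (hf : ∀ c ∈ s, CondCentered P z J (f c)) : CondCentered P z J (fun y => ∑ c ∈ s, f c y) := by
  classical
  induction s using Finset.induction_on with
  | empty => simpa using zero
  | insert a s ha ih =>
    simp only [Finset.sum_insert ha]
    exact (hf a (by simp)).add (ih fun c hc => hf c (by simp [hc]))

end CondCentered

namespace IsICSample

variable [IsProbabilityMeasure P]

/-- Resampling the component `J` preserves the law of the latent vector. -/
lemma measurePreserving_update (hS : IsICSample P z) (J : Fin p) :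
    MeasurePreserving (fun t : ℝ × (Fin p → ℝ) => Function.update t.2 J t.1)
      ((P.map fun ω => z 0 ω J).prod (P.map (z 0))) (P.map (z 0)) := by
  have hm : ∀ k, Measurable fun ω => z 0 ω k := fun k =>
    (measurable_pi_apply k).comp (hS.measurable 0)
  have : ∀ k, IsProbabilityMeasure (P.map fun ω => z 0 ω k) := fun k =>
    Measure.isProbabilityMeasure_map (hm k).aemeasurable
  have hν : P.map (z 0) = Measure.pi fun k => P.map fun ω => z 0 ω k :=
    (iIndepFun_iff_map_fun_eq_pi_map fun k => (hm k).aemeasurable).mp hS.iIndep_components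
  have hmeas : Measurable fun t : ℝ × (Fin p → ℝ) => Function.update t.2 J t.1 :=
    measurable_update'.comp measurable_swap
  refine ⟨hmeas, ?_⟩
  rw [hν]
  refine (Measure.pi_eq fun s hs => ?_).symm
  rw [Measure.map_apply hmeas (MeasurableSet.univ_pi hs)]
  have e : (fun t : ℝ × (Fin p → ℝ) => Function.update t.2 J t.1) ⁻¹' Set.univ.pi s =
      s J ×ˢ Set.univ.pi (Function.update s J Set.univ) := by
    ext t
    simp only [Set.mem_preimage, Set.mem_univ_pi, Set.mem_prod]
    constructor
    · intro h
      refine ⟨by simpa using h J, fun k => ?_⟩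
      by_cases hk : k = J
      · subst hk
        simp
      · simpa [hk] using h k
    · rintro ⟨h1, h2⟩ k
      by_cases hk : k = J
      · subst hk
        simpa using h1
      · simpa [hk] using h2 k
  rw [e, Measure.prod_prod, Measure.pi_pi, ← Finset.mul_prod_erase _ _ (Finset.mem_univ J),
    ← Finset.mul_prod_erase (a := J) Finset.univ (fun k => (P.map fun ω => z 0 ω k) (s k))
      (Finset.mem_univ J)]
  simp only [Function.update_self, measure_univ, one_mul]
  congr 1
  refine Finset.prod_congr rfl fun k hk => ?_
  rw [Function.update_of_ne (Finset.ne_of_mem_erase hk)]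

/-- Expectations of functions of the sample, with the component `J` separated. -/
lemma integral_comp_sample (hS : IsICSample P z) (J : Fin p) {n : ℕ}
    {Ψ : (Fin n → Fin p → ℝ) → ℂ} (hΨ : Measurable Ψ) :
    ∫ ω, Ψ (fun i => z i ω) ∂P =
      ∫ t, Ψ (fun i => Function.update (t.2 i) J (t.1 i))
        ∂((Measure.pi fun _ : Fin n => P.map fun ω => z 0 ω J).prod
          (Measure.pi fun _ : Fin n => P.map (z 0))) := by
  have hm : Measurable fun ω => z 0 ω J := (measurable_pi_apply J).comp (hS.measurable 0)
  have := Measure.isProbabilityMeasure_map (μ := P) hm.aemeasurable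
  have := Measure.isProbabilityMeasure_map (μ := P) (hS.measurable 0).aemeasurable
  have h1 : MeasurePreserving (fun ω (i : Fin n) => z i ω) P
      (Measure.pi fun _ : Fin n => P.map (z 0)) := by
    refine ⟨measurable_pi_iff.mpr fun i => hS.measurable i, ?_⟩
    rw [(iIndepFun_iff_map_fun_eq_pi_map fun i : Fin n => (hS.measurable i).aemeasurable).mp
      (hS.iIndep.precomp Fin.val_injective)]
    congr 1
    ext i : 1
    exact (hS.identDistrib i).map_eq
  -- In every observation the J-th coordinate of a full copy is overwritten by an independent draw,
  -- so the J-th column becomes a separate factor of the product measure.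
  have h2 := measurePreserving_pi (fun _ : Fin n => (P.map fun ω => z 0 ω J).prod (P.map (z 0)))
    (fun _ : Fin n => P.map (z 0)) (fun _ => hS.measurePreserving_update J)
  have h3 := (measurePreserving_arrowProdEquivProdArrow ℝ (Fin p → ℝ) (Fin n)
    (fun _ => P.map fun ω => z 0 ω J) (fun _ => P.map (z 0))).symm
  have h4 := h2.comp h3
  have e1 := integral_map (μ := P) (f := Ψ) h1.measurable.aemeasurable hΨ.aestronglyMeasurable
  have e2 := integral_map (f := Ψ) (h4.measurable.aemeasurable (μ :=
    (Measure.pi fun _ : Fin n => P.map fun ω => z 0 ω J).prod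
      (Measure.pi fun _ : Fin n => P.map (z 0)))) hΨ.aestronglyMeasurable
  rw [h1.map_eq] at e1
  rw [h4.map_eq] at e2
  exact e1.symm.trans e2

/-- Multiplying conditionally centred summands by a random sign that depends on the component `J`
does not affect asymptotic normality. -/
lemma isAsympNormal_sign (hS : IsICSample P z) {J : Fin p} {ι : Type*} [Fintype ι]
    {u v : ι → (Fin p → ℝ) → ℝ} {w : ι → ℝ → ℝ} (hu : ∀ c, CondCentered P z J (u c))
    (hv : ∀ c, CondCentered P z J (v c)) (hw : ∀ c, Measurable (w c))
    (huv : ∀ c c', ∫ ω, u c (z 0 ω) * v c' (z 0 ω) ∂P = 0)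
    {s : (n : ℕ) → (Fin n → ℝ) → ℝ} (hs : ∀ n, Measurable (s n))
    (hs1 : ∀ n x, s n x = 1 ∨ s n x = -1)
    (hY : IsAsympNormal P (fun n ω (c : ι) => (√(n : ℝ))⁻¹ *
      ∑ i : Fin n, (u c (z i ω) + (v c (z i ω) + w c (z i ω J))))) :
    IsAsympNormal P (fun n ω (c : ι) => (√(n : ℝ))⁻¹ *
      ∑ i : Fin n, (s n (fun k => z k ω J) * u c (z i ω) + (v c (z i ω) + w c (z i ω J)))) := by
  obtain ⟨ρ, hρ, hd⟩ := hY
  refine ⟨ρ, hρ, ?_⟩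
  have hm : Measurable fun ω => z 0 ω J := (measurable_pi_apply J).comp (hS.measurable 0)
  have := Measure.isProbabilityMeasure_map (μ := P) hm.aemeasurable
  have := Measure.isProbabilityMeasure_map (μ := P) (hS.measurable 0).aemeasurable
  have hzJ : ∀ i, Measurable fun ω => z i ω J := fun i =>
    (measurable_pi_apply J).comp (hS.measurable i)
  set Y : ℕ → Ω → ι → ℝ := fun n ω c => (√(n : ℝ))⁻¹ *
    ∑ i : Fin n, (u c (z i ω) + (v c (z i ω) + w c (z i ω J))) with hYdef
  set Y' : ℕ → Ω → ι → ℝ := fun n ω c => (√(n : ℝ))⁻¹ * ∑ i : Fin n,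
    (s n (fun k => z k ω J) * u c (z i ω) + (v c (z i ω) + w c (z i ω J))) with hY'def
  have hmY' : ∀ n, Measurable (Y' n) := by
    intro n
    refine measurable_pi_iff.mpr fun c => Measurable.const_mul ?_ _
    refine Finset.measurable_sum _ fun i _ => ?_
    exact (((hs n).comp (measurable_pi_iff.mpr fun k : Fin n => hzJ k)).mul
      ((hu c).measurable.comp (hS.measurable i))).add
        (((hv c).measurable.comp (hS.measurable i)).add ((hw c).comp (hzJ i)))
  -- Weak convergence is tested by characteristic functions, which need the inner product of
  -- Euclidean space.
  have hcont : Continuous (WithLp.toLp 2 : (ι → ℝ) → EuclideanSpace ℝ ι) :=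
    PiLp.continuous_toLp 2 _
  have hE := hd.continuous_comp hcont
  have hE' : TendstoInDistribution (fun n ω => (WithLp.toLp 2 (Y' n ω) : EuclideanSpace ℝ ι)) atTop
      (fun y => (WithLp.toLp 2 y : EuclideanSpace ℝ ι)) (fun _ => P) ρ := by
    refine ⟨fun n => (hcont.measurable.comp (hmY' n)).aemeasurable,
      hcont.measurable.aemeasurable, ?_⟩
    refine ProbabilityMeasure.tendsto_iff_tendsto_charFun.mpr fun t => ?_
    have h1 := ProbabilityMeasure.tendsto_iff_tendsto_charFun.mp hE.tendsto t
    have hchar : ∀ (Z : ℕ → Ω → ι → ℝ) (n : ℕ), AEMeasurable (Z n) P →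
        charFun (P.map fun ω => (WithLp.toLp 2 (Z n ω) : EuclideanSpace ℝ ι)) t =
          ∫ ω, Complex.exp ((∑ c, t c * Z n ω c : ℝ) * Complex.I) ∂P := by
      intro Z n hZ
      have hZ' : AEMeasurable (fun ω => (WithLp.toLp 2 (Z n ω) : EuclideanSpace ℝ ι)) P :=
        hcont.measurable.comp_aemeasurable hZ
      rw [charFun_apply, integral_map hZ' (Continuous.aestronglyMeasurable (by fun_prop))]
      refine integral_congr_ae (Eventually.of_forall fun ω => ?_)
      simp [PiLp.inner_apply]
    -- Cramér–Wold: for fixed t the vector collapses to scalar summands, and centring and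
    -- orthogonality pass to the combinations.
    set U : (Fin p → ℝ) → ℝ := fun y => ∑ c, t c * u c y with hU
    set V : (Fin p → ℝ) → ℝ := fun y => ∑ c, t c * v c y with hV
    set W : ℝ → ℝ := fun x => ∑ c, t c * w c x with hW
    have hUc : CondCentered P z J U := CondCentered.sum fun c _ => (hu c).const_mul (t c)
    have hVc : CondCentered P z J V := CondCentered.sum fun c _ => (hv c).const_mul (t c)
    have hWm : Measurable W := Finset.measurable_sum _ fun c _ => (hw c).const_mul (t c)
    have hUV : ∫ ω, U (z 0 ω) * V (z 0 ω) ∂P = 0 := by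
      have hint : ∀ c c', Integrable (fun ω => u c (z 0 ω) * v c' (z 0 ω)) P := fun c c' =>
        (hu c).memLp.integrable_mul (hv c').memLp
      have e : ∀ ω, U (z 0 ω) * V (z 0 ω) =
          ∑ c, ∑ c', t c * t c' * (u c (z 0 ω) * v c' (z 0 ω)) := by
        intro ω
        simp only [hU, hV, Finset.sum_mul_sum]
        refine Finset.sum_congr rfl fun c _ => Finset.sum_congr rfl fun c' _ => ?_
        ring
      simp only [e]
      rw [integral_finsetSum _ fun c _ => integrable_finsetSum _ fun c' _ =>
        (hint c c').const_mul _]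
      refine Finset.sum_eq_zero fun c _ => ?_
      rw [integral_finsetSum _ fun c' _ => (hint c c').const_mul _]
      refine Finset.sum_eq_zero fun c' _ => ?_
      rw [integral_const_mul, huv, mul_zero]
    have hup := hS.measurePreserving_update J
    have hmz := (hS.measurable 0).aemeasurable (μ := P)
    have hL : ∀ {f : (Fin p → ℝ) → ℝ}, CondCentered P z J f →
        MemLp (fun r : ℝ × (Fin p → ℝ) => f (Function.update r.2 J r.1)) 2
          ((P.map fun ω => z 0 ω J).prod (P.map (z 0))) := fun hf =>
      ((memLp_map_measure_iff hf.measurable.aestronglyMeasurable hmz).mpr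
        hf.memLp).comp_measurePreserving hup
    have hI : ∀ {f : (Fin p → ℝ) → ℝ}, CondCentered P z J f → ∀ x,
        Integrable (fun y => f (Function.update y J x)) (P.map (z 0)) := fun hf x =>
      (integrable_map_measure (hf.measurable.comp measurable_update_left).aestronglyMeasurable
        hmz).mpr (hf.integrable x)
    have h0 : ∀ {f : (Fin p → ℝ) → ℝ}, CondCentered P z J f → ∀ x,
        ∫ y, f (Function.update y J x) ∂(P.map (z 0)) = 0 := fun hf x =>
      (integral_map hmz (hf.measurable.comp measurable_update_left).aestronglyMeasurable).trans
        (hf.integral x)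
    have key := tendsto_integral_cexp_sign (μ := P.map fun ω => z 0 ω J) (ν := P.map (z 0))
      (u := fun r => U (Function.update r.2 J r.1)) (v := fun r => V (Function.update r.2 J r.1))
      (hUc.measurable.comp hup.measurable) (hVc.measurable.comp hup.measurable) hWm
      (hL hUc) (hL hVc) (h0 hUc) (hI hUc) (hI hVc) (h0 hVc)
      (by
        have e1 := integral_map (f := fun y => U y * V y) hmz
          (hUc.measurable.mul hVc.measurable).aestronglyMeasurable
        have e2 := integral_map (f := fun y => U y * V y) (hup.measurable.aemeasurable
          (μ := (P.map fun ω => z 0 ω J).prod (P.map (z 0))))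
          (hUc.measurable.mul hVc.measurable).aestronglyMeasurable
        rw [hup.map_eq, e1, hUV] at e2
        exact e2.symm) hs hs1
    have hUm := hUc.measurable
    have hVm := hVc.measurable
    have hsm : ∀ n : ℕ, Measurable fun y : Fin n → Fin p → ℝ => s n fun k => y k J := fun n =>
      (hs n).comp (measurable_pi_iff.mpr fun k =>
        (measurable_pi_apply J).comp (measurable_pi_apply k))
    have hF' : ∀ n : ℕ, Measurable fun y : Fin n → Fin p → ℝ => (√(n : ℝ))⁻¹ *
        ∑ i, (s n (fun k => y k J) * U (y i) + (V (y i) + W (y i J))) := fun n => by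
      have := hsm n
      fun_prop
    have hF : ∀ n : ℕ, Measurable fun y : Fin n → Fin p → ℝ => (√(n : ℝ))⁻¹ *
        ∑ i, (U (y i) + (V (y i) + W (y i J))) := fun n => by fun_prop
    have htr : ∀ n : ℕ, ∫ ω, (Complex.exp ((∑ c, t c * Y' n ω c : ℝ) * Complex.I) -
        Complex.exp ((∑ c, t c * Y n ω c : ℝ) * Complex.I)) ∂P = _ := fun n => by
      have e' : ∀ ω, ∑ c, t c * Y' n ω c = (√(n : ℝ))⁻¹ *
          ∑ i : Fin n, (s n (fun k => z k ω J) * U (z i ω) + (V (z i ω) + W (z i ω J))) := by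
        intro ω
        simp only [hY'def, hU, hV, hW, Finset.mul_sum, ← Finset.sum_add_distrib]
        rw [Finset.sum_comm]
        refine Finset.sum_congr rfl fun i _ => Finset.sum_congr rfl fun c _ => ?_
        ring
      have e : ∀ ω, ∑ c, t c * Y n ω c = (√(n : ℝ))⁻¹ *
          ∑ i : Fin n, (U (z i ω) + (V (z i ω) + W (z i ω J))) := by
        intro ω
        simp only [hYdef, hU, hV, hW, Finset.mul_sum, ← Finset.sum_add_distrib]
        rw [Finset.sum_comm]
        refine Finset.sum_congr rfl fun i _ => Finset.sum_congr rfl fun c _ => ?_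
        ring
      simp only [e, e']
      exact hS.integral_comp_sample J (n := n) (Ψ := fun y =>
        Complex.exp (((√(n : ℝ))⁻¹ * ∑ i, (s n (fun k => y k J) * U (y i) +
          (V (y i) + W (y i J))) : ℝ) * Complex.I) -
        Complex.exp (((√(n : ℝ))⁻¹ * ∑ i, (U (y i) + (V (y i) + W (y i J))) : ℝ) * Complex.I))
        (by
          have := hF n
          have := hF' n
          fun_prop)
    have h2 : Tendsto (fun n : ℕ => ∫ ω, (Complex.exp ((∑ c, t c * Y' n ω c : ℝ) * Complex.I) -
        Complex.exp ((∑ c, t c * Y n ω c : ℝ) * Complex.I)) ∂P) atTop (𝓝 0) := by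
      refine key.congr fun n => ?_
      rw [htr]
      simp only [Function.update_self]
    have h3 := h2.add h1
    rw [zero_add] at h3
    refine h3.congr fun n => ?_
    have i1 : Integrable (fun ω => Complex.exp ((∑ c, t c * Y' n ω c : ℝ) * Complex.I)) P := by
      refine integrable_cexp ?_
      exact Finset.measurable_sum _ fun c _ =>
        ((measurable_pi_apply c).comp (hmY' n)).const_mul _
    have hmY : Measurable (Y n) := by
      refine measurable_pi_iff.mpr fun c => Measurable.const_mul ?_ _
      refine Finset.measurable_sum _ fun i _ => ?_
      exact ((hu c).measurable.comp (hS.measurable i)).add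
        (((hv c).measurable.comp (hS.measurable i)).add ((hw c).comp (hzJ i)))
    have i2 : Integrable (fun ω => Complex.exp ((∑ c, t c * Y n ω c : ℝ) * Complex.I)) P := by
      refine integrable_cexp ?_
      exact Finset.measurable_sum _ fun c _ => ((measurable_pi_apply c).comp hmY).const_mul _
    rw [integral_sub i1 i2, ← hchar Y' n (hmY' n).aemeasurable, ← hchar Y n hmY.aemeasurable]
    simp only [ProbabilityMeasure.coe_mk]
    exact sub_add_cancel _ _
  exact hE'.continuous_comp (PiLp.continuous_ofLp 2 _)

end IsICSample

end SignedSums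

/-! ### Influence functions of the symmetric equations -/

namespace Model

variable {Ω : Type*} [MeasurableSpace Ω] {P : Measure Ω} {p : ℕ} {G : ℝ → ℝ}
  {z : ℕ → Ω → Fin p → ℝ} {m : Fin p → ℝ} {κ : Fin p → Fin p → ℝ}

lemma memLp_mul (hM : Model P G z) {j l : Fin p} (h : j ≠ l) {φ : ℝ → ℝ} (hφ : Measurable φ)
    (hφ2 : MemLp (fun ω => φ (z 0 ω j)) 2 P) :
    MemLp (fun ω => φ (z 0 ω j) * z 0 ω l) 2 P := by
  have hj := hM.measurable_comp j
  have hl := hM.measurable_comp l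
  rw [memLp_two_iff_integrable_sq (Measurable.aestronglyMeasurable (by fun_prop))]
  have h1 := (hM.indepFun_comp h (φ := fun x => φ x ^ 2) (ψ := fun x => x ^ 2) (by fun_prop)
    (by fun_prop)).integrable_mul hφ2.integrable_sq (hM.memLp l).integrable_sq
  refine h1.congr (Eventually.of_forall fun ω => ?_)
  simp only [Pi.mul_apply]
  ring

/-- The function `g - μ_j - c id`. -/
def score (P : Measure Ω) (G : ℝ → ℝ) (z : ℕ → Ω → Fin p → ℝ) (j : Fin p) (c x : ℝ) : ℝ :=
  deriv G x - mu P G (z 0) j - c * x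

lemma measurable_score (hM : Model P G z) (j : Fin p) (c : ℝ) :
    Measurable (score P G z j c) := by
  have := hM.continuous_g.measurable
  unfold score
  fun_prop

/-- Conditionally centred functions orthogonal to the products of the score of the component `J`
with the other components. -/
structure OrthCentered (P : Measure Ω) (G : ℝ → ℝ) (z : ℕ → Ω → Fin p → ℝ) (J : Fin p)
    (f : (Fin p → ℝ) → ℝ) : Prop where
  centered : CondCentered P z J f
  orth : ∀ k, k ≠ J →
    ∫ ω, score P G z J (lam P G (z 0) J) (z 0 ω J) * z 0 ω k * f (z 0 ω) ∂P = 0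

lemma OrthCentered.zero {J : Fin p} : OrthCentered P G z J (fun _ => 0) :=
  ⟨CondCentered.zero, fun _ _ => by simp⟩

lemma OrthCentered.const_mul {J : Fin p} {f : (Fin p → ℝ) → ℝ} (hf : OrthCentered P G z J f)
    (c : ℝ) : OrthCentered P G z J (fun y => c * f y) := by
  refine ⟨hf.centered.const_mul c, fun k hk => ?_⟩
  simp only [mul_left_comm _ c]
  rw [integral_const_mul, hf.orth k hk, mul_zero]

lemma empMean_score_mul (q : ℕ × Ω) (j l : Fin p) (c : ℝ) :
    empMean z (fun y => score P G z j c (y j) * y l) q =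
      oracleT P G z q.1 j q.2 l - c * empMean z (fun y => y j * y l) q := by
  rw [oracleT_eq, zbar, ← empMean_const_mul, ← empMean_sub, ← empMean_const_mul, ← empMean_sub]
  congr 1
  ext y
  unfold score
  ring

lemma sqrt_mul_inv (n : ℕ) : √(n : ℝ) * (n : ℝ)⁻¹ = (√(n : ℝ))⁻¹ := by
  rw [← div_eq_mul_inv, Real.sqrt_div_self]

variable [IsProbabilityMeasure P]

/-- Separation of the component `J` in expectations. -/
lemma integral_mul_of_update (hM : Model P G z) {J : Fin p} {ψ : ℝ → ℝ} {Θ : (Fin p → ℝ) → ℝ}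
    (hψ : Measurable ψ) (hΘ : Measurable Θ) (h : ∀ y x, Θ (Function.update y J x) = Θ y) :
    ∫ ω, ψ (z 0 ω J) * Θ (z 0 ω) ∂P = (∫ ω, ψ (z 0 ω J) ∂P) * ∫ ω, Θ (z 0 ω) ∂P := by
  have hmz := (hM.sample.measurable 0).aemeasurable (μ := P)
  have hmJ := (hM.measurable_comp J).aemeasurable (μ := P)
  have := Measure.isProbabilityMeasure_map hmz
  have := Measure.isProbabilityMeasure_map hmJ
  have hup := hM.sample.measurePreserving_update J
  have hf : Measurable fun y : Fin p → ℝ => ψ (y J) * Θ y := by fun_prop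
  have e1 := integral_map (f := fun y : Fin p → ℝ => ψ (y J) * Θ y) hmz hf.aestronglyMeasurable
  have e2 := integral_map (f := fun y : Fin p → ℝ => ψ (y J) * Θ y)
    (hup.measurable.aemeasurable (μ := (P.map fun ω => z 0 ω J).prod (P.map (z 0))))
    hf.aestronglyMeasurable
  rw [hup.map_eq, e1] at e2
  simp only [Function.update_self, h] at e2
  rw [e2, integral_prod_mul ψ Θ, integral_map hmJ hψ.aestronglyMeasurable,
    integral_map hmz hΘ.aestronglyMeasurable]

/-- Fixing the component J touches at most one of the two factors; the other remains centred and
independent of it. -/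
lemma condCentered_mul (hM : Model P G z) (J : Fin p) {j l : Fin p} (h : j ≠ l) {φ : ℝ → ℝ}
    (hφ : Measurable φ) (hφ2 : MemLp (fun ω => φ (z 0 ω j)) 2 P)
    (h0 : ∫ ω, φ (z 0 ω j) ∂P = 0) : CondCentered P z J (fun y => φ (y j) * y l) := by
  refine ⟨by fun_prop, hM.memLp_mul h hφ hφ2, fun x => ?_, fun x => ?_⟩
  · by_cases hj : j = J
    · subst hj
      simpa [Function.update_of_ne h.symm] using
        ((hM.memLp l).integrable one_le_two).const_mul (φ x)
    · by_cases hl : l = J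
      · subst hl
        simpa [Function.update_of_ne h] using (hφ2.integrable one_le_two).mul_const x
      · simpa [Function.update_of_ne hj, Function.update_of_ne hl] using
          (hM.memLp_mul h hφ hφ2).integrable one_le_two
  · by_cases hj : j = J
    · subst hj
      simp [Function.update_of_ne h.symm, integral_const_mul, hM.integral_eq_zero]
    · by_cases hl : l = J
      · subst hl
        simp [Function.update_of_ne h, integral_mul_const, h0]
      · simp only [Function.update_of_ne hj, Function.update_of_ne hl]
        rw [hM.integral_mul h hφ measurable_id', h0, zero_mul]

lemma condCentered_sq (hM : Model P G z) {j J : Fin p} (h : j ≠ J) :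
    CondCentered P z J (fun y => y j ^ 2 - 1) := by
  have hj := hM.measurable_comp j
  have h2 : MemLp (fun ω => z 0 ω j ^ 2 - 1) 2 P := by
    refine MemLp.sub ?_ (memLp_const 1)
    rw [memLp_two_iff_integrable_sq (Measurable.aestronglyMeasurable (by fun_prop))]
    refine (hM.moments.fourth j).congr (Eventually.of_forall fun ω => ?_)
    simp only
    ring
  refine ⟨by fun_prop, h2, fun x => ?_, fun x => ?_⟩
  · simpa only [Function.update_of_ne h] using h2.integrable one_le_two
  · simp only [Function.update_of_ne h]
    rw [integral_sub (hM.memLp j).integrable_sq (integrable_const _), hM.integral_sq]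
    simp

lemma memLp_score (hM : Model P G z) (j : Fin p) (c : ℝ) :
    MemLp (fun ω => score P G z j c (z 0 ω j)) 2 P :=
  ((hM.moments.memLp_g j).sub (memLp_const _)).sub ((hM.memLp j).const_mul c)

lemma integral_score (hM : Model P G z) (j : Fin p) (c : ℝ) :
    ∫ ω, score P G z j c (z 0 ω j) ∂P = 0 := by
  have h1 := (hM.moments.memLp_g j).integrable one_le_two
  have h2 := (hM.memLp j).integrable one_le_two
  have h3 : Integrable (fun ω => deriv G (z 0 ω j) - mu P G (z 0) j) P :=
    h1.sub (integrable_const _)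
  unfold score
  rw [integral_sub h3 (h2.const_mul c), integral_sub h1 (integrable_const _), integral_const_mul,
    hM.integral_eq_zero]
  simp [mu]

/-- The slope λ_j is the least-squares coefficient of g(z_j) on z_j, so subtracting it leaves a
residual uncorrelated with z_j. -/
lemma integral_score_mul (hM : Model P G z) (j : Fin p) :
    ∫ ω, score P G z j (lam P G (z 0) j) (z 0 ω j) * z 0 ω j ∂P = 0 := by
  have h1 := hM.moments.g_mul j
  have h2 := (hM.memLp j).integrable one_le_two
  have h3 := (hM.memLp j).integrable_sq
  have e : ∀ ω, score P G z j (lam P G (z 0) j) (z 0 ω j) * z 0 ω j =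
      deriv G (z 0 ω j) * z 0 ω j - mu P G (z 0) j * z 0 ω j -
        lam P G (z 0) j * z 0 ω j ^ 2 := by
    intro ω
    unfold score
    ring
  have h4 : Integrable (fun ω => deriv G (z 0 ω j) * z 0 ω j - mu P G (z 0) j * z 0 ω j) P :=
    h1.sub (h2.const_mul _)
  simp only [e]
  rw [integral_sub h4 (h3.const_mul _), integral_sub h1 (h2.const_mul _), integral_const_mul,
    integral_const_mul, hM.integral_eq_zero, hM.integral_sq]
  simp [lam]

lemma OrthCentered.add (hM : Model P G z) {J : Fin p} {f f' : (Fin p → ℝ) → ℝ}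
    (hf : OrthCentered P G z J f) (hf' : OrthCentered P G z J f') :
    OrthCentered P G z J (fun y => f y + f' y) := by
  refine ⟨hf.centered.add hf'.centered, fun k hk => ?_⟩
  have h := hM.memLp_mul hk.symm (hM.measurable_score J (lam P G (z 0) J))
    (hM.memLp_score J (lam P G (z 0) J))
  simp only [mul_add]
  have h1 : Integrable (fun ω => score P G z J (lam P G (z 0) J) (z 0 ω J) * z 0 ω k *
      f (z 0 ω)) P := h.integrable_mul hf.centered.memLp
  have h2 : Integrable (fun ω => score P G z J (lam P G (z 0) J) (z 0 ω J) * z 0 ω k *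
      f' (z 0 ω)) P := h.integrable_mul hf'.centered.memLp
  rw [integral_add h1 h2, hf.orth k hk, hf'.orth k hk, add_zero]

lemma orthCentered_sq (hM : Model P G z) {j J : Fin p} (h : j ≠ J) :
    OrthCentered P G z J (fun y => y j ^ 2 - 1) := by
  refine ⟨hM.condCentered_sq h, fun k hk => ?_⟩
  have := hM.integral_mul_of_update (J := J) (hM.measurable_score J (lam P G (z 0) J))
    (Θ := fun y => y k * (y j ^ 2 - 1)) (by fun_prop) (fun y x => by
      simp [Function.update_of_ne hk, Function.update_of_ne h])
  rw [hM.integral_score, zero_mul] at this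
  simpa only [mul_assoc] using this

/-- The factor depending on z_J is the score of J times z_J if l = J, and that score alone
otherwise. Both have mean zero, the first by the choice of the slope λ_J. -/
lemma orthCentered_score_mul (hM : Model P G z) {j l J : Fin p} (h : j ≠ l) (hj : j ≠ J) (c : ℝ) :
    OrthCentered P G z J (fun y => score P G z j c (y j) * y l) := by
  refine ⟨hM.condCentered_mul J h (hM.measurable_score j c) (hM.memLp_score j c)
    (hM.integral_score j c), fun k hk => ?_⟩
  have hm := hM.measurable_score j c
  have hmJ := hM.measurable_score J (lam P G (z 0) J)
  by_cases hl : l = J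
  · subst hl
    have := hM.integral_mul_of_update (J := l)
      (ψ := fun x => score P G z l (lam P G (z 0) l) x * x) (by fun_prop)
      (Θ := fun y => y k * score P G z j c (y j)) (by fun_prop) (fun y x => by
        simp [Function.update_of_ne hk, Function.update_of_ne hj])
    rw [hM.integral_score_mul, zero_mul] at this
    rw [← this]
    congr 1
    ext ω
    ring
  · have := hM.integral_mul_of_update (J := J) hmJ
      (Θ := fun y => y k * (score P G z j c (y j) * y l)) (by fun_prop) (fun y x => by
        simp [Function.update_of_ne hk, Function.update_of_ne hj, Function.update_of_ne hl])
    rw [hM.integral_score, zero_mul] at this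
    simpa only [mul_assoc] using this

/-- The influence function of the symmetric estimator with signs `σ`. -/
def influence (P : Measure Ω) (G : ℝ → ℝ) (z : ℕ → Ω → Fin p → ℝ) (κ : Fin p → Fin p → ℝ)
    (σ : Fin p → ℝ) (j l : Fin p) (y : Fin p → ℝ) : ℝ :=
  if j = l then -(1 / 2) * (y j ^ 2 - 1)
  else (κ j l)⁻¹ * (σ l * (score P G z l (del P G (z 0) l) (y l) * y j) -
    σ j * (score P G z j (lam P G (z 0) j) (y j) * y l))

/-- The leading term as a normalized sum. -/
lemma tendsto_leadStat_add_empMean (hM : Model P G z) {σ : ℕ × Ω → Fin p → ℝ}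
    (hσ : ∀ q k, |σ q k| ≤ 1) (j l : Fin p) :
    Tendsto (fun q => leadStat P G z m κ (fun q j _ => σ q j) q j l +
      √(q.1 : ℝ) * empMean z (influence P G z κ (σ q) j l) q) (whp P) (𝓝 0) := by
  -- The centring of the sample covariance contributes √n z̄_j z̄_l, which is negligible.
  have hz0 : Tendsto (fun q => zbar z q j * (√(q.1 : ℝ) * zbar z q l)) (whp P) (𝓝 0) :=
    hM.stochBdd_zbar l _ (hM.tendsto_zbar j)
  by_cases hjl : j = l
  · subst hjl
    have h := hz0.const_mul (-(1 / 2) : ℝ)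
    rw [mul_zero] at h
    refine h.congr' ?_
    filter_upwards [eventually_whp_of_atTop (P := P) (eventually_ne_atTop 0)] with q hq
    have e : empMean z (influence P G z κ (σ q) j j) q =
        -(1 / 2) * (empMean z (fun y => y j * y j) q - 1) := by
      have e' : influence P G z κ (σ q) j j = fun y => -(1 / 2) * (y j * y j - 1) := by
        ext y
        simp only [influence, if_true]
        ring
      rw [e', empMean_const_mul, empMean_sub, empMean_one hq]
    rw [leadStat_self, e, constraint_idArr, Matrix.sub_apply, Matrix.one_apply_eq, sampleCov_obs]
    ring
  · have hb : (fun q => (κ j l)⁻¹ * (σ q j * lam P G (z 0) j - σ q l * del P G (z 0) l))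
        =O[whp P] (fun _ => (1 : ℝ)) := by
      have h1 : ∀ k, (fun q => σ q k) =O[whp P] (fun _ => (1 : ℝ)) := fun k =>
        IsBigO.of_bound 1 (Eventually.of_forall fun q => by simpa using hσ q k)
      refine IsBigO.const_mul_left (IsBigO.sub ?_ ?_) _
      · simpa [mul_comm] using (h1 j).const_mul_left (lam P G (z 0) j)
      · simpa [mul_comm] using (h1 l).const_mul_left (del P G (z 0) l)
    have h := (hb.mul (isBigO_refl (fun q => zbar z q j * (√(q.1 : ℝ) * zbar z q l))
      (whp P))).trans_tendsto (by simpa using hz0)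
    refine h.congr fun q => ?_
    have e : empMean z (influence P G z κ (σ q) j l) q = (κ j l)⁻¹ *
        (σ q l * empMean z (fun y => score P G z l (del P G (z 0) l) (y l) * y j) q -
          σ q j * empMean z (fun y => score P G z j (lam P G (z 0) j) (y j) * y l) q) := by
      rw [← empMean_const_mul, ← empMean_const_mul, ← empMean_sub, ← empMean_const_mul]
      congr 1
      ext y
      simp only [influence, if_neg hjl]
    rw [leadStat_of_ne q hjl, e, empMean_score_mul, empMean_score_mul, constraint_idArr,
      Matrix.sub_apply, Matrix.one_apply_ne hjl, sampleCov_obs]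
    simp only [mul_comm (_ : ℝ) (_ : ℝ)]
    ring

end Model

/-! ### Signs of the empirical contrasts -/

namespace Model

variable {Ω : Type*} [MeasurableSpace Ω] {P : Measure Ω} {p : ℕ} {G : ℝ → ℝ}
  {z : ℕ → Ω → Fin p → ℝ} {m : Fin p → ℝ}

/-- The first-order term of the empirical contrast of the component `j`. -/
def contrastResid (P : Measure Ω) (G : ℝ → ℝ) (z : ℕ → Ω → Fin p → ℝ) (j : Fin p) (x : ℝ) : ℝ :=
  G x - mu P G (z 0) j * x - lam P G (z 0) j / 2 * (x ^ 2 - 1)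

/-- The sign of a sum of values of `h`, with value one at zero. -/
def sumSign (h : ℝ → ℝ) (n : ℕ) (x : Fin n → ℝ) : ℝ := if 0 ≤ ∑ i, h (x i) then 1 else -1

/-- The asymptotic signs of the empirical contrasts. -/
def refSign (P : Measure Ω) (G : ℝ → ℝ) (z : ℕ → Ω → Fin p → ℝ) (m : Fin p → ℝ) (n : ℕ)
    (x : Fin n → Fin p → ℝ) (j : Fin p) : ℝ :=
  if nu P G (z 0) j = 0 then sumSign (contrastResid P G z j) n (fun i => x i j - m j)
  else Real.sign (nu P G (z 0) j)

/-- The coefficients of the linearized symmetric equations. -/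
def symKappa (P : Measure Ω) (G : ℝ → ℝ) (z : ℕ → Ω → Fin p → ℝ) : Fin p → Fin p → ℝ :=
  kappa (lam P G (z 0)) (del P G (z 0)) (fun j _ => Real.sign (nu P G (z 0) j))

lemma sumSign_eq_or (h : ℝ → ℝ) (n : ℕ) (x : Fin n → ℝ) :
    sumSign h n x = 1 ∨ sumSign h n x = -1 := by
  unfold sumSign
  split_ifs <;> simp

lemma measurable_sumSign {h : ℝ → ℝ} (hh : Measurable h) (n : ℕ) : Measurable (sumSign h n) := by
  unfold sumSign
  refine Measurable.ite ?_ measurable_const measurable_const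
  exact measurableSet_le measurable_const (by fun_prop)

lemma measurable_contrastResid (hM : Model P G z) (j : Fin p) :
    Measurable (contrastResid P G z j) := by
  have := hM.continuous_contrast.measurable
  unfold contrastResid
  fun_prop

lemma abs_sign_le (x : ℝ) : |Real.sign x| ≤ 1 := by
  rcases Real.sign_apply_eq x with h | h | h <;> simp [h]

lemma abs_refSign_le (n : ℕ) (x : Fin n → Fin p → ℝ) (j : Fin p) :
    |refSign P G z m n x j| ≤ 1 := by
  unfold refSign
  split_ifs
  · rcases sumSign_eq_or (contrastResid P G z j) n (fun i => x i j - m j) with h | h <;> simp [h]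
  · exact abs_sign_le _

lemma measurable_refSign (hM : Model P G z) (n : ℕ) (j : Fin p) :
    Measurable fun x => refSign P G z m n x j := by
  unfold refSign
  split_ifs
  · refine (measurable_sumSign (hM.measurable_contrastResid j) n).comp ?_
    fun_prop
  · exact measurable_const

lemma refSign_obs (q : ℕ × Ω) {j : Fin p} (h : nu P G (z 0) j = 0) :
    refSign P G z m q.1 (obs m z q) j =
      sumSign (contrastResid P G z j) q.1 (fun i => z i q.2 j) := by
  simp [refSign, h, obs, firstObs, icObs]

lemma eventually_sign_eq_of_tendsto {Q : Type*} {L : Filter Q} {f : Q → ℝ} {a : ℝ} (ha : a ≠ 0)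
    (hf : Tendsto f L (𝓝 a)) : ∀ᶠ q in L, Real.sign (f q) = Real.sign a := by
  rcases lt_or_gt_of_ne ha with h | h
  · filter_upwards [hf.eventually (gt_mem_nhds h)] with q hq
    rw [Real.sign_of_neg hq, Real.sign_of_neg h]
  · filter_upwards [hf.eventually (lt_mem_nhds h)] with q hq
    rw [Real.sign_of_pos hq, Real.sign_of_pos h]

/-- A perturbation smaller than the sum cannot change its sign. The strict inequality excludes a
zero sum, so the convention of `sumSign` at zero is harmless. -/
lemma sign_eq_sumSign {h : ℝ → ℝ} {n : ℕ} {x : Fin n → ℝ} {c r : ℝ} (hc : 0 < c)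
    (hr : |r - c * ∑ i, h (x i)| < |c * ∑ i, h (x i)|) : Real.sign r = sumSign h n x := by
  unfold sumSign
  split_ifs with h0
  · have h1 : 0 ≤ c * ∑ i, h (x i) := by positivity
    rw [abs_of_nonneg h1, abs_lt] at hr
    exact Real.sign_of_pos (by linarith [hr.1])
  · have h1 : c * ∑ i, h (x i) < 0 := mul_neg_of_pos_of_neg hc (not_le.mp h0)
    rw [abs_of_neg h1, abs_lt] at hr
    exact Real.sign_of_neg (by linarith [hr.2])

variable [IsProbabilityMeasure P]

lemma integral_contrastResid (hM : Model P G z) {j : Fin p} (h : nu P G (z 0) j = 0) :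
    ∫ ω, contrastResid P G z j (z 0 ω j) ∂P = 0 := by
  have h1 := hM.moments.contrast j
  have h2 := (hM.memLp j).integrable one_le_two
  have h3 : Integrable (fun ω => z 0 ω j ^ 2 - 1) P :=
    (hM.memLp j).integrable_sq.sub (integrable_const _)
  have h4 : Integrable (fun ω => G (z 0 ω j) - mu P G (z 0) j * z 0 ω j) P :=
    h1.sub (h2.const_mul _)
  unfold contrastResid
  rw [integral_sub h4 (h3.const_mul _), integral_sub h1 (h2.const_mul _), integral_const_mul,
    integral_const_mul, integral_sub (hM.memLp j).integrable_sq (integrable_const _),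
    hM.integral_eq_zero, hM.integral_sq]
  change nu P G (z 0) j - _ - _ = 0
  simp [h]

/-- The signs of the empirical contrasts at estimators converging at the rate `√n`. -/
lemma eventually_sign_eq (hM : Model P G z)
    (hdeg : ∀ j, nu P G (z 0) j = 0 → ¬ ∀ᵐ ω ∂P, contrastResid P G z j (z 0 ω j) = 0)
    {Γ : ℕ × Ω → Fin p → Fin p → ℝ} (hΓ : Tendsto Γ (whp P) (𝓝 (idArr p)))
    (hbdd : StochBdd P (fun q => ‖√(q.1 : ℝ) • (Γ q - idArr p)‖)) (j : Fin p)
    (hC : ∀ᶠ q in whp P, constraint (obs m z q) (Γ q) j j = 0) :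
    ∀ᶠ q in whp P, Real.sign (sampleG G (obs m z q) (Γ q j)) =
      refSign P G z m q.1 (obs m z q) j := by
  obtain ⟨D, hD, hDe⟩ := hM.hasSDeriv_sampleG m j
  by_cases hν : nu P G (z 0) j = 0
  · have hs : (fun q : ℕ × Ω => √(q.1 : ℝ)) =O[whp P] (fun q => √(q.1 : ℝ)) := isBigO_refl _ _
    -- Here Ĝ(Γ_j) - Ĝ(e_j) ≈ λ_j(Γ_jj - 1), and the constraint in `d2` gives 2(Γ_jj - 1) ≈ -(Ŝ_jj -
    -- 1). Eliminating Γ_jj - 1 produces the quadratic term of `contrastResid`.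
    have d1 := hbdd.tendsto_of_isLittleO
      (hs.smul_isLittleO (hD.isLittleO_eval hΓ tendsto_const_nhds)).norm_right
    have d2 := hbdd.tendsto_of_isLittleO (hs.smul_isLittleO
      ((hM.hasSDeriv_constraint m j j).isLittleO_eval hΓ tendsto_const_nhds)).norm_right
    have d3 : Tendsto (fun q => zbar z q j * (√(q.1 : ℝ) * zbar z q j)) (whp P) (𝓝 0) :=
      hM.stochBdd_zbar j _ (hM.tendsto_zbar j)
    have d4 := ((d1.add (hM.tendsto_sqrt_mul_sampleG_sub m j)).sub
      (d2.const_mul (lam P G (z 0) j / 2))).add (d3.const_mul (lam P G (z 0) j / 2))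
    simp only [mul_zero, add_zero, sub_zero] at d4
    have hmj := hM.measurable_contrastResid j
    have hmz : ∀ i, Measurable fun ω => z i ω j := fun i =>
      (measurable_pi_apply j).comp (hM.sample.measurable i)
    -- Square integrability of G(z_j) is not assumed, so the sum is kept away from zero by
    -- anticoncentration and not by a central limit theorem.
    have hev := eventually_abs_lt_of_tendsto_zero (P := P)
      (X := fun i ω => contrastResid P G z j (z i ω j)) (fun i => hmj.comp (hmz i))
      (hM.sample.iIndep.comp (fun _ y => contrastResid P G z j (y j)) (fun _ => by fun_prop))
      (fun i => (hM.sample.identDistrib i).comp (u := fun y : Fin p → ℝ => contrastResid P G z j (y j))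
        (by fun_prop))
      (by
        -- The residual has mean zero, so an almost sure constant value would be zero, contrary to
        -- `hdeg`.
        rintro ⟨c, hc⟩
        refine hdeg j hν ?_
        have h1 := hM.integral_contrastResid hν
        rw [integral_congr_ae hc] at h1
        simp only [integral_const, probReal_univ, one_smul] at h1
        rwa [h1] at hc) d4
    filter_upwards [hev, hC, eventually_whp_of_atTop (P := P) (eventually_gt_atTop 0)]
      with q h1 h2 hq
    have hq' : (q.1 : ℝ) ≠ 0 := by positivity
    have hsq : 0 < √(q.1 : ℝ) := by positivity
    have key : √(q.1 : ℝ) * empMean z (fun y => contrastResid P G z j (y j)) q =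
        √(q.1 : ℝ) * (empMean z (fun y => G (y j)) q - mu P G (z 0) j * zbar z q j -
          lam P G (z 0) j / 2 * (empMean z (fun y => y j * y j) q - 1)) := by
      have e : (fun y : Fin p → ℝ => contrastResid P G z j (y j)) = fun y =>
          G (y j) - mu P G (z 0) j * y j - lam P G (z 0) j / 2 * (y j * y j - 1) := by
        ext y
        unfold contrastResid
        ring
      rw [e, empMean_sub, empMean_sub, empMean_const_mul, empMean_const_mul, empMean_sub,
        empMean_one hq.ne']
      rfl
    have hsum : √(q.1 : ℝ) * empMean z (fun y => contrastResid P G z j (y j)) q =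
        (√(q.1 : ℝ))⁻¹ * ∑ i : Fin q.1, contrastResid P G z j (z i q.2 j) := by
      rw [empMean, ← mul_assoc, sqrt_mul_inv,
        Fin.sum_univ_eq_sum_range (fun i => contrastResid P G z j (z i q.2 j)) q.1]
    rw [← Fin.sum_univ_eq_sum_range (fun i => contrastResid P G z j (z i q.2 j)) q.1, ← hsum]
      at h1
    rw [refSign_obs q hν]
    have hpos : 0 < (√(q.1 : ℝ))⁻¹ := by positivity
    have hscale : Real.sign (sampleG G (obs m z q) (Γ q j)) =
        Real.sign (√(q.1 : ℝ) * sampleG G (obs m z q) (Γ q j)) := by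
      rcases lt_trichotomy (sampleG G (obs m z q) (Γ q j)) 0 with h | h | h
      · rw [Real.sign_of_neg h, Real.sign_of_neg (mul_neg_of_pos_of_neg hsq h)]
      · rw [h, mul_zero]
      · rw [Real.sign_of_pos h, Real.sign_of_pos (mul_pos hsq h)]
    rw [hscale]
    refine sign_eq_sumSign hpos ?_
    rw [← hsum]
    refine lt_of_eq_of_lt (congrArg _ ?_) h1
    rw [key, h2, constraint_idArr, Matrix.sub_apply, Matrix.one_apply_eq, sampleCov_obs, hDe]
    simp only [_root_.add_apply, coord_apply, smul_eq_mul, Pi.sub_apply]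
    ring
  · have ht := hD.tendsto_eval (hM.tendsto_sampleG m j) hΓ
    simp only [refSign, if_neg hν]
    exact eventually_sign_eq_of_tendsto hν ht

/-- Weights given by signs. -/
lemma weights_sign (hM : Model P G z)
    (hnonneg : ∀ j, 0 ≤ nu P G (z 0) j * (lam P G (z 0) j - del P G (z 0) j))
    (hone : ∀ j l, nu P G (z 0) j * (lam P G (z 0) j - del P G (z 0) j) = 0 →
      nu P G (z 0) l * (lam P G (z 0) l - del P G (z 0) l) = 0 → j = l)
    (heq : ∀ j, nu P G (z 0) j = 0 → lam P G (z 0) j = del P G (z 0) j)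
    {σ : ℕ × Ω → Fin p → ℝ} (hσ : ∀ q k, |σ q k| ≤ 1)
    (hσ' : ∀ q k, nu P G (z 0) k ≠ 0 → σ q k = Real.sign (nu P G (z 0) k)) :
    Weights P G z m (symKappa P G z) (fun q j _ => σ q j) (fun q _ j _ => σ q j) := by
  refine hM.weights_of_bdd ⟨1, fun q j _ => hσ q j⟩ (fun q j l _ => ?_) (fun j l hjl h0 => ?_)
  · have h : ∀ k, σ q k * (del P G (z 0) k - lam P G (z 0) k) =
        Real.sign (nu P G (z 0) k) * (del P G (z 0) k - lam P G (z 0) k) := by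
      intro k
      by_cases hk : nu P G (z 0) k = 0
      · rw [heq k hk]
        simp
      · rw [hσ' q k hk]
    simp only [symKappa, kappa, h]
  · have h1 : ∀ k, 0 ≤ Real.sign (nu P G (z 0) k) * (lam P G (z 0) k - del P G (z 0) k) := by
      intro k
      have h := hnonneg k
      rcases lt_trichotomy (nu P G (z 0) k) 0 with hk | hk | hk
      · rw [Real.sign_of_neg hk]
        nlinarith
      · simp [hk]
      · rw [Real.sign_of_pos hk]
        nlinarith
    have h2 : ∀ k, Real.sign (nu P G (z 0) k) * (lam P G (z 0) k - del P G (z 0) k) = 0 →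
        nu P G (z 0) k * (lam P G (z 0) k - del P G (z 0) k) = 0 := by
      intro k hk
      rcases mul_eq_zero.mp hk with h | h
      · rw [Real.sign_eq_zero_iff.mp h, zero_mul]
      · rw [h, mul_zero]
    simp only [symKappa, kappa] at h0
    have hj := h1 j
    have hl := h1 l
    exact hjl (hone j l (h2 j (by linarith)) (h2 l (by linarith)))

end Model

/-! ### Random sign in the leading term, and the symmetric equations -/

namespace Model

variable {Ω : Type*} [MeasurableSpace Ω] {P : Measure Ω} {p : ℕ} {G : ℝ → ℝ}
  {z : ℕ → Ω → Fin p → ℝ} {m : Fin p → ℝ} {κ : Fin p → Fin p → ℝ} {J : Fin p} {τ : Fin p → ℝ}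

/-- The part of the influence function that carries the sign of the component `J`. -/
def signedPart (P : Measure Ω) (G : ℝ → ℝ) (z : ℕ → Ω → Fin p → ℝ) (κ : Fin p → Fin p → ℝ)
    (J j l : Fin p) (y : Fin p → ℝ) : ℝ :=
  if j = l then 0
  else if l = J then (κ j l)⁻¹ * (score P G z J (lam P G (z 0) J) (y J) * y j)
  else if j = J then -(κ j l)⁻¹ * (score P G z J (lam P G (z 0) J) (y J) * y l)
  else 0

/-- The part of the influence function that is free of the sign of the component `J` and does not
depend on this component only. -/
def unsignedPart (P : Measure Ω) (G : ℝ → ℝ) (z : ℕ → Ω → Fin p → ℝ) (κ : Fin p → Fin p → ℝ)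
    (τ : Fin p → ℝ) (J j l : Fin p) (y : Fin p → ℝ) : ℝ :=
  if j = l then if j = J then 0 else -(1 / 2) * (y j ^ 2 - 1)
  else (κ j l)⁻¹ *
    ((if l = J then 0 else τ l * (score P G z l (del P G (z 0) l) (y l) * y j)) +
      if j = J then 0 else -τ j * (score P G z j (lam P G (z 0) j) (y j) * y l))

/-- The part of the influence function that depends on the component `J` only. -/
def squarePart (J j l : Fin p) (x : ℝ) : ℝ :=
  if j = l then if j = J then -(1 / 2) * (x ^ 2 - 1) else 0 else 0

/-- The score of J enters with slope δ_J in column J and with slope λ_J in row J. Equality of the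
slopes lets all terms carrying the sign use the λ-score, to which the orthogonality applies. -/
lemma influence_eq (heq : lam P G (z 0) J = del P G (z 0) J) (s : ℝ) (j l : Fin p)
    (y : Fin p → ℝ) :
    influence P G z κ (Function.update τ J s) j l y = s * signedPart P G z κ J j l y +
      (unsignedPart P G z κ τ J j l y + squarePart J j l (y J)) := by
  by_cases hjl : j = l
  · subst hjl
    by_cases hj : j = J
    · subst hj
      simp [influence, signedPart, unsignedPart, squarePart]
    · simp [influence, signedPart, unsignedPart, squarePart, hj]
  · by_cases hl : l = J
    · subst hl
      simp only [influence, signedPart, unsignedPart, squarePart, hjl, if_false, if_true,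
        Function.update_self, Function.update_of_ne hjl, heq]
      ring
    · by_cases hj : j = J
      · subst hj
        simp only [influence, signedPart, unsignedPart, squarePart, hjl, hl, if_false, if_true,
          Function.update_self, Function.update_of_ne hl]
        ring
      · simp only [influence, signedPart, unsignedPart, squarePart, hjl, hl, hj, if_false,
          Function.update_of_ne hl, Function.update_of_ne hj]
        ring

lemma signedPart_eq (j l : Fin p) : signedPart P G z κ J j l = (fun _ => 0) ∨
    ∃ (c : ℝ) (k : Fin p), k ≠ J ∧ signedPart P G z κ J j l =
      fun y => c * (score P G z J (lam P G (z 0) J) (y J) * y k) := by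
  by_cases hjl : j = l
  · left
    ext y
    simp [signedPart, hjl]
  · by_cases hl : l = J
    · subst hl
      refine Or.inr ⟨(κ j l)⁻¹, j, hjl, ?_⟩
      ext y
      simp only [signedPart, hjl, if_false, if_true]
    · by_cases hj : j = J
      · refine Or.inr ⟨-(κ j l)⁻¹, l, hl, ?_⟩
        ext y
        rw [signedPart, if_neg hjl, if_neg hl, if_pos hj]
      · left
        ext y
        simp [signedPart, hjl, hl, hj]

lemma measurable_squarePart (j l : Fin p) : Measurable (squarePart J j l) := by
  unfold squarePart
  split_ifs <;> fun_prop

variable [IsProbabilityMeasure P]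

lemma condCentered_signedPart (hM : Model P G z) (j l : Fin p) :
    CondCentered P z J (signedPart P G z κ J j l) := by
  rcases signedPart_eq (P := P) (G := G) (z := z) (κ := κ) (J := J) j l with h | ⟨c, k, hk, h⟩
  · rw [h]
    exact CondCentered.zero
  · rw [h]
    exact (hM.condCentered_mul J hk.symm (hM.measurable_score J _) (hM.memLp_score J _)
      (hM.integral_score J _)).const_mul c

lemma orthCentered_unsignedPart (hM : Model P G z) (j l : Fin p) :
    OrthCentered P G z J (unsignedPart P G z κ τ J j l) := by
  unfold unsignedPart
  by_cases hjl : j = l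
  · simp only [hjl, if_true]
    split_ifs with h
    · exact OrthCentered.zero
    · exact (hM.orthCentered_sq h).const_mul _
  · simp only [hjl, if_false]
    refine OrthCentered.const_mul (OrthCentered.add hM ?_ ?_) _
    · split_ifs with h
      · exact OrthCentered.zero
      · exact (hM.orthCentered_score_mul (Ne.symm hjl) h _).const_mul _
    · split_ifs with h
      · exact OrthCentered.zero
      · exact (hM.orthCentered_score_mul hjl h _).const_mul _

lemma integral_signedPart_mul (hM : Model P G z) (j l j' l' : Fin p) :
    ∫ ω, signedPart P G z κ J j l (z 0 ω) * unsignedPart P G z κ τ J j' l' (z 0 ω) ∂P = 0 := by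
  rcases signedPart_eq (P := P) (G := G) (z := z) (κ := κ) (J := J) j l with h | ⟨c, k, hk, h⟩
  · simp [h]
  · simp only [h, mul_assoc c]
    rw [integral_const_mul, (hM.orthCentered_unsignedPart j' l').orth k hk, mul_zero]

/-- The leading term with the asymptotic signs of the empirical contrasts has a normal limit. -/
lemma exists_leading (hM : Model P G z)
    (hjoint : IsAsympNormal P (jointStat P G z (icObs m 1 z)))
    (hone : ∀ j l, nu P G (z 0) j * (lam P G (z 0) j - del P G (z 0) j) = 0 →
      nu P G (z 0) l * (lam P G (z 0) l - del P G (z 0) l) = 0 → j = l)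
    (heq : ∀ j, nu P G (z 0) j = 0 → lam P G (z 0) j = del P G (z 0) j) :
    ∃ N : ℕ × Ω → Fin p → Fin p → ℝ,
      IsAsympNormal P (fun n ω (c : Fin p × Fin p) => -N (n, ω) c.2 c.1) ∧
      Tendsto (fun q => N q - leadStat P G z m κ
        (fun q j _ => refSign P G z m q.1 (obs m z q) j) q) (whp P) (𝓝 0) := by
  set τ : Fin p → ℝ := fun k => Real.sign (nu P G (z 0) k) with hτ
  by_cases hex : ∃ J, nu P G (z 0) J = 0
  swap
  -- Without a vanishing ν_k the reference signs are constants, and the leading term is a fixed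
  -- linear image of the joint statistic.
  · have hne : ∀ k, nu P G (z 0) k ≠ 0 := fun k hk => hex ⟨k, hk⟩
    refine ⟨leadStat P G z m κ (fun q j _ => refSign P G z m q.1 (obs m z q) j), ?_,
      by simpa only [sub_self] using tendsto_const_nhds⟩
    have e : (fun (q : ℕ × Ω) (j _ : Fin p) => refSign P G z m q.1 (obs m z q) j) =
        fun _ j _ => τ j := by
      funext q j l
      simp [refSign, hne j, hτ]
    rw [e]
    exact hjoint.comp_clm (linStatL (lam P G (z 0)) (del P G (z 0)) κ (fun j _ => τ j))
  obtain ⟨J, hJ⟩ := hex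
  have huniq : ∀ k, k ≠ J → nu P G (z 0) k ≠ 0 := fun k hk h0 =>
    hk (hone k J (by rw [h0, zero_mul]) (by rw [hJ, zero_mul]))
  set S : (n : ℕ) → (Fin n → ℝ) → ℝ := sumSign (contrastResid P G z J) with hS
  have hsum : ∀ (s : ℝ) (q : ℕ × Ω) (j l : Fin p), (√(q.1 : ℝ))⁻¹ *
      ∑ i : Fin q.1, (s * signedPart P G z κ J j l (z i q.2) +
        (unsignedPart P G z κ τ J j l (z i q.2) + squarePart J j l (z i q.2 J))) =
      √(q.1 : ℝ) * empMean z (influence P G z κ (Function.update τ J s) j l) q := by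
    intro s q j l
    simp only [← influence_eq (heq J hJ), empMean]
    rw [← mul_assoc, sqrt_mul_inv, Fin.sum_univ_eq_sum_range
      (fun i => influence P G z κ (Function.update τ J s) j l (z i q.2)) q.1]
  have hτ1 : ∀ s : ℝ, |s| ≤ 1 → ∀ k, |Function.update τ J s k| ≤ 1 := by
    intro s hs k
    by_cases hk : k = J
    · subst hk
      simpa using hs
    · rw [Function.update_of_ne hk]
      exact abs_sign_le _
  -- With the sign of J frozen at +1 the limit is normal by linearity; `isAsympNormal_sign` then
  -- transfers the same limit law to the random sign.
  have hbase := hjoint.comp_clm (linStatL (lam P G (z 0)) (del P G (z 0)) κ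
    (fun j _ => Function.update τ J 1 j))
  have hY : IsAsympNormal P (fun n ω (c : Fin p × Fin p) => (√(n : ℝ))⁻¹ *
      ∑ i : Fin n, (signedPart P G z κ J c.2 c.1 (z i ω) +
        (unsignedPart P G z κ τ J c.2 c.1 (z i ω) + squarePart J c.2 c.1 (z i ω J)))) := by
    refine hbase.congr_of_tendsto (fun n => ?_) (tendsto_pi_nhds.mpr fun c => ?_)
    · refine Measurable.aemeasurable (measurable_pi_iff.mpr fun c => Measurable.const_mul ?_ _)
      refine Finset.measurable_sum _ fun i _ => ?_
      have hz := hM.sample.measurable i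
      exact ((hM.condCentered_signedPart c.2 c.1).measurable.comp hz).add
        (((hM.orthCentered_unsignedPart c.2 c.1).centered.measurable.comp hz).add
          ((measurable_squarePart c.2 c.1).comp ((measurable_pi_apply J).comp hz)))
    · refine (hM.tendsto_leadStat_add_empMean (m := m) (κ := κ)
        (σ := fun _ => Function.update τ J 1) (fun _ => hτ1 1 (by simp)) c.2 c.1).congr fun q => ?_
      have h1 := hsum 1 q c.2 c.1
      simp only [one_mul] at h1
      simp only [Pi.sub_apply, h1, linStatL_apply, leadStat]
      ring
  have hY' := hM.sample.isAsympNormal_sign (J := J)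
    (u := fun c : Fin p × Fin p => signedPart P G z κ J c.2 c.1)
    (v := fun c => unsignedPart P G z κ τ J c.2 c.1) (w := fun c => squarePart J c.2 c.1)
    (fun c => hM.condCentered_signedPart c.2 c.1)
    (fun c => (hM.orthCentered_unsignedPart c.2 c.1).centered)
    (fun c => measurable_squarePart c.2 c.1)
    (fun c c' => hM.integral_signedPart_mul c.2 c.1 c'.2 c'.1)
    (fun n => measurable_sumSign (hM.measurable_contrastResid J) n)
    (fun n x => sumSign_eq_or (contrastResid P G z J) n x) hY
  have href : ∀ q : ℕ × Ω, refSign P G z m q.1 (obs m z q) =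
      Function.update τ J (S q.1 fun k => z k q.2 J) := by
    intro q
    ext k
    by_cases hk : k = J
    · subst hk
      rw [refSign_obs q hJ, Function.update_self]
    · simp [refSign, huniq k hk, Function.update_of_ne hk, hτ]
  refine ⟨fun q j l => -((√(q.1 : ℝ))⁻¹ * ∑ i : Fin q.1,
    (S q.1 (fun k => z k q.2 J) * signedPart P G z κ J j l (z i q.2) +
      (unsignedPart P G z κ τ J j l (z i q.2) + squarePart J j l (z i q.2 J)))), ?_, ?_⟩
  · simpa only [neg_neg] using hY'
  · refine tendsto_pi_nhds.mpr fun j => tendsto_pi_nhds.mpr fun l => ?_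
    have h := (hM.tendsto_leadStat_add_empMean (m := m) (κ := κ)
      (σ := fun q => refSign P G z m q.1 (obs m z q)) (fun q => abs_refSign_le q.1 _) j l).neg
    rw [neg_zero] at h
    refine h.congr fun q => ?_
    simp only [Pi.sub_apply, hsum, ← href]
    ring

/-- Symmetric FastICA. -/
lemma symmetric (hM : Model P G z)
    (hjoint : IsAsympNormal P (jointStat P G z (icObs m 1 z)))
    (hnonneg : ∀ j, 0 ≤ nu P G (z 0) j * (lam P G (z 0) j - del P G (z 0) j))
    (hone : ∀ j l, nu P G (z 0) j * (lam P G (z 0) j - del P G (z 0) j) = 0 →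
      nu P G (z 0) l * (lam P G (z 0) l - del P G (z 0) l) = 0 → j = l)
    (h : ∀ j : Fin p, nu P G (z 0) j = 0 → lam P G (z 0) j = del P G (z 0) j ∧
      ¬ ∀ᵐ ω ∂P, G (z 0 ω j) = mu P G (z 0) j * z 0 ω j +
        lam P G (z 0) j / 2 * (z 0 ω j ^ 2 - 1)) :
    SolutionsAsympNormal P (icObs m 1 z) (fun _ x Γ => IsSymmetricSolution G x Γ) := by
  have heq : ∀ j, nu P G (z 0) j = 0 → lam P G (z 0) j = del P G (z 0) j := fun j hj => (h j hj).1
  have hdeg : ∀ j, nu P G (z 0) j = 0 →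
      ¬ ∀ᵐ ω ∂P, contrastResid P G z j (z 0 ω j) = 0 := by
    intro j hj h0
    refine (h j hj).2 ?_
    filter_upwards [h0] with ω hω
    unfold contrastResid at hω
    linarith
  have hsol : ∀ {n : ℕ} {x : Fin n → Fin p → ℝ} {Γ : Matrix (Fin p) (Fin p) ℝ} {σ : Fin p → ℝ},
      (∀ j, Real.sign (sampleG G x (Γ j)) = σ j) → (IsSymmetricSolution G x Γ ↔
        Γ * sampleCov x * Γᵀ = 1 ∧ ∀ j l, σ j * (Γ l ⬝ᵥ sampleT G x (Γ j)) =
          σ l * (Γ j ⬝ᵥ sampleT G x (Γ l))) := by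
    intro n x Γ σ hσ
    rw [IsSymmetricSolution, and_comm]
    simp only [hσ, mul_comm (σ _)]
  have hcon : ∀ {n : ℕ} {x : Fin n → Fin p → ℝ} {Γ : Matrix (Fin p) (Fin p) ℝ},
      Γ * sampleCov x * Γᵀ = 1 → ∀ j, constraint x Γ j j = 0 := by
    intro n x Γ hΓ j
    rw [constraint_eq, hΓ, sub_self]
    rfl
  -- For existence, the equations are solved first with signs that are measurable in the data and do
  -- not depend on Γ. They may involve m and the law of z, since an `Estimator` only has to be a
  -- measurable function of the data.
  set σ₀ : ℕ × Ω → Fin p → ℝ := fun q => refSign P G z m q.1 (obs m z q) with hσ₀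
  have hW₀ : Weights P G z m (symKappa P G z) (fun q j _ => σ₀ q j) (fun q _ j _ => σ₀ q j) :=
    hM.weights_sign hnonneg hone heq (fun q k => abs_refSign_le q.1 _ k)
      (fun q k hk => by simp [hσ₀, refSign, hk])
  constructor
  · obtain ⟨Γ, h1, h2⟩ := hW₀.exists_estimator hM hjoint
      (fun n x Γ => estFun G (lam P G (z 0)) (del P G (z 0)) (symKappa P G z)
        (fun j _ => refSign P G z m n x j) (fun j _ => refSign P G z m n x j) x Γ)
      (fun n => by
        have hr : Measurable fun (x : Fin n → Fin p → ℝ) (j _ : Fin p) => refSign P G z m n x j :=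
          measurable_pi_iff.mpr fun j => measurable_pi_iff.mpr fun l => hM.measurable_refSign n j
        exact measurable_estFun hM.continuous_g _ _ _ hr (hr.comp measurable_fst))
      (fun q Γ => rfl)
    -- The rate √n shows that the actual signs at this zero are the reference signs, so it solves
    -- the genuine equations.
    have h3 := (hW₀.expansion hM hjoint h1 h2).1
    have h4 : ∀ᶠ q in whp P, _ := h2.mono fun q hq =>
      (estFun_eq_zero_iff (hW₀.kappa_eq q) hW₀.kappa_ne (Γ := evalObs Γ m z q)).mp hq
    have h5 : ∀ᶠ q in whp P, ∀ j, Real.sign (sampleG G (obs m z q) (evalObs Γ m z q j)) = σ₀ q j :=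
      eventually_all.mpr fun j => hM.eventually_sign_eq hdeg h1 h3 j
        (h4.mono fun q hq => hcon hq.1 j)
    refine ⟨Γ, isConsistentSolution_iff.mpr ⟨h1, ?_⟩⟩
    filter_upwards [h4, h5] with q h6 h7
    exact (hsol h7).mpr h6
  · intro Γ hΓ
    obtain ⟨h1, h2⟩ := isConsistentSolution_iff.mp hΓ
    -- The signs realized by the given solution serve as weights where ν_k = 0. They need no
    -- measurability or limit, since κ does not see them, and the resulting rate √n identifies them
    -- with the reference signs only afterwards.
    set σ : ℕ × Ω → Fin p → ℝ := fun q k => if nu P G (z 0) k = 0 then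
      Real.sign (sampleG G (obs m z q) (evalObs Γ m z q k)) else Real.sign (nu P G (z 0) k) with hσ
    have hW : Weights P G z m (symKappa P G z) (fun q j _ => σ q j) (fun q _ j _ => σ q j) := by
      refine hM.weights_sign hnonneg hone heq (fun q k => ?_) (fun q k hk => by simp [hσ, hk])
      simp only [hσ]
      split_ifs <;> exact abs_sign_le _
    have h3 : ∀ᶠ q in whp P, ∀ j,
        Real.sign (sampleG G (obs m z q) (evalObs Γ m z q j)) = σ q j := by
      refine eventually_all.mpr fun j => ?_
      by_cases hj : nu P G (z 0) j = 0
      · exact Eventually.of_forall fun q => by simp [hσ, hj]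
      · obtain ⟨D, hD, -⟩ := hM.hasSDeriv_sampleG m j
        filter_upwards [eventually_sign_eq_of_tendsto hj
          (hD.tendsto_eval (hM.tendsto_sampleG m j) h1)] with q hq
        simp [hσ, hj, hq]
    have h4 : ∀ᶠ q in whp P, estFun G (lam P G (z 0)) (del P G (z 0)) (symKappa P G z)
        (fun j _ => σ q j) (fun j _ => σ q j) (obs m z q) (evalObs Γ m z q) = 0 := by
      filter_upwards [h2, h3] with q h5 h6
      exact (estFun_eq_zero_iff (hW.kappa_eq q) hW.kappa_ne).mpr ((hsol h6).mp h5)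
    obtain ⟨h5, h6⟩ := hW.expansion hM hjoint h1 h4
    have h7 : ∀ᶠ q in whp P, ∀ j, Real.sign (sampleG G (obs m z q) (evalObs Γ m z q j)) = σ₀ q j :=
      eventually_all.mpr fun j => hM.eventually_sign_eq hdeg h1 h5 j
        (h2.mono fun q hq => hcon hq.2 j)
    obtain ⟨N, hN, hN'⟩ := hM.exists_leading (κ := symKappa P G z) hjoint hone heq
    refine hM.isAsympNormal_scaledError hN ?_
    have h8 := h6.add hN'
    rw [add_zero] at h8
    refine h8.congr' ?_
    filter_upwards [h3, h7] with q h9 h10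
    have e : σ q = σ₀ q := by
      ext j
      rw [← h9, h10]
    have e' : leadStat P G z m (symKappa P G z) (fun q j _ => σ q j) q =
        leadStat P G z m (symKappa P G z) (fun q j _ => σ₀ q j) q := by
      simp only [leadStat, e]
    rw [e']
    abel

end Model

end FastICA

end

theorem corollary1 {Ω : Type*} [MeasurableSpace Ω] (P : Measure Ω) [IsProbabilityMeasure P]
    (p : ℕ) (G : ℝ → ℝ) (hG : FastICA.IsContrast G)
    -- the latent sample, the location, and the observed sample with mixing matrix `I_p`
    (z : ℕ → Ω → Fin p → ℝ) (m : Fin p → ℝ) (X : ℕ → Ω → Fin p → ℝ)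
    (hX : X = FastICA.icObs m 1 z) (hz : FastICA.IsICSample P z)
    (hA1 : FastICA.AtMostOneGaussian P (z 0))
    (hA2 : FastICA.IsStandardized P (z 0))
    (hA3 : FastICA.HasMoments P G (z 0))
    (hdom : FastICA.LocallyDominated P G (z 0))
    -- `ν_j (λ_j - δ_j) ≥ 0`, with equality for at most one `j`
    (hnonneg : ∀ j, 0 ≤ FastICA.nu P G (z 0) j *
      (FastICA.lam P G (z 0) j - FastICA.del P G (z 0) j))
    (hone : ∀ j l,
      FastICA.nu P G (z 0) j * (FastICA.lam P G (z 0) j - FastICA.del P G (z 0) j) = 0 →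
      FastICA.nu P G (z 0) l * (FastICA.lam P G (z 0) l - FastICA.del P G (z 0) l) = 0 → j = l)
    (hjoint : FastICA.IsAsympNormal P (FastICA.jointStat P G z X)) :
    -- deflation-based; the last extracted component may have `λ_p = δ_p`
    ((∀ j : Fin p, (j : ℕ) + 1 < p → FastICA.lam P G (z 0) j ≠ FastICA.del P G (z 0) j) →
      FastICA.SolutionsAsympNormal P X (fun _ x Γ => FastICA.IsDeflationSolution G x Γ)) ∧
    -- symmetric; if `ν_j = 0`, then `λ_j = δ_j` and the first-order term of the sample analogue
    -- of `ν_j`, which determines its sign, is not degenerate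
    ((∀ j : Fin p, FastICA.nu P G (z 0) j = 0 →
        FastICA.lam P G (z 0) j = FastICA.del P G (z 0) j ∧
        ¬ ∀ᵐ ω ∂P, G (z 0 ω j) = FastICA.mu P G (z 0) j * z 0 ω j +
          FastICA.lam P G (z 0) j / 2 * (z 0 ω j ^ 2 - 1)) →
      FastICA.SolutionsAsympNormal P X (fun _ x Γ => FastICA.IsSymmetricSolution G x Γ)) ∧
    -- squared symmetric
    FastICA.SolutionsAsympNormal P X (fun _ x Γ => FastICA.IsSquaredSymmetricSolution G x Γ) := by
  subst hX
  have hM : FastICA.Model P G z := ⟨hG, hz, hA2, hA3, hdom⟩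
  exact ⟨hM.deflation hjoint, hM.symmetric hjoint hnonneg hone,
    hM.squaredSymmetric hjoint hnonneg hone⟩
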